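/- **Setting.** Let $Z$ be a set of outcomes, $L$ the set of finitely supported probability distributions (lotteries) on $Z$, $\Omega$ a state space with an algebra $\Sigma$ of events, and $F$ the set of acts: $\Sigma$-measurable maps $f:\Omega\to L$ with finitely many values. $F_c\subseteq F$ is the set of constant acts, identified with $L$; mixtures of acts are statewise, and $f_Eg$ is the act equal to $f$ on $E$ and to $g$ off $E$. Let $\succsim$ and $\succsim'$ be two binary relations on $F$; $\succ,\sim$ are the strict and symmetric parts of $\succsim$. Write $f\ge g$ if $f(\omega)\succsim g(\omega)$ for all $\omega$. An act is *well-understood* if it is $\sim$ to a constant act. An event $E$ is *non-null* if $c^2_Ec^1\succ c^3_Ec^1$ for some constant $c^1,c^2,c^3$, and null otherwise. The *partition* of $f$ has as cells the classes of states at which $f$ gives $\sim$-indifferent lotteries. $P$ denotes a finitely additive probability on $\Sigma$. *Basic Conditions* on $\succsim$. Preorder: reflexive and transitive. Monotonicity: $f\ge g$ implies $f\succsim g$. Archimedean Continuity: for all $f,g,h\in F$ the sets $\{\lambda\in[0,1]:\lambda f+(1-\lambda)g\succsim h\}$ and $\{\lambda\in[0,1]:h\succsim\lambda f+(1-\lambda)g\}$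 are closed. Nontriviality: $f\succ g$ for some $f,g$. C-Completeness: $\succsim$ is complete on $F_c$. Weak C-Independence: for $c_1,c_2\in F_c$, $f\in F$, $\alpha\in(0,1)$: $f\succsim c_1$ iff $\alpha f+(1-\alpha)c_2\succsim\alpha c_1+(1-\alpha)c_2$, and the same with $\precsim$. *Simplicity Conditions.* (A0) For every $E\in\Sigma$ there are constant $c\succ d$ with $c_Ed$ well-understood. For every well-understood $f$ with partition $\tau$: (A1) every partition coarser than $\tau$ is the partition of some well-understood act; (A2) if $g$ is well-understood, $g$ is measurable with respect to $\tau$ (up to indifference of lotteries), and for some $a\in f(\Omega)$ every $\omega$ has $g(\omega)=f(\omega)$ or $g(\omega)=a$, then $\alpha f+(1-\alpha)g$ is well-understood for all $\alpha\in(0,1)$; (A3) for all non-null $T\ne T'$ in $\tau$ and every partition $\tau'$ of $T\cup T'$ into two (nonempty) events, some well-understood act has partition $\tau'\cup(\tau\setminus\{T,T'\})$; (A4) if $E$ is null then $g_Ef\sim f$ for all $g\in F$. *S-Independence.* If $f,g,h$, $\alpha f+(1-\alpha)h$ and $\alpha g+(1-\alpha)h$ are well-understood, $\alpha\in(0,1)$,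 then $f\succsim g$ iff $\alpha f+(1-\alpha)h\succsim\alpha g+(1-\alpha)h$. *Uniform Comparability.* If not $f\ge g$, then $f\succsim g$ iff $f\ge h\succsim k\ge g$ for some well-understood $h,k$. *Consistency.* $f\succsim g$ implies $f\succsim' g$. *Strong Consistency for Simple Acts.* For acts $f,g$ that are well-understood (with respect to $\succsim$), $f\succsim g$ iff $f\succsim' g$. *Caution.* For $f\in F$ and constant $h$, if not $f\succsim h$ then $h\succsim' f$. *Representations.* Let $N\in\{2,3,\dots\}\cup\{\infty\}$, $P$ a finitely additive probability on $\Sigma$, $u:Z\to\mathbb R$ non-constant, and let $E_lu$ be the expected utility of the lottery $l$. An act $f$ is $N$-simple if $\omega\mapsto E_{f(\omega)}u$ takes at most $N$ values. $\mathrm{siminf}_{N,f}$ is the set of $N$-simple acts $h$ with $E_{h(\omega)}u\le E_{f(\omega)}u$ outside a $P$-null event that have maximal $\int_\Omega E_{h(\omega)}u\,dP(\omega)$ among such acts; $\mathrm{simsup}_{N,f}$ is the set of $N$-simple acts $h$ with $E_{h(\omega)}u\ge E_{f(\omega)}u$ outside a $P$-null event that have minimal $\int_\Omega E_{h(\omega)}u\,dP(\omega)$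 among such acts. $\succsim$ has a *Simple Bounds representation* with parameters $P,u,N$ if for all $f,g\in F$: $f\succsim g$ iff $E_{f(\omega)}u\ge E_{g(\omega)}u$ for all $\omega$, or $\int E_{\mathrm{siminf}_{N,f}(\omega)}u\,dP\ge\int E_{\mathrm{simsup}_{N,g}(\omega)}u\,dP$. $\succsim'$ has a *Cautious representation* with parameters $P,u,N$ if for all $f,g\in F$: $f\succsim' g$ iff $\int E_{\mathrm{siminf}_{N,f}(\omega)}u\,dP\ge\int E_{\mathrm{siminf}_{N,g}(\omega)}u\,dP$. **Theorem.** The following are equivalent: (i) $\succsim$ satisfies the Basic Conditions, the Simplicity Conditions, S-Independence and Uniform Comparability; $\succsim'$ is a preorder and satisfies Archimedean Continuity; and $\succsim,\succsim'$ jointly satisfy Consistency, Strong Consistency for Simple Acts and Caution. (ii) $\succsim$ has a Simple Bounds representation and $\succsim'$ has a Cautious representation, with common parameters $P,u,N$. Moreover, for every such common representation $P,u,N$: the sets $\mathrm{siminf}_{N,f}$ and $\mathrm{simsup}_{N,f}$ are non-empty for all $f\in F$; every other common representation $P',u',N'$ has $P'=P$ on $\Sigma$ and $u'=au+b$ for some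 $a>0$, $b\in\mathbb R$; and for all $a>0$, $b\in\mathbb R$, the parameters $P,\,au+b,\,N$ also give a common representation. -/

import Mathlib

open scoped NNReal

namespace SimpleBounds

/-- Lotteries over the outcome set `Z`: probability distributions with finite support. -/
abbrev Lottery (Z : Type*) := Convexity.StdSimplex ℝ Z

/-- The mixture `t p + (1 - t) q` of two lotteries, `t ∈ [0,1]`. -/
noncomputable def Lottery.mix {Z : Type*} (t : unitInterval) (p q : Lottery Z) : Lottery Z :=
  Convexity.convexCombPair (t : ℝ) (1 - t) t.2.1 (sub_nonneg.2 t.2.2) (by ring) p q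

/-- The expected utility `E_p u` of the lottery `p`. -/
noncomputable def util {Z : Type*} (u : Z → ℝ) (p : Lottery Z) : ℝ :=
  p.weights.sum fun z r => r * u z

/-- Acts: finitely valued maps from the state space to lotteries that are measurable with respect
to the algebra of events `Sig`. -/
structure Act {Ω : Type*} (Z : Type*) (Sig : BooleanSubalgebra (Set Ω)) where
  toFun : Ω → Lottery Z
  finite_range : (Set.range toFun).Finite
  measurable : ∀ p : Lottery Z, toFun ⁻¹' {p} ∈ Sig

theorem isSetAlgebra {Ω : Type*} (Sig : BooleanSubalgebra (Set Ω)) :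
    MeasureTheory.IsSetAlgebra (Sig : Set (Set Ω)) where
  empty_mem := Sig.bot_mem
  compl_mem _ h := BooleanSubalgebra.compl_mem h
  union_mem _ _ hs ht := BooleanSubalgebra.sup_mem hs ht

namespace Act

variable {Ω Z : Type*} {Sig : BooleanSubalgebra (Set Ω)}

instance : CoeFun (Act Z Sig) (fun _ => Ω → Lottery Z) := ⟨Act.toFun⟩

theorem preimage_mem (f : Act Z Sig) (S : Set (Lottery Z)) : f ⁻¹' S ∈ Sig := by
  classical
  have h : f ⁻¹' S = ⋃ p ∈ f.finite_range.toFinset.filter (· ∈ S), f ⁻¹' {p} := by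
    ext ω
    simp
  rw [h]
  exact (isSetAlgebra Sig).biUnion_mem _ fun p _ => f.measurable p

/-- The constant act with value `p`. -/
def const (Sig : BooleanSubalgebra (Set Ω)) (p : Lottery Z) : Act Z Sig where
  toFun _ := p
  finite_range := (Set.finite_singleton p).subset (by rintro _ ⟨_, rfl⟩; rfl)
  measurable q := by
    by_cases h : p = q
    · have : (fun _ : Ω => p) ⁻¹' {q} = Set.univ := by ext; simp [h]
      rw [this]
      exact (isSetAlgebra Sig).univ_mem
    · have : (fun _ : Ω => p) ⁻¹' {q} = ∅ := by ext; simp [h]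
      rw [this]
      exact (isSetAlgebra Sig).empty_mem

/-- The statewise mixture `t f + (1 - t) g`, `t ∈ [0,1]`. -/
noncomputable def mix (t : unitInterval) (f g : Act Z Sig) : Act Z Sig where
  toFun ω := Lottery.mix t (f ω) (g ω)
  finite_range :=
    (f.finite_range.image2 (Lottery.mix t) g.finite_range).subset (by
      rintro _ ⟨ω, rfl⟩
      exact ⟨f ω, ⟨ω, rfl⟩, g ω, ⟨ω, rfl⟩, rfl⟩)
  measurable q := by
    have h : (fun ω => Lottery.mix t (f ω) (g ω)) ⁻¹' {q} =
        ⋃ p ∈ f.finite_range.toFinset, (f ⁻¹' {p} ∩ g ⁻¹' {r | Lottery.mix t p r = q}) := by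
      ext ω
      simp only [Set.mem_preimage, Set.mem_singleton_iff, Set.mem_iUnion, Set.mem_inter_iff,
        Set.mem_ofPred_eq, Set.Finite.mem_toFinset, exists_prop]
      exact ⟨fun h => ⟨f ω, ⟨ω, rfl⟩, rfl, h⟩, fun ⟨p, _, hp, h⟩ => hp ▸ h⟩
    rw [h]
    exact (isSetAlgebra Sig).biUnion_mem _ fun p _ =>
      (isSetAlgebra Sig).inter_mem (f.measurable p) (g.preimage_mem _)

open Classical in
/-- The act `f_E g`, equal to `f` on the event `E` and to `g` elsewhere. -/
noncomputable def splice (E : Sig) (f g : Act Z Sig) : Act Z Sig where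
  toFun ω := if ω ∈ (E : Set Ω) then f ω else g ω
  finite_range := (f.finite_range.union g.finite_range).subset (by
    rintro _ ⟨ω, rfl⟩
    dsimp only
    split_ifs
    · exact Or.inl ⟨ω, rfl⟩
    · exact Or.inr ⟨ω, rfl⟩)
  measurable q := by
    have h : (fun ω => if ω ∈ (E : Set Ω) then f ω else g ω) ⁻¹' {q} =
        ((E : Set Ω) ∩ f ⁻¹' {q}) ∪ ((E : Set Ω)ᶜ ∩ g ⁻¹' {q}) := by
      ext ω
      rw [Set.mem_preimage]
      by_cases hω : ω ∈ (E : Set Ω)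
      · rw [if_pos hω]
        exact ⟨fun h => Or.inl ⟨hω, h⟩, fun h => h.elim And.right fun h => absurd hω h.1⟩
      · rw [if_neg hω]
        exact ⟨fun h => Or.inr ⟨hω, h⟩, fun h => h.elim (fun h => absurd h.1 hω) And.right⟩
    rw [h]
    exact (isSetAlgebra Sig).union_mem ((isSetAlgebra Sig).inter_mem E.2 (f.measurable q))
      ((isSetAlgebra Sig).inter_mem ((isSetAlgebra Sig).compl_mem E.2) (g.measurable q))

end Act

section Axioms

/-! Notions and axioms for a binary relation `R` on acts; `R f g` reads `f ≿ g`. -/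

variable {Ω Z : Type*} {Sig : BooleanSubalgebra (Set Ω)}

/-- `f ≻ g`. -/
def Strict (R : Act Z Sig → Act Z Sig → Prop) (f g : Act Z Sig) : Prop := R f g ∧ ¬ R g f

/-- `f ∼ g`. -/
def Indiff (R : Act Z Sig → Act Z Sig → Prop) (f g : Act Z Sig) : Prop := R f g ∧ R g f

/-- Statewise dominance `f ≥ g`: `f(ω) ≿ g(ω)` for every state `ω`. -/
def Dominates (R : Act Z Sig → Act Z Sig → Prop) (f g : Act Z Sig) : Prop :=
  ∀ ω, R (Act.const Sig (f ω)) (Act.const Sig (g ω))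

/-- An act is well-understood if it has a certain equivalent. -/
def WellUnderstood (R : Act Z Sig → Act Z Sig → Prop) (f : Act Z Sig) : Prop :=
  ∃ c : Lottery Z, Indiff R f (Act.const Sig c)

/-- The event `E` is non-null if `c²_E c¹ ≻ c³_E c¹` for some constant acts. -/
def NonNull (R : Act Z Sig → Act Z Sig → Prop) (E : Sig) : Prop :=
  ∃ c₁ c₂ c₃ : Lottery Z,
    Strict R (Act.splice E (Act.const Sig c₂) (Act.const Sig c₁))
      (Act.splice E (Act.const Sig c₃) (Act.const Sig c₁))

/-- The partition of the act `f`: two states are in the same cell iff `f` yields indifferent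
lotteries (equivalently, lotteries of equal utility, once `R` has a utility on lotteries). -/
def cells (R : Act Z Sig → Act Z Sig → Prop) (f : Act Z Sig) : Set (Set Ω) :=
  Set.range fun ω => {ω' | Indiff R (Act.const Sig (f ω')) (Act.const Sig (f ω))}

def IsPreorderRel (R : Act Z Sig → Act Z Sig → Prop) : Prop :=
  (∀ f, R f f) ∧ ∀ f g h, R f g → R g h → R f h

def Monotonicity (R : Act Z Sig → Act Z Sig → Prop) : Prop :=
  ∀ f g, Dominates R f g → R f g

def ArchimedeanContinuity (R : Act Z Sig → Act Z Sig → Prop) : Prop :=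
  ∀ f g h, IsClosed {t : unitInterval | R (Act.mix t f g) h} ∧
    IsClosed {t : unitInterval | R h (Act.mix t f g)}

def Nontriviality (R : Act Z Sig → Act Z Sig → Prop) : Prop :=
  ∃ f g, Strict R f g

def CCompleteness (R : Act Z Sig → Act Z Sig → Prop) : Prop :=
  ∀ c d : Lottery Z, R (Act.const Sig c) (Act.const Sig d) ∨ R (Act.const Sig d) (Act.const Sig c)

def WeakCIndependence (R : Act Z Sig → Act Z Sig → Prop) : Prop :=
  ∀ (c₁ c₂ : Lottery Z) (f : Act Z Sig) (t : unitInterval), 0 < t → t < 1 →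
    (R f (Act.const Sig c₁) ↔
      R (Act.mix t f (Act.const Sig c₂)) (Act.mix t (Act.const Sig c₁) (Act.const Sig c₂))) ∧
    (R (Act.const Sig c₁) f ↔
      R (Act.mix t (Act.const Sig c₁) (Act.const Sig c₂)) (Act.mix t f (Act.const Sig c₂)))

structure BasicConditions (R : Act Z Sig → Act Z Sig → Prop) : Prop where
  preorder : IsPreorderRel R
  monotonicity : Monotonicity R
  archimedean : ArchimedeanContinuity R
  nontriviality : Nontriviality R
  cCompleteness : CCompleteness R
  weakCIndependence : WeakCIndependence R

/-- For every event there is a well-understood bet on it (a bet pays a strictly better lottery on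
the event than off it). -/
def A0 (R : Act Z Sig → Act Z Sig → Prop) : Prop :=
  ∀ E : Sig, ∃ c d : Lottery Z, Strict R (Act.const Sig c) (Act.const Sig d) ∧
    WellUnderstood R (Act.splice E (Act.const Sig c) (Act.const Sig d))

/-- Every coarsening of the partition of a well-understood act is the partition of some
well-understood act. -/
def A1 (R : Act Z Sig → Act Z Sig → Prop) : Prop :=
  ∀ f, WellUnderstood R f → ∀ τ' : Set (Set Ω), Setoid.IsPartition τ' →
    (∀ T ∈ cells R f, ∃ T' ∈ τ', T ⊆ T') → ∃ g, WellUnderstood R g ∧ cells R g = τ'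

def A2 (R : Act Z Sig → Act Z Sig → Prop) : Prop :=
  ∀ f g, WellUnderstood R f →
    (∀ T ∈ cells R f, ∀ ω ∈ T, ∀ ω' ∈ T,
      Indiff R (Act.const Sig (g ω)) (Act.const Sig (g ω'))) →
    (∃ a ∈ Set.range f, ∀ ω, g ω = f ω ∨ g ω = a) →
    WellUnderstood R g → ∀ t : unitInterval, 0 < t → t < 1 → WellUnderstood R (Act.mix t f g)

def A3 (R : Act Z Sig → Act Z Sig → Prop) : Prop :=
  ∀ f, WellUnderstood R f → ∀ T T' : Sig, (T : Set Ω) ∈ cells R f → (T' : Set Ω) ∈ cells R f →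
    T ≠ T' → NonNull R T → NonNull R T' →
    ∀ A B : Sig, (A : Set Ω).Nonempty → (B : Set Ω).Nonempty → Disjoint (A : Set Ω) B →
      (A : Set Ω) ∪ B = (T : Set Ω) ∪ T' →
      ∃ g, WellUnderstood R g ∧
        cells R g = {(A : Set Ω), (B : Set Ω)} ∪ (cells R f \ {(T : Set Ω), (T' : Set Ω)})

def A4 (R : Act Z Sig → Act Z Sig → Prop) : Prop :=
  ∀ f, WellUnderstood R f → ∀ E : Sig, ¬ NonNull R E → ∀ g, Indiff R (Act.splice E g f) f

structure SimplicityConditions (R : Act Z Sig → Act Z Sig → Prop) : Prop where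
  a0 : A0 R
  a1 : A1 R
  a2 : A2 R
  a3 : A3 R
  a4 : A4 R

def SIndependence (R : Act Z Sig → Act Z Sig → Prop) : Prop :=
  ∀ f g h, WellUnderstood R f → WellUnderstood R g → WellUnderstood R h →
    ∀ t : unitInterval, 0 < t → t < 1 →
      WellUnderstood R (Act.mix t f h) → WellUnderstood R (Act.mix t g h) →
      (R f g ↔ R (Act.mix t f h) (Act.mix t g h))

def UniformComparability (R : Act Z Sig → Act Z Sig → Prop) : Prop :=
  ∀ f g, ¬ Dominates R f g →
    (R f g ↔ ∃ h k, WellUnderstood R h ∧ WellUnderstood R k ∧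
      Dominates R f h ∧ R h k ∧ Dominates R k g)

def Consistency (R R' : Act Z Sig → Act Z Sig → Prop) : Prop :=
  ∀ f g, R f g → R' f g

/-- Well-understood refers to the objective relation `R`. -/
def StrongConsistencyForSimpleActs (R R' : Act Z Sig → Act Z Sig → Prop) : Prop :=
  ∀ f g, WellUnderstood R f → WellUnderstood R g → (R f g ↔ R' f g)

def Caution (R R' : Act Z Sig → Act Z Sig → Prop) : Prop :=
  ∀ (f : Act Z Sig) (c : Lottery Z), ¬ R f (Act.const Sig c) → R' (Act.const Sig c) f

end Axioms

section Representation

/-! Parameters of a representation: a capacity `N` (an integer, or `⊤` for `∞`), a finitely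
additive probability `P` on the algebra of events, and a utility function `u` on outcomes. -/

variable {Ω Z : Type*} {Sig : BooleanSubalgebra (Set Ω)}

/-- The expected utility `∫ E_{f(ω)} u dP(ω)`; as `f` is finitely valued, this is a finite sum. -/
noncomputable def expUtil (P : MeasureTheory.AddContent ℝ≥0 (Sig : Set (Set Ω))) (u : Z → ℝ)
    (f : Act Z Sig) : ℝ :=
  ∑ p ∈ f.finite_range.toFinset, (P (f ⁻¹' {p}) : ℝ) * util u p

/-- `f` is `N`-simple: the utility image of `f` has at most `N` elements. -/
def IsNSimple (N : ℕ∞) (u : Z → ℝ) (f : Act Z Sig) : Prop :=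
  (Set.range fun ω => util u (f ω)).encard ≤ N

/-- `f ≥ g` for the utility `u`. -/
def UtilDominates (u : Z → ℝ) (f g : Act Z Sig) : Prop :=
  ∀ ω, util u (g ω) ≤ util u (f ω)

/-- `f ≥⁰ g`: dominance outside a null event. -/
def AEDominates (P : MeasureTheory.AddContent ℝ≥0 (Sig : Set (Set Ω))) (u : Z → ℝ)
    (f g : Act Z Sig) : Prop :=
  ∃ E ∈ Sig, P E = 0 ∧ ∀ ω, ω ∉ E → util u (g ω) ≤ util u (f ω)

/-- The simple lower bounds of `f`: the best `N`-simple acts `h` with `f ≥⁰ h`. -/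
def simInf (N : ℕ∞) (P : MeasureTheory.AddContent ℝ≥0 (Sig : Set (Set Ω))) (u : Z → ℝ)
    (f : Act Z Sig) : Set (Act Z Sig) :=
  {h | IsNSimple N u h ∧ AEDominates P u f h ∧
    ¬ ∃ k, IsNSimple N u k ∧ AEDominates P u f k ∧ expUtil P u h < expUtil P u k}

/-- The simple upper bounds of `f`: the worst `N`-simple acts `h` with `h ≥⁰ f`. -/
def simSup (N : ℕ∞) (P : MeasureTheory.AddContent ℝ≥0 (Sig : Set (Set Ω))) (u : Z → ℝ)
    (f : Act Z Sig) : Set (Act Z Sig) :=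
  {h | IsNSimple N u h ∧ AEDominates P u h f ∧
    ¬ ∃ k, IsNSimple N u k ∧ AEDominates P u k f ∧ expUtil P u k < expUtil P u h}

/-- Admissible parameters: `N ∈ {2, 3, …} ∪ {∞}`, `P` a probability, `u` non-constant. -/
def IsParam (N : ℕ∞) (P : MeasureTheory.AddContent ℝ≥0 (Sig : Set (Set Ω))) (u : Z → ℝ) : Prop :=
  2 ≤ N ∧ P Set.univ = 1 ∧ ∃ z z', u z ≠ u z'

/-- All members of `simInf N P u f` have the same expected utility, and likewise for `simSup`. -/
def IsSimpleBoundsRep (R : Act Z Sig → Act Z Sig → Prop) (N : ℕ∞)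
    (P : MeasureTheory.AddContent ℝ≥0 (Sig : Set (Set Ω))) (u : Z → ℝ) : Prop :=
  IsParam N P u ∧ ∀ f g, R f g ↔ (UtilDominates u f g ∨
    ∃ h ∈ simInf N P u f, ∃ k ∈ simSup N P u g, expUtil P u k ≤ expUtil P u h)

def IsCautiousRep (R' : Act Z Sig → Act Z Sig → Prop) (N : ℕ∞)
    (P : MeasureTheory.AddContent ℝ≥0 (Sig : Set (Set Ω))) (u : Z → ℝ) : Prop :=
  IsParam N P u ∧ ∀ f g, R' f g ↔
    ∃ h ∈ simInf N P u f, ∃ k ∈ simInf N P u g, expUtil P u k ≤ expUtil P u h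

/-- `≿` is Simple Bounds and `≿'` is Cautious, with common parameters `N`, `P`, `u`. -/
def IsCommonRep (R R' : Act Z Sig → Act Z Sig → Prop) (N : ℕ∞)
    (P : MeasureTheory.AddContent ℝ≥0 (Sig : Set (Set Ω))) (u : Z → ℝ) : Prop :=
  IsSimpleBoundsRep R N P u ∧ IsCautiousRep R' N P u

end Representation

end SimpleBounds

/-! An act matters only through its utility profile, a simple function. Let `lowerInt N P x` be the
largest integral of a function with at most `N` values below `x` almost everywhere, and `upperInt`
its mirror image. Both extremes are attained, since a competitor can be replaced by one that is at
least as good and takes only values of `x`. Hence the sets of simple bounds are non-empty, and both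
representations become inequalities between these numbers. The two numbers agree exactly when `x`
takes at most `N` values with positive probability (`upperInt_le_lowerInt_iff`). Such profiles are
those of the well-understood acts, on which preference is expected utility. With this description
the axioms follow from the representation by comparing integrals and essential ranges.

For the converse, the expected utility theorem on constant acts gives `u`, so each well-understood
act has a value, the utility of its certain equivalent. Weak C-Independence transports values along
positive affine maps, S-Independence makes them affine on mixtures, and bets then define `P`. The
crux is `hasValue_comp_aux`: once one act with a given partition is well-understood, all acts
measurable for that partition are, and their value is their expected utility. This goes by induction
on the number of cells. Strict coarsenings are settled by (A1) and the induction hypothesis, and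
mixing with them through (A2) moves the value on one cell at a time. Lowering a middle value and
raising it back gives a linear equation satisfied both by the value and by the integral.

By (A3) and (A4) only the number of non-null cells decides whether an act is well-understood: up to
null sets, partitions with equally many non-null cells are connected by repartitions of pairs of
cells (`isUnderstood_connected`). The capacity `N` is the supremum of these numbers, or 2 if that is
larger. Uniform Comparability reduces the remaining comparisons to well-understood acts.
Consistency, Caution and continuity make each act indifferent, for the cautious relation, to a
constant of utility `lowerInt`. For uniqueness, lotteries are calibrated by mixtures, and events by
certain equivalents of bets. -/

namespace SimpleBounds

/-! ### Functions with finitely many values, measurable for an algebra of events. -/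

section SimpleFunctions

variable {Ω α β : Type*} {Sig : BooleanSubalgebra (Set Ω)}

/-- Finitely valued maps that are measurable with respect to the algebra `Sig`. -/
structure IsSimple (Sig : BooleanSubalgebra (Set Ω)) (x : Ω → α) : Prop where
  finite_range : (Set.range x).Finite
  preimage_mem : ∀ S : Set α, x ⁻¹' S ∈ Sig

theorem IsSimple.of_singleton {x : Ω → α} (hf : (Set.range x).Finite)
    (h : ∀ a, x ⁻¹' {a} ∈ Sig) : IsSimple Sig x := by
  classical
  refine ⟨hf, fun S => ?_⟩
  have : x ⁻¹' S = ⋃ p ∈ hf.toFinset.filter (· ∈ S), x ⁻¹' {p} := by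
    ext ω
    simp
  rw [this]
  exact (isSetAlgebra Sig).biUnion_mem _ fun p _ => h p

theorem IsSimple.const (Sig : BooleanSubalgebra (Set Ω)) (a : α) :
    IsSimple Sig (fun _ : Ω => a) := by
  refine ⟨(Set.finite_singleton a).subset (by rintro _ ⟨_, rfl⟩; rfl), fun S => ?_⟩
  by_cases h : a ∈ S
  · simpa [Set.preimage_const_of_mem h] using (isSetAlgebra Sig).univ_mem
  · simpa [Set.preimage_const_of_notMem h] using (isSetAlgebra Sig).empty_mem

theorem IsSimple.comp {x : Ω → α} (hx : IsSimple Sig x) (φ : α → β) :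
    IsSimple Sig (fun ω => φ (x ω)) := by
  refine ⟨(hx.finite_range.image φ).subset ?_, fun S => hx.preimage_mem (φ ⁻¹' S)⟩
  rintro _ ⟨ω, rfl⟩
  exact ⟨_, ⟨ω, rfl⟩, rfl⟩

theorem IsSimple.prodMk {x : Ω → α} {y : Ω → β} (hx : IsSimple Sig x) (hy : IsSimple Sig y) :
    IsSimple Sig (fun ω => (x ω, y ω)) := by
  refine IsSimple.of_singleton ((hx.finite_range.prod hy.finite_range).subset ?_) ?_
  · rintro _ ⟨ω, rfl⟩
    exact ⟨⟨ω, rfl⟩, ⟨ω, rfl⟩⟩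
  · rintro ⟨a, b⟩
    have : (fun ω => (x ω, y ω)) ⁻¹' {(a, b)} = x ⁻¹' {a} ∩ y ⁻¹' {b} := by
      ext ω
      simp
    rw [this]
    exact (isSetAlgebra Sig).inter_mem (hx.preimage_mem _) (hy.preimage_mem _)

theorem IsSimple.comp₂ {γ : Type*} {x : Ω → α} {y : Ω → β} (hx : IsSimple Sig x)
    (hy : IsSimple Sig y) (φ : α → β → γ) : IsSimple Sig (fun ω => φ (x ω) (y ω)) :=
  (hx.prodMk hy).comp fun p => φ p.1 p.2

theorem IsSimple.mem_event {E : Set Ω} (hE : E ∈ Sig) : IsSimple Sig (fun ω => ω ∈ E) := by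
  refine IsSimple.of_singleton (Set.toFinite _) fun a => ?_
  by_cases ha : a
  · have : (fun ω => ω ∈ E) ⁻¹' {a} = E := by ext ω; simp [ha]
    rwa [this]
  · have : (fun ω => ω ∈ E) ⁻¹' {a} = Eᶜ := by ext ω; simp [ha]
    rw [this]
    exact (isSetAlgebra Sig).compl_mem hE

open Classical in
theorem IsSimple.ite {E : Set Ω} (hE : E ∈ Sig) {x y : Ω → α} (hx : IsSimple Sig x)
    (hy : IsSimple Sig y) : IsSimple Sig (fun ω => if ω ∈ E then x ω else y ω) :=
  ((IsSimple.mem_event hE).prodMk (hx.prodMk hy)).comp fun p => if p.1 then p.2.1 else p.2.2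

/-- `y` factors through `x`. The factor needs a default value in `β`, so empty `Ω` is treated
separately. -/
theorem IsSimple.congr_fibers {x : Ω → α} {y : Ω → β} (hx : IsSimple Sig x)
    (h : ∀ ω ω', x ω = x ω' → y ω = y ω') : IsSimple Sig y := by
  rcases isEmpty_or_nonempty Ω with hΩ | ⟨⟨ω₀⟩⟩
  · refine ⟨Set.toFinite _, fun S => ?_⟩
    rw [Set.eq_empty_of_isEmpty (y ⁻¹' S)]
    exact (isSetAlgebra Sig).empty_mem
  · have : Nonempty β := ⟨y ω₀⟩
    obtain ⟨e, he⟩ := (Function.factorsThrough_iff y).1 fun ω ω' => h ω ω'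
    rw [he]
    exact hx.comp e

end SimpleFunctions

/-! ### Finitely additive integration and essential ranges. -/

section Integral

variable {Ω α β : Type*} {Sig : BooleanSubalgebra (Set Ω)}
  {P : MeasureTheory.AddContent ℝ≥0 (Sig : Set (Set Ω))}

theorem content_mono {A B : Set Ω} (hA : A ∈ Sig) (hB : B ∈ Sig) (h : A ⊆ B) : P A ≤ P B :=
  MeasureTheory.addContent_mono (isSetAlgebra Sig).isSetRing.isSetSemiring hA hB h

theorem content_eq_zero_of_subset {A B : Set Ω} (hA : A ∈ Sig) (hB : B ∈ Sig) (h : A ⊆ B)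
    (h0 : P B = 0) : P A = 0 :=
  le_antisymm (h0 ▸ content_mono hA hB h) zero_le

theorem content_union_eq_zero {A B : Set Ω} (hA : A ∈ Sig) (hB : B ∈ Sig)
    (hA0 : P A = 0) (hB0 : P B = 0) : P (A ∪ B) = 0 := by
  have := MeasureTheory.addContent_union_le (m := P) (isSetAlgebra Sig).isSetRing hA hB
  rw [hA0, hB0, add_zero] at this
  exact le_antisymm this zero_le

theorem content_preimage_finset {x : Ω → α} (hx : IsSimple Sig x) (s : Finset α) :
    P (x ⁻¹' s) = ∑ a ∈ s, P (x ⁻¹' {a}) := by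
  have : x ⁻¹' s = ⋃ a ∈ s, x ⁻¹' {a} := by
    ext ω
    simp
  rw [this, MeasureTheory.addContent_biUnion (fun a _ => hx.preimage_mem _)]
  · intro a _ b _ hab
    exact Disjoint.preimage x (Set.disjoint_singleton.2 hab)
  · rw [← this]
    exact hx.preimage_mem _

theorem content_preimage {x : Ω → α} (hx : IsSimple Sig x) (S : Set α) [DecidablePred (· ∈ S)] :
    P (x ⁻¹' S) = ∑ a ∈ hx.finite_range.toFinset with a ∈ S, P (x ⁻¹' {a}) := by
  rw [← content_preimage_finset hx]
  congr 1
  ext ω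
  simp

theorem content_preimage_eq_zero {x : Ω → α} (hx : IsSimple Sig x) {S : Set α}
    (h : ∀ a ∈ S, P (x ⁻¹' {a}) = 0) : P (x ⁻¹' S) = 0 := by
  classical
  rw [content_preimage hx]
  exact Finset.sum_eq_zero fun a ha => h a (Finset.mem_filter.1 ha).2

theorem nonempty_of_prob (hP : P Set.univ = 1) : Nonempty Ω := by
  by_contra h
  rw [not_nonempty_iff] at h
  rw [Set.eq_empty_of_isEmpty (Set.univ : Set Ω), MeasureTheory.addContent_empty] at hP
  exact zero_ne_one hP

theorem exists_notMem_of_null (hP : P Set.univ = 1) {E : Set Ω} (h0 : P E = 0) : ∃ ω, ω ∉ E := by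
  by_contra! h
  rw [Set.eq_univ_of_forall h, hP] at h0
  exact one_ne_zero h0

/-- The integral of a finitely valued real function with respect to a content. -/
noncomputable def integral (P : MeasureTheory.AddContent ℝ≥0 (Sig : Set (Set Ω)))
    (x : Ω → ℝ) : ℝ :=
  ∑ᶠ r : ℝ, (P (x ⁻¹' {r}) : ℝ) * r

/-- Regrouping the sum by the cells of a finer simple map lets two functions be integrated over one
common partition. Linearity and monotonicity then hold term by term. -/
theorem integral_comp {π : Ω → α} (hπ : IsSimple Sig π) (v : α → ℝ) :
    integral P (fun ω => v (π ω)) =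
      ∑ a ∈ hπ.finite_range.toFinset, (P (π ⁻¹' {a}) : ℝ) * v a := by
  classical
  have key : ∀ r : ℝ, (P ((fun ω => v (π ω)) ⁻¹' {r}) : ℝ) =
      ∑ a ∈ hπ.finite_range.toFinset with v a = r, (P (π ⁻¹' {a}) : ℝ) := by
    intro r
    have := content_preimage (P := P) hπ (v ⁻¹' {r})
    rw [← Set.preimage_comp] at this
    change P ((v ∘ π) ⁻¹' {r}) = _ at this
    change ((P ((v ∘ π) ⁻¹' {r}) : ℝ≥0) : ℝ) = _
    rw [this]
    push_cast
    rfl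
  rw [integral, finsum_eq_sum_of_support_subset (s := hπ.finite_range.toFinset.image v)]
  · rw [Finset.sum_image' (fun a => (P (π ⁻¹' {a}) : ℝ) * v a)]
    intro a _
    rw [key, Finset.sum_mul]
    refine Finset.sum_congr rfl fun b hb => ?_
    rw [(Finset.mem_filter.1 hb).2]
  · intro r hr
    rw [Function.mem_support, key] at hr
    have h1 : (∑ a ∈ hπ.finite_range.toFinset with v a = r, (P (π ⁻¹' {a}) : ℝ)) ≠ 0 :=
      left_ne_zero_of_mul hr
    obtain ⟨a, ha, -⟩ := Finset.exists_ne_zero_of_sum_ne_zero h1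
    rw [Finset.mem_filter] at ha
    exact Finset.mem_coe.2 (Finset.mem_image.2 ⟨a, ha.1, ha.2⟩)

theorem integral_const (hP : P Set.univ = 1) (c : ℝ) : integral P (fun _ => c) = c := by
  have := nonempty_of_prob hP
  rw [integral_comp (IsSimple.const Sig ()) fun _ => c]
  have h : (Set.range fun _ : Ω => ()) = Set.univ := by ext; simp
  simp [h, hP]

theorem integral_add {x y : Ω → ℝ} (hx : IsSimple Sig x) (hy : IsSimple Sig y) :
    integral P (fun ω => x ω + y ω) = integral P x + integral P y := by
  have h := hx.prodMk hy
  rw [integral_comp h fun p => p.1 + p.2, integral_comp h Prod.fst, integral_comp h Prod.snd,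
    ← Finset.sum_add_distrib]
  exact Finset.sum_congr rfl fun a _ => by ring

theorem integral_const_mul {x : Ω → ℝ} (hx : IsSimple Sig x) (c : ℝ) :
    integral P (fun ω => c * x ω) = c * integral P x := by
  rw [integral_comp hx fun r => c * r, integral_comp hx fun r => r, Finset.mul_sum]
  exact Finset.sum_congr rfl fun a _ => by ring

theorem integral_affine (hP : P Set.univ = 1) {x : Ω → ℝ} (hx : IsSimple Sig x) (a b : ℝ) :
    integral P (fun ω => a * x ω + b) = a * integral P x + b := by
  rw [integral_add (hx.comp fun r => a * r) (IsSimple.const Sig b), integral_const_mul hx,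
    integral_const hP]

theorem integral_neg {x : Ω → ℝ} (hx : IsSimple Sig x) :
    integral P (fun ω => - x ω) = - integral P x := by
  simpa using integral_const_mul (P := P) hx (-1)

theorem integral_mix {x y : Ω → ℝ} (hx : IsSimple Sig x) (hy : IsSimple Sig y) (s t : ℝ) :
    integral P (fun ω => s * x ω + t * y ω) = s * integral P x + t * integral P y := by
  rw [integral_add (hx.comp fun r => s * r) (hy.comp fun r => t * r), integral_const_mul hx,
    integral_const_mul hy]

/-- `x ≤ y` outside a null event. -/
def AELE (P : MeasureTheory.AddContent ℝ≥0 (Sig : Set (Set Ω))) (x y : Ω → ℝ) : Prop :=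
  ∃ E ∈ Sig, P E = 0 ∧ ∀ ω, ω ∉ E → x ω ≤ y ω

theorem AELE.of_le {x y : Ω → ℝ} (h : ∀ ω, x ω ≤ y ω) : AELE P x y :=
  ⟨∅, (isSetAlgebra Sig).empty_mem, MeasureTheory.addContent_empty, fun ω _ => h ω⟩

theorem AELE.trans {x y z : Ω → ℝ} (h : AELE P x y) (h' : AELE P y z) : AELE P x z := by
  obtain ⟨E, hE, hE0, hxy⟩ := h
  obtain ⟨F, hF, hF0, hyz⟩ := h'
  refine ⟨E ∪ F, (isSetAlgebra Sig).union_mem hE hF, content_union_eq_zero hE hF hE0 hF0,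
    fun ω hω => ?_⟩
  rw [Set.mem_union, not_or] at hω
  exact (hxy ω hω.1).trans (hyz ω hω.2)

theorem integral_mono {x y : Ω → ℝ} (hx : IsSimple Sig x) (hy : IsSimple Sig y)
    (h : AELE P x y) : integral P x ≤ integral P y := by
  obtain ⟨E, hE, hE0, hxy⟩ := h
  have hp := hx.prodMk hy
  rw [integral_comp hp Prod.fst, integral_comp hp Prod.snd]
  refine Finset.sum_le_sum fun a _ => ?_
  by_cases ha : a.1 ≤ a.2
  · exact mul_le_mul_of_nonneg_left ha (NNReal.coe_nonneg _)
  · have : P ((fun ω => (x ω, y ω)) ⁻¹' {a}) = 0 := by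
      refine content_eq_zero_of_subset (hp.preimage_mem _) hE ?_ hE0
      rintro ω rfl
      by_contra hω
      exact ha (hxy ω hω)
    rw [this]
    simp

/-- In the sums over joint values of `x` and `y` each term for `x` is at most the one for `y`. Equal
totals force equal terms, so a joint value with distinct coordinates has probability zero. -/
theorem ae_eq_of_integral_eq {x y : Ω → ℝ} (hx : IsSimple Sig x) (hy : IsSimple Sig y)
    (h : AELE P x y) (heq : integral P x = integral P y) :
    ∃ E ∈ Sig, P E = 0 ∧ ∀ ω, ω ∉ E → x ω = y ω := by
  obtain ⟨E, hE, hE0, hxy⟩ := h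
  have hp := hx.prodMk hy
  refine ⟨_, hp.preimage_mem {a | a.1 ≠ a.2}, content_preimage_eq_zero hp ?_,
    fun ω hω => by simpa using hω⟩
  intro a ha
  rw [integral_comp hp Prod.fst, integral_comp hp Prod.snd] at heq
  have hz : ∀ b : ℝ × ℝ, b.2 < b.1 → P ((fun ω => (x ω, y ω)) ⁻¹' {b}) = 0 := by
    intro b hb
    refine content_eq_zero_of_subset (hp.preimage_mem _) hE ?_ hE0
    rintro ω rfl
    by_contra hω
    exact absurd (hxy ω hω) (not_le.2 hb)
  have hle : ∀ b ∈ hp.finite_range.toFinset,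
      (P ((fun ω => (x ω, y ω)) ⁻¹' {b}) : ℝ) * b.1 ≤
        (P ((fun ω => (x ω, y ω)) ⁻¹' {b}) : ℝ) * b.2 := by
    intro b _
    rcases le_or_gt b.1 b.2 with hb | hb
    · exact mul_le_mul_of_nonneg_left hb (NNReal.coe_nonneg _)
    · simp [hz b hb]
  have hall := (Finset.sum_eq_sum_iff_of_le hle).1 heq
  by_cases hmem : a ∈ hp.finite_range.toFinset
  · have := hall a hmem
    rcases mul_eq_mul_left_iff.1 this with h1 | h1
    · exact absurd h1 ha
    · exact_mod_cast h1
  · have : (fun ω => (x ω, y ω)) ⁻¹' {a} = ∅ := by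
      ext ω
      simp only [Set.mem_preimage, Set.mem_singleton_iff, Set.mem_empty_iff_false, iff_false]
      rintro rfl
      exact hmem (hp.finite_range.mem_toFinset.2 ⟨ω, rfl⟩)
    rw [this, MeasureTheory.addContent_empty]

theorem integral_congr_ae {x y : Ω → ℝ} (hx : IsSimple Sig x) (hy : IsSimple Sig y)
    {E : Set Ω} (hE : E ∈ Sig) (hE0 : P E = 0) (h : ∀ ω, ω ∉ E → x ω = y ω) :
    integral P x = integral P y :=
  le_antisymm (integral_mono hx hy ⟨E, hE, hE0, fun ω hω => (h ω hω).le⟩)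
    (integral_mono hy hx ⟨E, hE, hE0, fun ω hω => (h ω hω).ge⟩)

/-- The values that are taken with positive probability. -/
def essRange (P : MeasureTheory.AddContent ℝ≥0 (Sig : Set (Set Ω))) (x : Ω → α) : Set α :=
  {a | P (x ⁻¹' {a}) ≠ 0}

theorem essRange_subset_range (x : Ω → α) : essRange P x ⊆ Set.range x := by
  intro a ha
  by_contra h
  refine ha ?_
  rw [Set.preimage_singleton_eq_empty.2 h, MeasureTheory.addContent_empty]

theorem ae_mem_essRange {x : Ω → α} (hx : IsSimple Sig x) :
    ∃ E ∈ Sig, P E = 0 ∧ ∀ ω, ω ∉ E → x ω ∈ essRange P x :=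
  ⟨_, hx.preimage_mem (essRange P x)ᶜ,
    content_preimage_eq_zero hx fun _ ha => not_not.1 ha, fun ω hω => by simpa using hω⟩

theorem essRange_subset_of_ae {x : Ω → α} (hx : IsSimple Sig x) {S : Set α} {E : Set Ω}
    (hE : E ∈ Sig) (hE0 : P E = 0) (h : ∀ ω, ω ∉ E → x ω ∈ S) : essRange P x ⊆ S := by
  intro a ha
  by_contra haS
  refine ha (content_eq_zero_of_subset (hx.preimage_mem _) hE ?_ hE0)
  rintro ω rfl
  by_contra hω
  exact haS (h ω hω)

theorem essRange_congr_ae {x y : Ω → α} (hx : IsSimple Sig x) (hy : IsSimple Sig y)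
    {E : Set Ω} (hE : E ∈ Sig) (hE0 : P E = 0) (h : ∀ ω, ω ∉ E → x ω = y ω) :
    essRange P x = essRange P y := by
  obtain ⟨F, hF, hF0, hx'⟩ := ae_mem_essRange (P := P) hx
  obtain ⟨G, hG, hG0, hy'⟩ := ae_mem_essRange (P := P) hy
  apply Set.Subset.antisymm
  · refine essRange_subset_of_ae hx ((isSetAlgebra Sig).union_mem hE hG)
      (content_union_eq_zero hE hG hE0 hG0) fun ω hω => ?_
    rw [Set.mem_union, not_or] at hω
    exact h ω hω.1 ▸ hy' ω hω.2
  · refine essRange_subset_of_ae hy ((isSetAlgebra Sig).union_mem hE hF)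
      (content_union_eq_zero hE hF hE0 hF0) fun ω hω => ?_
    rw [Set.mem_union, not_or] at hω
    exact h ω hω.1 ▸ hx' ω hω.2

theorem essRange_comp_subset {x : Ω → α} (hx : IsSimple Sig x) (φ : α → β) :
    essRange P (fun ω => φ (x ω)) ⊆ φ '' essRange P x := by
  obtain ⟨E, hE, hE0, h⟩ := ae_mem_essRange (P := P) hx
  exact essRange_subset_of_ae (hx.comp φ) hE hE0 fun ω hω => ⟨_, h ω hω, rfl⟩

theorem essRange_encard_le_of_fibers {x : Ω → α} {y : Ω → β} (hx : IsSimple Sig x)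
    (h : ∀ ω ω', x ω = x ω' → y ω = y ω') : (essRange P y).encard ≤ (essRange P x).encard := by
  rcases isEmpty_or_nonempty Ω with hΩ | ⟨⟨ω₀⟩⟩
  · have : essRange P y = ∅ :=
      Set.eq_empty_of_subset_empty fun a ha => hΩ.elim (essRange_subset_range y ha).choose
    simp [this]
  · have : Nonempty β := ⟨y ω₀⟩
    obtain ⟨e, rfl⟩ := (Function.factorsThrough_iff y).1 fun ω ω' => h ω ω'
    exact (Set.encard_le_encard (essRange_comp_subset hx e)).trans (Set.encard_image_le _ _)

end Integral

/-! ### Best approximations by functions with at most `N` values. -/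

section SimpleEnvelopes

variable {Ω : Type*} {Sig : BooleanSubalgebra (Set Ω)}
  {P : MeasureTheory.AddContent ℝ≥0 (Sig : Set (Set Ω))} {N : ℕ∞} {x y : Ω → ℝ}

/-- The simple functions with at most `N` values that lie below `x` almost everywhere. -/
def lowerFns (N : ℕ∞) (P : MeasureTheory.AddContent ℝ≥0 (Sig : Set (Set Ω))) (x : Ω → ℝ) :
    Set (Ω → ℝ) :=
  {h | IsSimple Sig h ∧ (Set.range h).encard ≤ N ∧ AELE P h x}

/-- The largest integral of an `N`-valued simple function below `x`. -/
noncomputable def lowerInt (N : ℕ∞) (P : MeasureTheory.AddContent ℝ≥0 (Sig : Set (Set Ω)))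
    (x : Ω → ℝ) : ℝ :=
  sSup (integral P '' lowerFns N P x)

/-- The smallest integral of an `N`-valued simple function above `x`. -/
noncomputable def upperInt (N : ℕ∞) (P : MeasureTheory.AddContent ℝ≥0 (Sig : Set (Set Ω)))
    (x : Ω → ℝ) : ℝ :=
  - lowerInt N P (fun ω => - x ω)

/-- Off the exceptional null set, `ψ` rounds each value of `h` up to the least value of `x` above
it, which produces at most `N` numbers. Sending `x ω` to the largest of these numbers below it stays
under `x` and loses nothing against `h`. -/
theorem exists_lowerFn_range_subset (hP : P Set.univ = 1) (hx : IsSimple Sig x) {h : Ω → ℝ}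
    (hh : h ∈ lowerFns N P x) :
    ∃ φ : ℝ → ℝ, (fun ω => φ (x ω)) ∈ lowerFns N P x ∧ (∀ r, φ r ∈ Set.range x) ∧
      AELE P h (fun ω => φ (x ω)) := by
  classical
  obtain ⟨hs, hN, E, hE, hE0, hle⟩ := hh
  have hfin : (x '' Eᶜ).Finite := hx.finite_range.subset (Set.image_subset_range _ _)
  have hψ : ∀ v ∈ h '' Eᶜ, ∃ r ∈ x '' Eᶜ, v ≤ r ∧ ∀ r' ∈ x '' Eᶜ, v ≤ r' → r ≤ r' := by
    rintro _ ⟨ω, hω, rfl⟩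
    obtain ⟨r, ⟨hr, hr'⟩, hmin⟩ := Set.exists_min_image {r ∈ x '' Eᶜ | h ω ≤ r} id
      (hfin.subset (Set.sep_subset _ _)) ⟨x ω, ⟨ω, hω, rfl⟩, hle ω hω⟩
    exact ⟨r, hr, hr', fun r' h1 h2 => hmin r' ⟨h1, h2⟩⟩
  choose! ψ hψF hψle hψmin using hψ
  set A := ψ '' (h '' Eᶜ) with hA
  have hAF : A ⊆ x '' Eᶜ := by
    rintro _ ⟨v, hv, rfl⟩
    exact hψF v hv
  obtain ⟨ω₀, hω₀⟩ := exists_notMem_of_null hP hE0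
  have hφ : ∀ r : ℝ, ∃ a ∈ A, (∃ b ∈ A, b ≤ r) → a ≤ r ∧ ∀ b ∈ A, b ≤ r → b ≤ a := by
    intro r
    by_cases hr : ∃ b ∈ A, b ≤ r
    · obtain ⟨b, hb, hbr⟩ := hr
      obtain ⟨a, ⟨ha, har⟩, hmax⟩ := Set.exists_max_image {a ∈ A | a ≤ r} id
        ((hfin.subset hAF).subset (Set.sep_subset _ _)) ⟨b, hb, hbr⟩
      exact ⟨a, ha, fun _ => ⟨har, fun c h1 h2 => hmax c ⟨h1, h2⟩⟩⟩
    · exact ⟨ψ (h ω₀), ⟨_, ⟨ω₀, hω₀, rfl⟩, rfl⟩, fun h' => absurd h' hr⟩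
  choose φ hφA hφ using hφ
  have hkey : ∀ ω, ω ∉ E → φ (x ω) ≤ x ω ∧ h ω ≤ φ (x ω) := by
    intro ω hω
    have hv : h ω ∈ h '' Eᶜ := ⟨ω, hω, rfl⟩
    have h1 : ψ (h ω) ∈ A := ⟨_, hv, rfl⟩
    have h2 : ψ (h ω) ≤ x ω := hψmin _ hv _ ⟨ω, hω, rfl⟩ (hle ω hω)
    obtain ⟨h3, h4⟩ := hφ (x ω) ⟨_, h1, h2⟩
    exact ⟨h3, (hψle _ hv).trans (h4 _ h1 h2)⟩
  refine ⟨φ, ⟨hx.comp φ, ?_, E, hE, hE0, fun ω hω => (hkey ω hω).1⟩,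
    fun r => Set.image_subset_range _ _ (hAF (hφA r)), E, hE, hE0, fun ω hω => (hkey ω hω).2⟩
  calc (Set.range fun ω => φ (x ω)).encard ≤ A.encard :=
        Set.encard_le_encard (by rintro _ ⟨ω, rfl⟩; exact hφA _)
    _ ≤ (h '' Eᶜ).encard := Set.encard_image_le _ _
    _ ≤ (Set.range h).encard := Set.encard_le_encard (Set.image_subset_range _ _)
    _ ≤ N := hN

theorem lowerFns_nonempty (hP : P Set.univ = 1) (hN : 1 ≤ N) (hx : IsSimple Sig x) :
    (lowerFns N P x).Nonempty := by
  have := nonempty_of_prob hP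
  obtain ⟨_, ⟨ω, rfl⟩, hmin⟩ :=
    Set.exists_min_image (Set.range x) id hx.finite_range (Set.range_nonempty x)
  refine ⟨fun _ => x ω, IsSimple.const Sig _, ?_, AELE.of_le fun ω' => hmin _ ⟨ω', rfl⟩⟩
  rw [Set.range_const, Set.encard_singleton]
  exact hN

/-- The supremum defining `lowerInt` is attained by a function whose values are values of `x`. -/
theorem exists_lowerFn_max (hP : P Set.univ = 1) (hN : 1 ≤ N) (hx : IsSimple Sig x) :
    ∃ h ∈ lowerFns N P x, Set.range h ⊆ Set.range x ∧
      ∀ k ∈ lowerFns N P x, integral P k ≤ integral P h := by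
  have hfin : Finite (Set.range x) := hx.finite_range
  set C : Set (Ω → ℝ) :=
    {g ∈ lowerFns N P x | ∃ φ : ℝ → ℝ, (∀ r, φ r ∈ Set.range x) ∧ g = fun ω => φ (x ω)}
  -- A candidate is determined by a self-map of the finite range of `x`.
  have hC : C.Finite := by
    refine (Set.finite_range
      fun (θ : Set.range x → Set.range x) (ω : Ω) => (θ ⟨x ω, ω, rfl⟩ : ℝ)).subset ?_
    rintro g ⟨-, φ, hφ, rfl⟩
    exact ⟨fun r => ⟨φ r, hφ r⟩, rfl⟩
  have himp : ∀ k ∈ lowerFns N P x, ∃ g ∈ C, integral P k ≤ integral P g := by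
    intro k hk
    obtain ⟨φ, h1, h2, h3⟩ := exists_lowerFn_range_subset hP hx hk
    exact ⟨_, ⟨h1, φ, h2, rfl⟩, integral_mono hk.1 h1.1 h3⟩
  obtain ⟨k₀, hk₀⟩ := lowerFns_nonempty hP hN hx
  obtain ⟨g₀, hg₀, -⟩ := himp k₀ hk₀
  obtain ⟨h, ⟨hh, φ, hφ, hhφ⟩, hmax⟩ := Set.exists_max_image C (integral P) hC ⟨g₀, hg₀⟩
  refine ⟨h, hh, ?_, fun k hk => ?_⟩
  · rintro _ ⟨ω, rfl⟩
    rw [hhφ]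
    exact hφ _
  · obtain ⟨g, hg, hkg⟩ := himp k hk
    exact hkg.trans (hmax g hg)

theorem isGreatest_lowerInt (hP : P Set.univ = 1) (hN : 1 ≤ N) (hx : IsSimple Sig x) :
    IsGreatest (integral P '' lowerFns N P x) (lowerInt N P x) := by
  obtain ⟨h, hh, -, hmax⟩ := exists_lowerFn_max hP hN hx
  have : IsGreatest (integral P '' lowerFns N P x) (integral P h) :=
    ⟨⟨h, hh, rfl⟩, by rintro _ ⟨k, hk, rfl⟩; exact hmax k hk⟩
  rwa [lowerInt, this.csSup_eq]

theorem integral_le_lowerInt (hP : P Set.univ = 1) (hN : 1 ≤ N) (hx : IsSimple Sig x)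
    {h : Ω → ℝ} (hh : h ∈ lowerFns N P x) : integral P h ≤ lowerInt N P x :=
  (isGreatest_lowerInt hP hN hx).2 ⟨h, hh, rfl⟩

theorem exists_lowerFn_eq (hP : P Set.univ = 1) (hN : 1 ≤ N) (hx : IsSimple Sig x) :
    ∃ h ∈ lowerFns N P x, Set.range h ⊆ Set.range x ∧ integral P h = lowerInt N P x := by
  obtain ⟨h, hh, hr, hmax⟩ := exists_lowerFn_max hP hN hx
  obtain ⟨k, hk, hke⟩ := (isGreatest_lowerInt hP hN hx).1
  exact ⟨h, hh, hr, le_antisymm (integral_le_lowerInt hP hN hx hh) (hke ▸ hmax k hk)⟩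

theorem lowerInt_le_integral (hP : P Set.univ = 1) (hN : 1 ≤ N) (hx : IsSimple Sig x) :
    lowerInt N P x ≤ integral P x := by
  obtain ⟨k, hk, hke⟩ := (isGreatest_lowerInt hP hN hx).1
  exact hke ▸ integral_mono hk.1 hx hk.2.2

theorem lowerInt_mono (hP : P Set.univ = 1) (hN : 1 ≤ N) (hx : IsSimple Sig x)
    (hy : IsSimple Sig y) (h : AELE P x y) : lowerInt N P x ≤ lowerInt N P y := by
  obtain ⟨k, hk, hke⟩ := (isGreatest_lowerInt hP hN hx).1
  rw [← hke]
  exact integral_le_lowerInt hP hN hy ⟨hk.1, hk.2.1, hk.2.2.trans h⟩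

theorem lowerFns_affine {a b : ℝ} (ha : 0 < a) {h : Ω → ℝ} (hh : h ∈ lowerFns N P x) :
    (fun ω => a * h ω + b) ∈ lowerFns N P (fun ω => a * x ω + b) := by
  obtain ⟨hs, hN, E, hE, hE0, hle⟩ := hh
  refine ⟨hs.comp fun r => a * r + b, ?_, E, hE, hE0, fun ω hω => ?_⟩
  · have : (Set.range fun ω => a * h ω + b) = (fun r => a * r + b) '' Set.range h := by
      rw [← Set.range_comp]
      rfl
    rw [this]
    exact (Set.encard_image_le _ _).trans hN
  · have := mul_le_mul_of_nonneg_left (hle ω hω) ha.le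
    linarith

theorem lowerInt_affine (hP : P Set.univ = 1) (hN : 1 ≤ N) (hx : IsSimple Sig x) {a : ℝ}
    (ha : 0 < a) (b : ℝ) :
    lowerInt N P (fun ω => a * x ω + b) = a * lowerInt N P x + b := by
  have hx' : IsSimple Sig (fun ω => a * x ω + b) := hx.comp fun r => a * r + b
  apply le_antisymm
  · obtain ⟨k, hk, hke⟩ := (isGreatest_lowerInt hP hN hx').1
    have h1 := lowerFns_affine (b := -(a⁻¹ * b)) (inv_pos.2 ha) hk
    have h2 : (fun ω => a⁻¹ * (a * x ω + b) + -(a⁻¹ * b)) = x := by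
      funext ω
      field_simp
      ring
    rw [h2] at h1
    have h3 := integral_le_lowerInt hP hN hx h1
    rw [integral_affine hP hk.1, hke] at h3
    have h4 := mul_le_mul_of_nonneg_left h3 ha.le
    have h5 : a * (a⁻¹ * lowerInt N P (fun ω => a * x ω + b) + -(a⁻¹ * b)) =
        lowerInt N P (fun ω => a * x ω + b) - b := by
      field_simp
      ring
    linarith
  · obtain ⟨k, hk, hke⟩ := (isGreatest_lowerInt hP hN hx).1
    have h3 := integral_le_lowerInt hP hN hx' (lowerFns_affine (b := b) ha hk)
    rwa [integral_affine hP hk.1, hke] at h3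

/-- Overwriting the inessential values of `x`, on a null event, by an essential one gives a
competitor with the same integral. -/
theorem lowerInt_eq_integral (hP : P Set.univ = 1) (hN : 1 ≤ N) (hx : IsSimple Sig x)
    (h : (essRange P x).encard ≤ N) : lowerInt N P x = integral P x := by
  classical
  refine le_antisymm (lowerInt_le_integral hP hN hx) ?_
  obtain ⟨E, hE, hE0, hess⟩ := ae_mem_essRange (P := P) hx
  obtain ⟨ω₀, hω₀⟩ := exists_notMem_of_null hP hE0
  have hs := IsSimple.ite hE (IsSimple.const Sig (x ω₀)) hx
  rw [integral_congr_ae hx hs hE hE0 fun ω hω => (if_neg hω).symm]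
  refine integral_le_lowerInt hP hN hx ⟨hs, (Set.encard_le_encard ?_).trans h, E, hE, hE0,
    fun ω hω => (if_neg hω).le⟩
  rintro _ ⟨ω, rfl⟩
  dsimp only
  split_ifs with hω
  · exact hess _ hω₀
  · exact hess _ hω

/-- An optimal competitor lies below `x` and has the same integral, so it equals `x` almost
everywhere and shares its essential range. -/
theorem essRange_encard_le_of_lowerInt_eq (hP : P Set.univ = 1) (hN : 1 ≤ N)
    (hx : IsSimple Sig x) (h : integral P x ≤ lowerInt N P x) : (essRange P x).encard ≤ N := by
  obtain ⟨k, hk, hke⟩ := (isGreatest_lowerInt hP hN hx).1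
  obtain ⟨E, hE, hE0, heq⟩ := ae_eq_of_integral_eq hk.1 hx hk.2.2
    (le_antisymm (integral_mono hk.1 hx hk.2.2) (hke ▸ h))
  rw [← essRange_congr_ae hk.1 hx hE hE0 heq]
  exact (Set.encard_le_encard (essRange_subset_range k)).trans hk.2.1

theorem IsSimple.neg (hx : IsSimple Sig x) : IsSimple Sig (fun ω => - x ω) :=
  hx.comp fun r => - r

theorem AELE.neg (h : AELE P x y) : AELE P (fun ω => - y ω) (fun ω => - x ω) := by
  obtain ⟨E, hE, hE0, hle⟩ := h
  exact ⟨E, hE, hE0, fun ω hω => neg_le_neg (hle ω hω)⟩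

theorem encard_range_neg (x : Ω → ℝ) :
    (Set.range fun ω => - x ω).encard = (Set.range x).encard := by
  have : (Set.range fun ω => - x ω) = (fun r => - r) '' Set.range x := by
    rw [← Set.range_comp]
    rfl
  rw [this]
  exact neg_injective.encard_image _

theorem encard_essRange_neg (hx : IsSimple Sig x) :
    (essRange P fun ω => - x ω).encard = (essRange P x).encard :=
  le_antisymm (essRange_encard_le_of_fibers hx fun _ _ h => by rw [h])
    (essRange_encard_le_of_fibers hx.neg fun _ _ h => neg_injective h)

theorem upperInt_le_integral (hP : P Set.univ = 1) (hN : 1 ≤ N) (hx : IsSimple Sig x)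
    {h : Ω → ℝ} (hs : IsSimple Sig h) (hcard : (Set.range h).encard ≤ N) (hle : AELE P x h) :
    upperInt N P x ≤ integral P h := by
  have := integral_le_lowerInt hP hN hx.neg
    ⟨hs.neg, (encard_range_neg h).trans_le hcard, hle.neg⟩
  rw [integral_neg hs] at this
  rw [upperInt]
  linarith

theorem exists_upperFn_eq (hP : P Set.univ = 1) (hN : 1 ≤ N) (hx : IsSimple Sig x) :
    ∃ h, IsSimple Sig h ∧ (Set.range h).encard ≤ N ∧ AELE P x h ∧
      Set.range h ⊆ Set.range x ∧ integral P h = upperInt N P x := by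
  obtain ⟨h, ⟨hs, hcard, hle⟩, hr, he⟩ := exists_lowerFn_eq hP hN hx.neg
  refine ⟨fun ω => - h ω, hs.neg, (encard_range_neg h).trans_le hcard, ?_, ?_, ?_⟩
  · simpa using hle.neg
  · rintro _ ⟨ω, rfl⟩
    obtain ⟨ω', hω'⟩ := hr ⟨ω, rfl⟩
    exact ⟨ω', by simp only [← hω', neg_neg]⟩
  · rw [integral_neg hs, he, upperInt]

theorem integral_le_upperInt (hP : P Set.univ = 1) (hN : 1 ≤ N) (hx : IsSimple Sig x) :
    integral P x ≤ upperInt N P x := by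
  have := lowerInt_le_integral hP hN hx.neg
  rw [integral_neg hx] at this
  rw [upperInt]
  linarith

theorem lowerInt_le_upperInt (hP : P Set.univ = 1) (hN : 1 ≤ N) (hx : IsSimple Sig x) :
    lowerInt N P x ≤ upperInt N P x :=
  (lowerInt_le_integral hP hN hx).trans (integral_le_upperInt hP hN hx)

theorem upperInt_mono (hP : P Set.univ = 1) (hN : 1 ≤ N) (hx : IsSimple Sig x)
    (hy : IsSimple Sig y) (h : AELE P x y) : upperInt N P x ≤ upperInt N P y :=
  neg_le_neg (lowerInt_mono hP hN hy.neg hx.neg h.neg)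

theorem upperInt_affine (hP : P Set.univ = 1) (hN : 1 ≤ N) (hx : IsSimple Sig x) {a : ℝ}
    (ha : 0 < a) (b : ℝ) :
    upperInt N P (fun ω => a * x ω + b) = a * upperInt N P x + b := by
  have := lowerInt_affine hP hN hx.neg ha (-b)
  have h2 : (fun ω => -(a * x ω + b)) = fun ω => a * -x ω + -b := by
    funext ω
    ring
  rw [upperInt, upperInt, h2, this]
  ring

theorem upperInt_eq_integral (hP : P Set.univ = 1) (hN : 1 ≤ N) (hx : IsSimple Sig x)
    (h : (essRange P x).encard ≤ N) : upperInt N P x = integral P x := by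
  rw [upperInt, lowerInt_eq_integral hP hN hx.neg ((encard_essRange_neg hx).trans_le h),
    integral_neg hx, neg_neg]

theorem upperInt_le_lowerInt_iff (hP : P Set.univ = 1) (hN : 1 ≤ N) (hx : IsSimple Sig x) :
    upperInt N P x ≤ lowerInt N P x ↔ (essRange P x).encard ≤ N := by
  refine ⟨fun h => essRange_encard_le_of_lowerInt_eq hP hN hx
    ((integral_le_upperInt hP hN hx).trans h), fun h => ?_⟩
  rw [upperInt_eq_integral hP hN hx h, lowerInt_eq_integral hP hN hx h]

theorem essRange_const_encard_le (hN : 1 ≤ N) (c : ℝ) :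
    (essRange P fun _ : Ω => c).encard ≤ N := by
  refine (Set.encard_le_encard (t := {c}) ?_).trans (by rwa [Set.encard_singleton])
  refine (essRange_subset_range _).trans ?_
  rintro _ ⟨_, rfl⟩
  rfl

theorem lowerInt_const (hP : P Set.univ = 1) (hN : 1 ≤ N) (c : ℝ) :
    lowerInt N P (fun _ : Ω => c) = c := by
  rw [lowerInt_eq_integral hP hN (IsSimple.const Sig c) (essRange_const_encard_le hN c),
    integral_const hP]

theorem upperInt_const (hP : P Set.univ = 1) (hN : 1 ≤ N) (c : ℝ) :
    upperInt N P (fun _ : Ω => c) = c := by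
  rw [upperInt_eq_integral hP hN (IsSimple.const Sig c) (essRange_const_encard_le hN c),
    integral_const hP]

/-- Monotonicity and translation give a Lipschitz bound in the supremum norm, the source of
Archimedean Continuity. -/
theorem lowerInt_le_add (hP : P Set.univ = 1) (hN : 1 ≤ N) (hx : IsSimple Sig x)
    (hy : IsSimple Sig y) {ε : ℝ} (h : ∀ ω, x ω ≤ y ω + ε) :
    lowerInt N P x ≤ lowerInt N P y + ε := by
  have h1 := lowerInt_affine hP hN hy one_pos ε
  simp only [one_mul] at h1
  rw [← h1]
  exact lowerInt_mono hP hN hx (hy.comp fun r => r + ε) (AELE.of_le h)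

end SimpleEnvelopes

/-! ### Lotteries, expected utility and utility profiles. -/

section Lotteries

variable {Ω Z : Type*} {Sig : BooleanSubalgebra (Set Ω)} {u : Z → ℝ}

theorem Lottery.mix_weights (t : unitInterval) (p q : Lottery Z) :
    (Lottery.mix t p q).weights = (t : ℝ) • p.weights + (1 - t : ℝ) • q.weights := by
  simp [Lottery.mix]

@[simp] theorem Lottery.mix_zero (p q : Lottery Z) : Lottery.mix 0 p q = q := by
  apply Convexity.StdSimplex.ext
  rw [Lottery.mix_weights]
  simp

@[simp] theorem Lottery.mix_one (p q : Lottery Z) : Lottery.mix 1 p q = p := by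
  apply Convexity.StdSimplex.ext
  rw [Lottery.mix_weights]
  simp

theorem util_mix (u : Z → ℝ) (t : unitInterval) (p q : Lottery Z) :
    util u (Lottery.mix t p q) = t * util u p + (1 - t) * util u q := by
  classical
  rw [util, Lottery.mix_weights, Finsupp.sum_add_index' (by simp) (by intros; ring),
    Finsupp.sum_smul_index' (by simp), Finsupp.sum_smul_index' (by simp), util, util,
    Finsupp.mul_sum, Finsupp.mul_sum]
  simp [mul_assoc]

theorem util_affine (u : Z → ℝ) (a b : ℝ) (p : Lottery Z) :
    util (fun z => a * u z + b) p = a * util u p + b := by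
  have h : b = p.weights.sum fun _ r => r * b := by
    rw [← Finsupp.sum_mul, p.total, one_mul]
  rw [util, util, Finsupp.mul_sum]
  conv_rhs => rw [h]
  rw [← Finsupp.sum_add]
  exact Finsupp.sum_congr fun z _ => by ring

theorem util_single (u : Z → ℝ) (z : Z) : util u (Convexity.StdSimplex.single z) = u z := by
  simp [util]

theorem exists_lottery_between {p q : Lottery Z} {r : ℝ} (h₁ : util u p ≤ r)
    (h₂ : r ≤ util u q) : ∃ t : unitInterval, util u (Lottery.mix t q p) = r := by
  rcases h₁.eq_or_lt with h | h
  · exact ⟨0, by simpa using h⟩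
  · have hd : 0 < util u q - util u p := by linarith
    refine ⟨⟨(r - util u p) / (util u q - util u p), div_nonneg (by linarith) hd.le,
      (div_le_one hd).2 (by linarith)⟩, ?_⟩
    rw [util_mix]
    field_simp
    ring

instance utilRange_ordConnected (u : Z → ℝ) : (Set.range (util u)).OrdConnected := by
  refine ⟨?_⟩
  rintro _ ⟨p, rfl⟩ _ ⟨q, rfl⟩ r ⟨h₁, h₂⟩
  obtain ⟨t, ht⟩ := exists_lottery_between h₁ h₂
  exact ⟨_, ht⟩

/-- The utility profile of an act. -/
noncomputable def profile (u : Z → ℝ) (f : Act Z Sig) : Ω → ℝ := fun ω => util u (f ω)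

theorem isSimple_act (f : Act Z Sig) : IsSimple Sig f.toFun := ⟨f.finite_range, f.preimage_mem⟩

theorem isSimple_profile (u : Z → ℝ) (f : Act Z Sig) : IsSimple Sig (profile u f) :=
  (isSimple_act f).comp (util u)

theorem profile_mem (u : Z → ℝ) (f : Act Z Sig) (ω : Ω) :
    profile u f ω ∈ Set.range (util u) := ⟨_, rfl⟩

theorem profile_mix (t : unitInterval) (f g : Act Z Sig) :
    profile u (Act.mix t f g) = fun ω => t * profile u f ω + (1 - t) * profile u g ω :=
  funext fun ω => util_mix u t (f ω) (g ω)

theorem profile_const (p : Lottery Z) : profile u (Act.const Sig p) = fun _ => util u p := rfl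

open Classical in
theorem profile_splice (E : Sig) (f g : Act Z Sig) :
    profile u (Act.splice E f g) =
      fun ω => if ω ∈ (E : Set Ω) then profile u f ω else profile u g ω :=
  funext fun _ => apply_ite (util u) _ _ _

theorem expUtil_eq_integral (P : MeasureTheory.AddContent ℝ≥0 (Sig : Set (Set Ω))) (u : Z → ℝ)
    (f : Act Z Sig) : expUtil P u f = integral P (profile u f) :=
  (integral_comp (isSimple_act f) (util u)).symm

/-- The act given by a simple map. -/
def Act.ofSimple {f : Ω → Lottery Z} (hf : IsSimple Sig f) : Act Z Sig :=
  ⟨f, hf.finite_range, fun _ => hf.preimage_mem _⟩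

/-- The lottery is chosen for each value of `x` rather than for each state, since a choice by state
need be neither finitely valued nor measurable. -/
theorem exists_act_profile {x : Ω → ℝ} (hx : IsSimple Sig x)
    (h : ∀ ω, x ω ∈ Set.range (util u)) : ∃ f : Act Z Sig, profile u f = x := by
  choose l hl using h
  rcases isEmpty_or_nonempty Ω with hΩ | ⟨⟨ω₀⟩⟩
  · refine ⟨⟨l, Set.toFinite _, fun p => ?_⟩, funext fun ω => hΩ.elim ω⟩
    rw [Set.eq_empty_of_isEmpty (l ⁻¹' _)]
    exact (isSetAlgebra Sig).empty_mem
  · classical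
    let m : ℝ → Lottery Z := fun r => if h : ∃ p, util u p = r then h.choose else l ω₀
    refine ⟨Act.ofSimple (hx.comp m), funext fun ω => ?_⟩
    have hω : ∃ p, util u p = x ω := ⟨_, hl ω⟩
    change util u (m (x ω)) = x ω
    simp only [m, hω, dif_pos]
    exact hω.choose_spec

end Lotteries

/-! ### The representations as inequalities between `lowerInt` and `upperInt`. -/

section Representation

variable {Ω Z : Type*} {Sig : BooleanSubalgebra (Set Ω)}
  {P : MeasureTheory.AddContent ℝ≥0 (Sig : Set (Set Ω))} {N : ℕ∞} {u : Z → ℝ}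

/-- An act without a better competitor attains `lowerInt`, because some maximising function takes
only values of the profile of `f` and is therefore itself the profile of an act. -/
theorem simInf_eq (hP : P Set.univ = 1) (hN : 1 ≤ N) (f : Act Z Sig) :
    simInf N P u f = {h | IsNSimple N u h ∧ AEDominates P u f h ∧
      integral P (profile u h) = lowerInt N P (profile u f)} := by
  ext h
  have hf := isSimple_profile u f
  simp only [simInf, Set.mem_ofPred_eq, expUtil_eq_integral]
  refine and_congr_right fun h1 => and_congr_right fun h2 => ⟨fun h3 => ?_, fun h3 => ?_⟩
  · refine le_antisymm (integral_le_lowerInt hP hN hf ⟨isSimple_profile u h, h1, h2⟩) ?_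
    obtain ⟨k, ⟨hks, hkN, hkle⟩, hr, he⟩ := exists_lowerFn_eq hP hN hf
    obtain ⟨g, rfl⟩ := exists_act_profile (u := u) hks fun ω => by
      obtain ⟨ω', hω'⟩ := hr ⟨ω, rfl⟩
      exact hω' ▸ profile_mem u f ω'
    rw [← he]
    by_contra hlt
    exact h3 ⟨g, hkN, hkle, not_le.1 hlt⟩
  · rintro ⟨k, hk1, hk2, hk3⟩
    exact absurd (integral_le_lowerInt hP hN hf ⟨isSimple_profile u k, hk1, hk2⟩)
      (not_le.2 (h3 ▸ hk3))

theorem simSup_eq (hP : P Set.univ = 1) (hN : 1 ≤ N) (f : Act Z Sig) :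
    simSup N P u f = {h | IsNSimple N u h ∧ AEDominates P u h f ∧
      integral P (profile u h) = upperInt N P (profile u f)} := by
  ext h
  have hf := isSimple_profile u f
  simp only [simSup, Set.mem_ofPred_eq, expUtil_eq_integral]
  refine and_congr_right fun h1 => and_congr_right fun h2 => ⟨fun h3 => ?_, fun h3 => ?_⟩
  · refine le_antisymm ?_ (upperInt_le_integral hP hN hf (isSimple_profile u h) h1 h2)
    obtain ⟨k, hks, hkN, hkle, hr, he⟩ := exists_upperFn_eq hP hN hf
    obtain ⟨g, rfl⟩ := exists_act_profile (u := u) hks fun ω => by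
      obtain ⟨ω', hω'⟩ := hr ⟨ω, rfl⟩
      exact hω' ▸ profile_mem u f ω'
    rw [← he]
    by_contra hlt
    exact h3 ⟨g, hkN, hkle, not_le.1 hlt⟩
  · rintro ⟨k, hk1, hk2, hk3⟩
    exact absurd (upperInt_le_integral hP hN hf (isSimple_profile u k) hk1 hk2)
      (not_le.2 (h3 ▸ hk3))

theorem simInf_nonempty (hP : P Set.univ = 1) (hN : 1 ≤ N) (f : Act Z Sig) :
    (simInf N P u f).Nonempty := by
  rw [simInf_eq hP hN]
  obtain ⟨k, ⟨hks, hkN, hkle⟩, hr, he⟩ := exists_lowerFn_eq hP hN (isSimple_profile u f)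
  obtain ⟨g, rfl⟩ := exists_act_profile (u := u) hks fun ω => by
    obtain ⟨ω', hω'⟩ := hr ⟨ω, rfl⟩
    exact hω' ▸ profile_mem u f ω'
  exact ⟨g, hkN, hkle, he⟩

theorem simSup_nonempty (hP : P Set.univ = 1) (hN : 1 ≤ N) (f : Act Z Sig) :
    (simSup N P u f).Nonempty := by
  rw [simSup_eq hP hN]
  obtain ⟨k, hks, hkN, hkle, hr, he⟩ := exists_upperFn_eq hP hN (isSimple_profile u f)
  obtain ⟨g, rfl⟩ := exists_act_profile (u := u) hks fun ω => by
    obtain ⟨ω', hω'⟩ := hr ⟨ω, rfl⟩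
    exact hω' ▸ profile_mem u f ω'
  exact ⟨g, hkN, hkle, he⟩

theorem exists_simInf_simSup_iff (hP : P Set.univ = 1) (hN : 1 ≤ N) (f g : Act Z Sig) :
    (∃ h ∈ simInf N P u f, ∃ k ∈ simSup N P u g, expUtil P u k ≤ expUtil P u h) ↔
      upperInt N P (profile u g) ≤ lowerInt N P (profile u f) := by
  obtain ⟨h₀, hh₀⟩ := simInf_nonempty (u := u) hP hN f
  obtain ⟨k₀, hk₀⟩ := simSup_nonempty (u := u) hP hN g
  simp only [expUtil_eq_integral]
  constructor
  · rintro ⟨h, hh, k, hk, hle⟩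
    rw [simInf_eq hP hN] at hh
    rw [simSup_eq hP hN] at hk
    rwa [hh.2.2, hk.2.2] at hle
  · intro hle
    refine ⟨h₀, hh₀, k₀, hk₀, ?_⟩
    rw [simInf_eq hP hN] at hh₀
    rw [simSup_eq hP hN] at hk₀
    rwa [hh₀.2.2, hk₀.2.2]

theorem exists_simInf_simInf_iff (hP : P Set.univ = 1) (hN : 1 ≤ N) (f g : Act Z Sig) :
    (∃ h ∈ simInf N P u f, ∃ k ∈ simInf N P u g, expUtil P u k ≤ expUtil P u h) ↔
      lowerInt N P (profile u g) ≤ lowerInt N P (profile u f) := by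
  obtain ⟨h₀, hh₀⟩ := simInf_nonempty (u := u) hP hN f
  obtain ⟨k₀, hk₀⟩ := simInf_nonempty (u := u) hP hN g
  simp only [expUtil_eq_integral]
  constructor
  · rintro ⟨h, hh, k, hk, hle⟩
    rw [simInf_eq hP hN] at hh
    rw [simInf_eq hP hN] at hk
    rwa [hh.2.2, hk.2.2] at hle
  · intro hle
    refine ⟨h₀, hh₀, k₀, hk₀, ?_⟩
    rw [simInf_eq hP hN] at hh₀
    rw [simInf_eq hP hN] at hk₀
    rwa [hh₀.2.2, hk₀.2.2]

theorem IsParam.one_le (h : IsParam N P u) : 1 ≤ N := le_trans (by norm_num) h.1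

theorem isSimpleBoundsRep_iff {R : Act Z Sig → Act Z Sig → Prop} :
    IsSimpleBoundsRep R N P u ↔ IsParam N P u ∧ ∀ f g, R f g ↔
      ((∀ ω, profile u g ω ≤ profile u f ω) ∨
        upperInt N P (profile u g) ≤ lowerInt N P (profile u f)) := by
  refine and_congr_right fun h => forall₂_congr fun f g => ?_
  rw [exists_simInf_simSup_iff h.2.1 h.one_le]
  rfl

theorem isCautiousRep_iff {R' : Act Z Sig → Act Z Sig → Prop} :
    IsCautiousRep R' N P u ↔ IsParam N P u ∧ ∀ f g, R' f g ↔
      lowerInt N P (profile u g) ≤ lowerInt N P (profile u f) := by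
  refine and_congr_right fun h => forall₂_congr fun f g => ?_
  rw [exists_simInf_simInf_iff h.2.1 h.one_le]

theorem profile_affine (a b : ℝ) (f : Act Z Sig) :
    profile (fun z => a * u z + b) f = fun ω => a * profile u f ω + b :=
  funext fun ω => util_affine u a b (f ω)

theorem IsCommonRep.affine {R R' : Act Z Sig → Act Z Sig → Prop} (h : IsCommonRep R R' N P u)
    {a : ℝ} (ha : 0 < a) (b : ℝ) : IsCommonRep R R' N P fun z => a * u z + b := by
  obtain ⟨h1, h2⟩ := h
  rw [isSimpleBoundsRep_iff] at h1
  rw [isCautiousRep_iff] at h2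
  have hp := h1.1
  have hp' : IsParam N P fun z => a * u z + b := by
    obtain ⟨z, z', hz⟩ := hp.2.2
    refine ⟨hp.1, hp.2.1, z, z', fun h => hz ?_⟩
    have : a * u z = a * u z' := by linarith
    exact mul_left_cancel₀ ha.ne' this
  refine ⟨isSimpleBoundsRep_iff.2 ⟨hp', fun f g => ?_⟩, isCautiousRep_iff.2 ⟨hp', fun f g => ?_⟩⟩
  · rw [h1.2, profile_affine, profile_affine, upperInt_affine hp.2.1 hp.one_le
      (isSimple_profile u g) ha, lowerInt_affine hp.2.1 hp.one_le (isSimple_profile u f) ha]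
    simp only [add_le_add_iff_right, mul_le_mul_iff_right₀ ha]
  · rw [h2.2, profile_affine, profile_affine, lowerInt_affine hp.2.1 hp.one_le
      (isSimple_profile u g) ha, lowerInt_affine hp.2.1 hp.one_le (isSimple_profile u f) ha]
    simp only [add_le_add_iff_right, mul_le_mul_iff_right₀ ha]

end Representation

/-! ### Bets, lotteries matching an integral, and extremal acts with bounds in every state. -/

section ActBounds

variable {Ω Z : Type*} {Sig : BooleanSubalgebra (Set Ω)}
  {P : MeasureTheory.AddContent ℝ≥0 (Sig : Set (Set Ω))} {N : ℕ∞} {u : Z → ℝ}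

open Classical in
theorem integral_bet (hP : P Set.univ = 1) {E : Set Ω} (hE : E ∈ Sig) (a b : ℝ) :
    integral P (fun ω => if ω ∈ E then a else b) = P E * a + (1 - P E) * b := by
  have hs : IsSimple Sig (fun ω => if ω ∈ E then (1 : ℝ) else 0) :=
    IsSimple.ite hE (IsSimple.const Sig 1) (IsSimple.const Sig 0)
  have h1 : integral P (fun ω => if ω ∈ E then (1 : ℝ) else 0) = P E := by
    rw [integral, finsum_eq_single _ (1 : ℝ)]
    · have : (fun ω => if ω ∈ E then (1 : ℝ) else 0) ⁻¹' {1} = E := by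
        ext ω
        by_cases h : ω ∈ E <;> simp [h]
      rw [this, mul_one]
    · intro r hr
      by_cases hr0 : r = 0
      · simp [hr0]
      · have : (fun ω => if ω ∈ E then (1 : ℝ) else 0) ⁻¹' {r} = ∅ := by
          ext ω
          by_cases h : ω ∈ E <;> simp [h, Ne.symm hr, Ne.symm hr0]
        rw [this, MeasureTheory.addContent_empty]
        simp
  have h2 : (fun ω => if ω ∈ E then a else b) =
      fun ω => (a - b) * (if ω ∈ E then (1 : ℝ) else 0) + b := by
    funext ω
    split_ifs <;> ring
  rw [h2, integral_affine hP hs, h1]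
  ring

theorem integral_mem_Icc (hP : P Set.univ = 1) {x : Ω → ℝ} (hx : IsSimple Sig x) :
    ∃ ω ω', x ω ≤ integral P x ∧ integral P x ≤ x ω' := by
  have := nonempty_of_prob hP
  obtain ⟨_, ⟨ω, rfl⟩, hmin⟩ :=
    Set.exists_min_image (Set.range x) id hx.finite_range (Set.range_nonempty x)
  obtain ⟨_, ⟨ω', rfl⟩, hmax⟩ :=
    Set.exists_max_image (Set.range x) id hx.finite_range (Set.range_nonempty x)
  refine ⟨ω, ω', ?_, ?_⟩
  · rw [← integral_const hP (x ω)]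
    exact integral_mono (IsSimple.const Sig _) hx (AELE.of_le fun ω'' => hmin _ ⟨ω'', rfl⟩)
  · rw [← integral_const hP (x ω')]
    exact integral_mono hx (IsSimple.const Sig _) (AELE.of_le fun ω'' => hmax _ ⟨ω'', rfl⟩)

theorem exists_lottery_integral (hP : P Set.univ = 1) (f : Act Z Sig) :
    ∃ c : Lottery Z, util u c = integral P (profile u f) := by
  obtain ⟨ω, ω', h1, h2⟩ := integral_mem_Icc hP (isSimple_profile u f)
  exact (utilRange_ordConnected u).out (profile_mem u f ω) (profile_mem u f ω') ⟨h1, h2⟩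

/-- Taking the minimum with `f` turns domination outside a null event into domination everywhere, as
Uniform Comparability demands. The act changes on a null event only, so the bound survives for
essential values. -/
theorem exists_act_below (hP : P Set.univ = 1) (hN : 1 ≤ N) (f : Act Z Sig) :
    ∃ h : Act Z Sig, (essRange P (profile u h)).encard ≤ N ∧
      (∀ ω, profile u h ω ≤ profile u f ω) ∧
      integral P (profile u h) = lowerInt N P (profile u f) := by
  obtain ⟨k, ⟨hks, hkN, E, hE, hE0, hkle⟩, hr, he⟩ :=
    exists_lowerFn_eq hP hN (isSimple_profile u f)
  have hs : IsSimple Sig (fun ω => min (k ω) (profile u f ω)) :=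
    hks.comp₂ (isSimple_profile u f) min
  have heq : ∀ ω, ω ∉ E → k ω = min (k ω) (profile u f ω) := fun ω hω =>
    (min_eq_left (hkle ω hω)).symm
  obtain ⟨h, hh⟩ := exists_act_profile (u := u) hs fun ω => by
    rcases min_choice (k ω) (profile u f ω) with h | h
    · obtain ⟨ω', hω'⟩ := hr ⟨ω, rfl⟩
      rw [h, ← hω']
      exact profile_mem u f ω'
    · rw [h]
      exact profile_mem u f ω
  refine ⟨h, ?_, fun ω => ?_, ?_⟩
  · rw [hh, ← essRange_congr_ae hks hs hE hE0 heq]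
    exact (Set.encard_le_encard (essRange_subset_range k)).trans hkN
  · rw [hh]
    exact min_le_right _ _
  · rw [hh, ← integral_congr_ae hks hs hE hE0 heq, he]

theorem exists_act_above (hP : P Set.univ = 1) (hN : 1 ≤ N) (f : Act Z Sig) :
    ∃ h : Act Z Sig, (essRange P (profile u h)).encard ≤ N ∧
      (∀ ω, profile u f ω ≤ profile u h ω) ∧
      integral P (profile u h) = upperInt N P (profile u f) := by
  obtain ⟨k, hks, hkN, ⟨E, hE, hE0, hkle⟩, hr, he⟩ :=
    exists_upperFn_eq hP hN (isSimple_profile u f)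
  have hs : IsSimple Sig (fun ω => max (k ω) (profile u f ω)) :=
    hks.comp₂ (isSimple_profile u f) max
  have heq : ∀ ω, ω ∉ E → k ω = max (k ω) (profile u f ω) := fun ω hω =>
    (max_eq_left (hkle ω hω)).symm
  obtain ⟨h, hh⟩ := exists_act_profile (u := u) hs fun ω => by
    rcases max_choice (k ω) (profile u f ω) with h | h
    · obtain ⟨ω', hω'⟩ := hr ⟨ω, rfl⟩
      rw [h, ← hω']
      exact profile_mem u f ω'
    · rw [h]
      exact profile_mem u f ω
  refine ⟨h, ?_, fun ω => ?_, ?_⟩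
  · rw [hh, ← essRange_congr_ae hks hs hE hE0 heq]
    exact (Set.encard_le_encard (essRange_subset_range k)).trans hkN
  · rw [hh]
    exact le_max_right _ _
  · rw [hh, ← integral_congr_ae hks hs hE hE0 heq, he]

theorem continuous_lowerInt_mix (hP : P Set.univ = 1) (hN : 1 ≤ N) {x y : Ω → ℝ}
    (hx : IsSimple Sig x) (hy : IsSimple Sig y) :
    Continuous fun t : ℝ => lowerInt N P (fun ω => t * x ω + (1 - t) * y ω) := by
  have hs : ∀ t : ℝ, IsSimple Sig (fun ω => t * x ω + (1 - t) * y ω) := fun t =>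
    hx.comp₂ hy fun a b => t * a + (1 - t) * b
  obtain ⟨C, hC⟩ := (hx.comp₂ hy fun a b => |a - b|).finite_range.bddAbove
  have hC' : ∀ ω, |x ω - y ω| ≤ C := fun ω => hC ⟨ω, rfl⟩
  refine (LipschitzWith.of_le_add_mul C.toNNReal fun s t => ?_).continuous
  refine lowerInt_le_add hP hN (hs s) (hs t) fun ω => ?_
  have h1 : (s - t) * (x ω - y ω) ≤ |s - t| * |x ω - y ω| := by
    rw [← abs_mul]
    exact le_abs_self _
  have h2 : |s - t| * |x ω - y ω| ≤ |s - t| * C :=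
    mul_le_mul_of_nonneg_left (hC' ω) (abs_nonneg _)
  have h3 : C * |s - t| ≤ C.toNNReal * |s - t| :=
    mul_le_mul_of_nonneg_right (Real.le_coe_toNNReal C) (abs_nonneg _)
  rw [Real.dist_eq]
  linarith

theorem continuous_upperInt_mix (hP : P Set.univ = 1) (hN : 1 ≤ N) {x y : Ω → ℝ}
    (hx : IsSimple Sig x) (hy : IsSimple Sig y) :
    Continuous fun t : ℝ => upperInt N P (fun ω => t * x ω + (1 - t) * y ω) := by
  have h := (continuous_lowerInt_mix (N := N) hP hN hx.neg hy.neg).neg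
  refine h.congr fun t => ?_
  have heq : (fun ω => t * -x ω + (1 - t) * -y ω) =
      fun ω => -(t * x ω + (1 - t) * y ω) := by
    funext ω
    ring
  rw [upperInt, ← heq]
  rfl

end ActBounds

/-! ### From the Simple Bounds representation to the axioms on the objective relation. -/

namespace IsSimpleBoundsRep

variable {Ω Z : Type*} {Sig : BooleanSubalgebra (Set Ω)}
  {P : MeasureTheory.AddContent ℝ≥0 (Sig : Set (Set Ω))} {N : ℕ∞} {u : Z → ℝ}
  {R : Act Z Sig → Act Z Sig → Prop}

theorem prob (hR : IsSimpleBoundsRep R N P u) : P Set.univ = 1 := hR.1.2.1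

theorem one_le (hR : IsSimpleBoundsRep R N P u) : 1 ≤ N := hR.1.one_le

theorem rel_iff (hR : IsSimpleBoundsRep R N P u) (f g : Act Z Sig) :
    R f g ↔ ((∀ ω, profile u g ω ≤ profile u f ω) ∨
      upperInt N P (profile u g) ≤ lowerInt N P (profile u f)) :=
  (isSimpleBoundsRep_iff.1 hR).2 f g

/-- Against a constant the dominance clause is redundant, since dominance already implies the
inequality of bounds. -/
theorem rel_const_iff (hR : IsSimpleBoundsRep R N P u) (f : Act Z Sig) (c : Lottery Z) :
    R f (Act.const Sig c) ↔ util u c ≤ lowerInt N P (profile u f) := by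
  rw [hR.rel_iff, profile_const, upperInt_const hR.prob hR.one_le, or_iff_right_of_imp]
  intro h
  rw [← lowerInt_const hR.prob hR.one_le (util u c)]
  exact lowerInt_mono hR.prob hR.one_le (IsSimple.const Sig _) (isSimple_profile u f)
    (AELE.of_le h)

theorem const_rel_iff (hR : IsSimpleBoundsRep R N P u) (f : Act Z Sig) (c : Lottery Z) :
    R (Act.const Sig c) f ↔ upperInt N P (profile u f) ≤ util u c := by
  rw [hR.rel_iff, profile_const, lowerInt_const hR.prob hR.one_le, or_iff_right_of_imp]
  intro h
  rw [← upperInt_const hR.prob hR.one_le (util u c)]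
  exact upperInt_mono hR.prob hR.one_le (isSimple_profile u f) (IsSimple.const Sig _)
    (AELE.of_le h)

theorem const_const_iff (hR : IsSimpleBoundsRep R N P u) (c d : Lottery Z) :
    R (Act.const Sig c) (Act.const Sig d) ↔ util u d ≤ util u c := by
  rw [hR.rel_const_iff, profile_const, lowerInt_const hR.prob hR.one_le]

theorem indiff_const_iff (hR : IsSimpleBoundsRep R N P u) (c d : Lottery Z) :
    Indiff R (Act.const Sig c) (Act.const Sig d) ↔ util u c = util u d := by
  rw [Indiff, hR.const_const_iff, hR.const_const_iff, le_antisymm_iff, and_comm]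

theorem dominates_iff (hR : IsSimpleBoundsRep R N P u) (f g : Act Z Sig) :
    Dominates R f g ↔ ∀ ω, profile u g ω ≤ profile u f ω :=
  forall_congr' fun _ => hR.const_const_iff _ _

/-- A certain equivalent forces `upperInt` below `lowerInt`. Conversely the integral lies between
two values of the profile, so it is the utility of some lottery. -/
theorem wellUnderstood_iff (hR : IsSimpleBoundsRep R N P u) (f : Act Z Sig) :
    WellUnderstood R f ↔ (essRange P (profile u f)).encard ≤ N := by
  constructor
  · rintro ⟨c, h1, h2⟩
    rw [hR.rel_const_iff] at h1
    rw [hR.const_rel_iff] at h2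
    exact (upperInt_le_lowerInt_iff hR.prob hR.one_le (isSimple_profile u f)).1 (h2.trans h1)
  · intro h
    obtain ⟨c, hc⟩ := exists_lottery_integral (u := u) hR.prob f
    refine ⟨c, (hR.rel_const_iff _ _).2 ?_, (hR.const_rel_iff _ _).2 ?_⟩
    · rw [lowerInt_eq_integral hR.prob hR.one_le (isSimple_profile u f) h, hc]
    · rw [upperInt_eq_integral hR.prob hR.one_le (isSimple_profile u f) h, hc]

theorem rel_iff_of_wellUnderstood (hR : IsSimpleBoundsRep R N P u) {f g : Act Z Sig}
    (hf : WellUnderstood R f) (hg : WellUnderstood R g) :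
    R f g ↔ integral P (profile u g) ≤ integral P (profile u f) := by
  rw [hR.wellUnderstood_iff] at hf hg
  rw [hR.rel_iff, lowerInt_eq_integral hR.prob hR.one_le (isSimple_profile u f) hf,
    upperInt_eq_integral hR.prob hR.one_le (isSimple_profile u g) hg, or_iff_right_of_imp]
  exact fun h => integral_mono (isSimple_profile u g) (isSimple_profile u f) (AELE.of_le h)

theorem trans (hR : IsSimpleBoundsRep R N P u) {f g h : Act Z Sig} (h1 : R f g) (h2 : R g h) :
    R f h := by
  have hP := hR.prob
  have hN := hR.one_le
  have hf := isSimple_profile u f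
  have hg := isSimple_profile u g
  have hh := isSimple_profile u h
  rw [hR.rel_iff] at h1 h2 ⊢
  rcases h1 with h1 | h1 <;> rcases h2 with h2 | h2
  · exact Or.inl fun ω => (h2 ω).trans (h1 ω)
  · exact Or.inr (h2.trans (lowerInt_mono hP hN hg hf (AELE.of_le h1)))
  · exact Or.inr ((upperInt_mono hP hN hh hg (AELE.of_le h2)).trans h1)
  · exact Or.inr ((h2.trans (lowerInt_le_upperInt hP hN hg)).trans h1)

theorem archimedeanContinuity (hR : IsSimpleBoundsRep R N P u) : ArchimedeanContinuity R := by
  have hP := hR.prob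
  have hN := hR.one_le
  intro f g h
  have hf := isSimple_profile u f
  have hg := isSimple_profile u g
  have hc : ∀ ω, Continuous fun t : unitInterval =>
      (t : ℝ) * profile u f ω + (1 - t) * profile u g ω := fun ω => by fun_prop
  constructor
  · have : {t : unitInterval | R (Act.mix t f g) h} =
        {t : unitInterval | ∀ ω, profile u h ω ≤ t * profile u f ω + (1 - t) * profile u g ω} ∪
        {t : unitInterval | upperInt N P (profile u h) ≤
          lowerInt N P (fun ω => t * profile u f ω + (1 - t) * profile u g ω)} := by
      ext t
      simp only [Set.mem_ofPred_eq, Set.mem_union, hR.rel_iff, profile_mix]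
    rw [this]
    refine IsClosed.union ?_ ?_
    · simp only [Set.ofPred_forall]
      exact isClosed_iInter fun ω => isClosed_le continuous_const (hc ω)
    · exact isClosed_le continuous_const
        ((continuous_lowerInt_mix hP hN hf hg).comp continuous_subtype_val)
  · have : {t : unitInterval | R h (Act.mix t f g)} =
        {t : unitInterval | ∀ ω, t * profile u f ω + (1 - t) * profile u g ω ≤ profile u h ω} ∪
        {t : unitInterval | upperInt N P (fun ω => t * profile u f ω + (1 - t) * profile u g ω) ≤
          lowerInt N P (profile u h)} := by
      ext t
      simp only [Set.mem_ofPred_eq, Set.mem_union, hR.rel_iff, profile_mix]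
    rw [this]
    refine IsClosed.union ?_ ?_
    · simp only [Set.ofPred_forall]
      exact isClosed_iInter fun ω => isClosed_le (hc ω) continuous_const
    · exact isClosed_le ((continuous_upperInt_mix hP hN hf hg).comp continuous_subtype_val)
        continuous_const

theorem exists_util_lt (hR : IsSimpleBoundsRep R N P u) :
    ∃ c d : Lottery Z, util u d < util u c := by
  obtain ⟨z, z', hz⟩ := hR.1.2.2
  rcases lt_or_gt_of_ne hz with h | h
  · exact ⟨.single z', .single z, by simpa only [util_single] using h⟩
  · exact ⟨.single z, .single z', by simpa only [util_single] using h⟩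

theorem strict_const_iff (hR : IsSimpleBoundsRep R N P u) (c d : Lottery Z) :
    Strict R (Act.const Sig c) (Act.const Sig d) ↔ util u d < util u c := by
  rw [Strict, hR.const_const_iff, hR.const_const_iff, lt_iff_le_not_ge]

theorem weakCIndependence (hR : IsSimpleBoundsRep R N P u) : WeakCIndependence R := by
  intro c₁ c₂ f t ht _
  have ht' : (0 : ℝ) < t := ht
  have hm : Act.mix t (Act.const Sig c₁) (Act.const Sig c₂) =
    Act.const Sig (Lottery.mix t c₁ c₂) := rfl
  rw [hm]
  constructor
  · rw [hR.rel_const_iff, hR.rel_const_iff, profile_mix, profile_const, util_mix,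
      lowerInt_affine hR.prob hR.one_le (isSimple_profile u f) ht', add_le_add_iff_right,
      mul_le_mul_iff_right₀ ht']
  · rw [hR.const_rel_iff, hR.const_rel_iff, profile_mix, profile_const, util_mix,
      upperInt_affine hR.prob hR.one_le (isSimple_profile u f) ht', add_le_add_iff_right,
      mul_le_mul_iff_right₀ ht']

theorem basicConditions (hR : IsSimpleBoundsRep R N P u) : BasicConditions R where
  preorder := ⟨fun f => (hR.rel_iff f f).2 (Or.inl fun _ => le_rfl), fun _ _ _ => hR.trans⟩
  monotonicity f g h := (hR.rel_iff f g).2 (Or.inl ((hR.dominates_iff f g).1 h))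
  archimedean := hR.archimedeanContinuity
  nontriviality := by
    obtain ⟨c, d, h⟩ := hR.exists_util_lt
    exact ⟨_, _, (hR.strict_const_iff c d).2 h⟩
  cCompleteness c d := by
    rw [hR.const_const_iff, hR.const_const_iff]
    exact le_total _ _
  weakCIndependence := hR.weakCIndependence

theorem wellUnderstood_bet (hR : IsSimpleBoundsRep R N P u) (E : Sig) (c d : Lottery Z) :
    WellUnderstood R (Act.splice E (Act.const Sig c) (Act.const Sig d)) := by
  classical
  rw [hR.wellUnderstood_iff, profile_splice]
  refine (Set.encard_le_encard (t := {util u c, util u d}) ?_).trans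
    (le_trans ?_ hR.1.1)
  swap
  · exact (Set.encard_insert_le _ _).trans (by rw [Set.encard_singleton]; norm_num)
  refine (essRange_subset_range _).trans ?_
  rintro _ ⟨ω, rfl⟩
  dsimp only
  split_ifs
  · exact Or.inl rfl
  · exact Or.inr rfl

theorem integral_bet (hR : IsSimpleBoundsRep R N P u) (E : Sig) (c d : Lottery Z) :
    integral P (profile u (Act.splice E (Act.const Sig c) (Act.const Sig d))) =
      P E * util u c + (1 - P E) * util u d := by
  rw [profile_splice]
  exact SimpleBounds.integral_bet hR.prob E.2 (util u c) (util u d)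

theorem nonNull_iff (hR : IsSimpleBoundsRep R N P u) (E : Sig) : NonNull R E ↔ P E ≠ 0 := by
  have key : ∀ c₁ c₂ c₃ : Lottery Z,
      Strict R (Act.splice E (Act.const Sig c₂) (Act.const Sig c₁))
        (Act.splice E (Act.const Sig c₃) (Act.const Sig c₁)) ↔
      (P E : ℝ) * util u c₃ < P E * util u c₂ := by
    intro c₁ c₂ c₃
    rw [Strict, hR.rel_iff_of_wellUnderstood (hR.wellUnderstood_bet E _ _)
      (hR.wellUnderstood_bet E _ _), hR.rel_iff_of_wellUnderstood (hR.wellUnderstood_bet E _ _)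
      (hR.wellUnderstood_bet E _ _), hR.integral_bet, hR.integral_bet, ← lt_iff_le_not_ge,
      add_lt_add_iff_right]
  simp only [NonNull, key]
  constructor
  · rintro ⟨_, c₂, c₃, h⟩ h0
    simp [h0] at h
  · intro h0
    obtain ⟨c, d, h⟩ := hR.exists_util_lt
    exact ⟨c, c, d, mul_lt_mul_of_pos_left h (by positivity)⟩

theorem cells_eq (hR : IsSimpleBoundsRep R N P u) (f : Act Z Sig) :
    cells R f = Set.range fun ω => {ω' | profile u f ω' = profile u f ω} := by
  simp only [cells, hR.indiff_const_iff]
  rfl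

/-- On each coarse cell the act copies the lottery of `f` at a chosen state. Distinct coarse cells
receive distinct utilities, because their chosen states lie in different cells of `f`. -/
theorem a1 (hR : IsSimpleBoundsRep R N P u) : A1 R := by
  intro f hf τ' hτ' hsub
  rw [hR.cells_eq] at hsub
  have hcell : ∀ ω, ∃ T ∈ τ', ω ∈ T := fun ω => (hτ'.2 ω).exists
  choose cell hcell hmem using hcell
  have hcell_eq : ∀ T ∈ τ', ∀ ω ∈ T, cell ω = T := fun T hT ω hω =>
    (hτ'.2 ω).unique ⟨hcell ω, hmem ω⟩ ⟨hT, hω⟩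
  have hne : ∀ T ∈ τ', ∃ ω, ω ∈ T := fun T hT => by
    by_contra h
    rw [← Set.Nonempty, Set.not_nonempty_iff_eq_empty] at h
    exact hτ'.1 (h ▸ hT)
  rcases isEmpty_or_nonempty Ω with hΩ | hΩ
  · exact (not_isEmpty_iff.2 (nonempty_of_prob hR.prob) hΩ).elim
  choose! rep hrep using hne
  have hprof : ∀ ω ω', profile u f ω = profile u f ω' → cell ω = cell ω' := by
    intro ω ω' h
    obtain ⟨T', hT', hTT'⟩ := hsub _ ⟨ω', rfl⟩
    rw [hcell_eq T' hT' ω (hTT' h), hcell_eq T' hT' ω' (hTT' rfl)]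
  have hs : IsSimple Sig (fun ω => f (rep (cell ω))) :=
    (isSimple_act f).congr_fibers fun ω ω' h => by
      rw [hprof ω ω' (congrArg (util u) h)]
  have hker : ∀ ω ω', profile u (Act.ofSimple hs) ω = profile u (Act.ofSimple hs) ω' ↔
      cell ω = cell ω' := by
    intro ω ω'
    constructor
    · intro h
      have := hprof _ _ h
      rwa [hcell_eq _ (hcell ω) _ (hrep _ (hcell ω)),
        hcell_eq _ (hcell ω') _ (hrep _ (hcell ω'))] at this
    · intro h
      change util u (f (rep (cell ω))) = util u (f (rep (cell ω')))
      rw [h]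
  refine ⟨Act.ofSimple hs, ?_, ?_⟩
  · rw [hR.wellUnderstood_iff] at hf ⊢
    exact (essRange_encard_le_of_fibers (isSimple_profile u f) fun ω ω' h =>
      (hker ω ω').2 (hprof ω ω' h)).trans hf
  · rw [hR.cells_eq]
    simp only [hker]
    have hset : ∀ ω, {ω' | cell ω' = cell ω} = cell ω := fun ω => by
      ext ω'
      exact ⟨fun h => h ▸ hmem ω', fun h => hcell_eq _ (hcell ω) _ h⟩
    simp only [hset]
    ext T
    constructor
    · rintro ⟨ω, rfl⟩
      exact hcell ω
    · intro hT
      exact ⟨rep T, hcell_eq T hT _ (hrep T hT)⟩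

/-- The mixture is measurable for the partition of `f`, so it has no more essential values than `f`.
-/
theorem a2 (hR : IsSimpleBoundsRep R N P u) : A2 R := by
  intro f g hf hmeas _ _ t _ _
  rw [hR.wellUnderstood_iff] at hf ⊢
  refine (essRange_encard_le_of_fibers (isSimple_profile u f) fun ω ω' h => ?_).trans hf
  have hT := hmeas {ω'' | profile u f ω'' = profile u f ω'}
    (by rw [hR.cells_eq]; exact ⟨ω', rfl⟩) ω h ω' rfl
  rw [hR.indiff_const_iff] at hT
  change profile u g ω = profile u g ω' at hT
  simp only [profile_mix, h, hT]

/-- The values of `f` on `T` and `T'` are placed on `A` and `B` instead. As `T` and `T'` are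
non-null, both values already count in the essential range of `f`, which therefore does not grow
whatever the probabilities of `A` and `B`. -/
theorem a3 (hR : IsSimpleBoundsRep R N P u) : A3 R := by
  classical
  intro f hf T T' hT hT' hne hTn hTn' A B hA hB hAB hun
  rw [hR.wellUnderstood_iff] at hf
  rw [hR.nonNull_iff] at hTn hTn'
  rw [hR.cells_eq] at hT hT'
  obtain ⟨ω₁, hω₁⟩ := hT
  obtain ⟨ω₂, hω₂⟩ := hT'
  have hTmem : ∀ ω, ω ∈ (T : Set Ω) ↔ profile u f ω = profile u f ω₁ := fun ω => by
    rw [← hω₁]; rfl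
  have hTmem' : ∀ ω, ω ∈ (T' : Set Ω) ↔ profile u f ω = profile u f ω₂ := fun ω => by
    rw [← hω₂]; rfl
  have hne12 : profile u f ω₁ ≠ profile u f ω₂ := by
    intro h
    refine hne (Subtype.ext ?_)
    ext ω
    rw [hTmem, hTmem', h]
  have hABmem : ∀ ω, (ω ∈ (A : Set Ω) ∨ ω ∈ (B : Set Ω)) ↔
      (profile u f ω = profile u f ω₁ ∨ profile u f ω = profile u f ω₂) := fun ω => by
    rw [← hTmem, ← hTmem', ← Set.mem_union, hun, Set.mem_union]
  have hBA : ∀ ω, ω ∈ (B : Set Ω) → ω ∉ (A : Set Ω) := fun ω hb ha =>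
    Set.disjoint_left.1 hAB ha hb
  let g : Act Z Sig := Act.splice A (Act.const Sig (f ω₁)) (Act.splice B (Act.const Sig (f ω₂)) f)
  have hg : ∀ ω, profile u g ω = if ω ∈ (A : Set Ω) then profile u f ω₁ else
      if ω ∈ (B : Set Ω) then profile u f ω₂ else profile u f ω := fun ω => by
    simp only [g, profile_splice]
    rfl
  have hgA : ∀ ω, ω ∈ (A : Set Ω) ↔ profile u g ω = profile u f ω₁ := by
    intro ω
    rw [hg]
    by_cases ha : ω ∈ (A : Set Ω)
    · simp [ha]
    by_cases hb : ω ∈ (B : Set Ω)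
    · simp [ha, hb, hne12.symm]
    · have := (not_congr (hABmem ω)).1 (by tauto)
      simp [ha, hb]
      tauto
  have hgB : ∀ ω, ω ∈ (B : Set Ω) ↔ profile u g ω = profile u f ω₂ := by
    intro ω
    rw [hg]
    by_cases ha : ω ∈ (A : Set Ω)
    · have hb : ω ∉ (B : Set Ω) := fun hb => hBA ω hb ha
      simp [ha, hb, hne12]
    by_cases hb : ω ∈ (B : Set Ω)
    · simp [ha, hb]
    · have := (not_congr (hABmem ω)).1 (by tauto)
      simp [ha, hb]
      tauto
  have hgo : ∀ ω, ω ∉ (A : Set Ω) → ω ∉ (B : Set Ω) → profile u g ω = profile u f ω := by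
    intro ω ha hb
    rw [hg, if_neg ha, if_neg hb]
  refine ⟨g, ?_, ?_⟩
  · rw [hR.wellUnderstood_iff]
    refine (Set.encard_le_encard ?_).trans hf
    obtain ⟨E, hE, hE0, h⟩ := ae_mem_essRange (P := P) (isSimple_profile u f)
    refine essRange_subset_of_ae (isSimple_profile u g) hE hE0 fun ω hω => ?_
    by_cases ha : ω ∈ (A : Set Ω)
    · rw [(hgA ω).1 ha]
      rw [← hω₁] at hTn
      exact hTn
    by_cases hb : ω ∈ (B : Set Ω)
    · rw [(hgB ω).1 hb]
      rw [← hω₂] at hTn'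
      exact hTn'
    · rw [hgo ω ha hb]
      exact h ω hω
  · rw [hR.cells_eq, hR.cells_eq]
    have hcA : ∀ ω ∈ (A : Set Ω), {ω' | profile u g ω' = profile u g ω} = A := by
      intro ω hω
      ext ω'
      rw [Set.mem_ofPred_eq, (hgA ω).1 hω, ← hgA]
    have hcB : ∀ ω ∈ (B : Set Ω), {ω' | profile u g ω' = profile u g ω} = B := by
      intro ω hω
      ext ω'
      rw [Set.mem_ofPred_eq, (hgB ω).1 hω, ← hgB]
    have hco : ∀ ω, ω ∉ (A : Set Ω) → ω ∉ (B : Set Ω) →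
        {ω' | profile u g ω' = profile u g ω} = {ω' | profile u f ω' = profile u f ω} := by
      intro ω ha hb
      have hn := (not_congr (hABmem ω)).1 (by tauto)
      rw [not_or] at hn
      ext ω'
      rw [Set.mem_ofPred_eq, Set.mem_ofPred_eq, hgo ω ha hb]
      by_cases ha' : ω' ∈ (A : Set Ω)
      · have h1 := (hABmem ω').1 (Or.inl ha')
        rw [(hgA ω').1 ha']
        constructor
        · intro h; exact absurd h.symm hn.1
        · intro h; rw [h] at h1; tauto
      by_cases hb' : ω' ∈ (B : Set Ω)
      · have h1 := (hABmem ω').1 (Or.inr hb')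
        rw [(hgB ω').1 hb']
        constructor
        · intro h; exact absurd h.symm hn.2
        · intro h; rw [h] at h1; tauto
      rw [hgo ω' ha' hb']
    ext S
    constructor
    · rintro ⟨ω, rfl⟩
      dsimp only
      by_cases ha : ω ∈ (A : Set Ω)
      · rw [hcA ω ha]
        exact Or.inl (Or.inl rfl)
      by_cases hb : ω ∈ (B : Set Ω)
      · rw [hcB ω hb]
        exact Or.inl (Or.inr rfl)
      · rw [hco ω ha hb]
        have hn := (not_congr (hABmem ω)).1 (by tauto)
        rw [not_or] at hn
        refine Or.inr ⟨⟨ω, rfl⟩, ?_⟩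
        rintro (h | h)
        · exact hn.1 ((hTmem ω).1 (h ▸ rfl))
        · exact hn.2 ((hTmem' ω).1 (h ▸ rfl))
    · rintro ((rfl | rfl) | ⟨⟨ω, rfl⟩, hω⟩)
      · obtain ⟨ω, hω⟩ := hA
        exact ⟨ω, hcA ω hω⟩
      · obtain ⟨ω, hω⟩ := hB
        exact ⟨ω, hcB ω hω⟩
      · have hn : ¬ (ω ∈ (A : Set Ω) ∨ ω ∈ (B : Set Ω)) := by
          rw [hABmem]
          rintro (h | h)
          · refine hω (Or.inl ?_)
            dsimp only
            rw [h, ← hω₁]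
          · refine hω (Or.inr ?_)
            dsimp only
            rw [h, ← hω₂]
            rfl
        rw [not_or] at hn
        exact ⟨ω, hco ω hn.1 hn.2⟩

theorem a4 (hR : IsSimpleBoundsRep R N P u) : A4 R := by
  classical
  intro f hf E hE g
  rw [hR.nonNull_iff, not_not] at hE
  have hae : ∀ ω, ω ∉ (E : Set Ω) → profile u f ω = profile u (Act.splice E g f) ω :=
    fun ω hω => by rw [profile_splice]; exact (if_neg hω).symm
  have hs := isSimple_profile u (Act.splice E g f)
  have hwu : WellUnderstood R (Act.splice E g f) := by
    rw [hR.wellUnderstood_iff] at hf ⊢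
    rwa [← essRange_congr_ae (isSimple_profile u f) hs E.2 hE hae]
  have hint := integral_congr_ae (isSimple_profile u f) hs E.2 hE hae
  exact ⟨(hR.rel_iff_of_wellUnderstood hwu hf).2 hint.le,
    (hR.rel_iff_of_wellUnderstood hf hwu).2 hint.ge⟩

theorem simplicityConditions (hR : IsSimpleBoundsRep R N P u) : SimplicityConditions R where
  a0 E := by
    obtain ⟨c, d, h⟩ := hR.exists_util_lt
    exact ⟨c, d, (hR.strict_const_iff c d).2 h, hR.wellUnderstood_bet E c d⟩
  a1 := hR.a1
  a2 := hR.a2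
  a3 := hR.a3
  a4 := hR.a4

theorem sIndependence (hR : IsSimpleBoundsRep R N P u) : SIndependence R := by
  intro f g h hf hg _ t ht _ hfh hgh
  have ht' : (0 : ℝ) < t := ht
  rw [hR.rel_iff_of_wellUnderstood hf hg, hR.rel_iff_of_wellUnderstood hfh hgh, profile_mix,
    profile_mix, integral_mix (isSimple_profile u f) (isSimple_profile u h),
    integral_mix (isSimple_profile u g) (isSimple_profile u h), add_le_add_iff_right,
    mul_le_mul_iff_right₀ ht']

/-- The witnesses attain `lowerInt` below `f` and `upperInt` above `g`. -/
theorem uniformComparability (hR : IsSimpleBoundsRep R N P u) : UniformComparability R := by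
  intro f g hfg
  rw [hR.dominates_iff] at hfg
  constructor
  · intro h
    have h := ((hR.rel_iff f g).1 h).resolve_left hfg
    obtain ⟨k, hk1, hk2, hk3⟩ := exists_act_below (u := u) hR.prob hR.one_le f
    obtain ⟨l, hl1, hl2, hl3⟩ := exists_act_above (u := u) hR.prob hR.one_le g
    rw [← hR.wellUnderstood_iff] at hk1 hl1
    refine ⟨k, l, hk1, hl1, (hR.dominates_iff _ _).2 hk2, ?_, (hR.dominates_iff _ _).2 hl2⟩
    rw [hR.rel_iff_of_wellUnderstood hk1 hl1, hk3, hl3]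
    exact h
  · rintro ⟨k, l, -, -, hfk, hkl, hlg⟩
    exact hR.trans (hR.trans (hR.basicConditions.monotonicity _ _ hfk) hkl)
      (hR.basicConditions.monotonicity _ _ hlg)

end IsSimpleBoundsRep

/-! ### Necessity for the cautious relation, and uniqueness of utility and probability. -/

section Common

variable {Ω Z : Type*} {Sig : BooleanSubalgebra (Set Ω)}
  {P : MeasureTheory.AddContent ℝ≥0 (Sig : Set (Set Ω))} {N : ℕ∞} {u : Z → ℝ}
  {R R' : Act Z Sig → Act Z Sig → Prop}

theorem IsCautiousRep.rel_iff (h : IsCautiousRep R' N P u) (f g : Act Z Sig) :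
    R' f g ↔ lowerInt N P (profile u g) ≤ lowerInt N P (profile u f) :=
  (isCautiousRep_iff.1 h).2 f g

theorem IsCautiousRep.isPreorderRel (h : IsCautiousRep R' N P u) : IsPreorderRel R' := by
  refine ⟨fun f => (h.rel_iff f f).2 le_rfl, fun f g k h1 h2 => ?_⟩
  rw [h.rel_iff] at h1 h2 ⊢
  exact h2.trans h1

theorem IsCautiousRep.archimedeanContinuity (h : IsCautiousRep R' N P u) :
    ArchimedeanContinuity R' := by
  intro f g k
  have hc := (continuous_lowerInt_mix (N := N) h.1.2.1 h.1.one_le (isSimple_profile u f)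
    (isSimple_profile u g)).comp (continuous_subtype_val (p := (· ∈ unitInterval)))
  simp only [h.rel_iff, profile_mix]
  exact ⟨isClosed_le continuous_const hc, isClosed_le hc continuous_const⟩

theorem IsCommonRep.consistency (h : IsCommonRep R R' N P u) : Consistency R R' := by
  intro f g hfg
  rw [h.2.rel_iff]
  rcases (h.1.rel_iff f g).1 hfg with h1 | h1
  · exact lowerInt_mono h.1.prob h.1.one_le (isSimple_profile u g) (isSimple_profile u f)
      (AELE.of_le h1)
  · exact (lowerInt_le_upperInt h.1.prob h.1.one_le (isSimple_profile u g)).trans h1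

theorem IsCommonRep.strongConsistency (h : IsCommonRep R R' N P u) :
    StrongConsistencyForSimpleActs R R' := by
  intro f g hf hg
  rw [h.1.rel_iff_of_wellUnderstood hf hg, h.2.rel_iff]
  rw [h.1.wellUnderstood_iff] at hf hg
  rw [lowerInt_eq_integral h.1.prob h.1.one_le (isSimple_profile u f) hf,
    lowerInt_eq_integral h.1.prob h.1.one_le (isSimple_profile u g) hg]

theorem IsCommonRep.caution (h : IsCommonRep R R' N P u) : Caution R R' := by
  intro f c hfc
  rw [h.1.rel_const_iff] at hfc
  rw [h.2.rel_iff, profile_const, lowerInt_const h.1.prob h.1.one_le]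
  exact (not_le.1 hfc).le

/-- Of three lotteries the middle one is indifferent to a mixture of the outer two, with the same
weight for both utilities. So the utilities agree on ratios of differences. -/
theorem IsSimpleBoundsRep.utility_unique {N' : ℕ∞}
    {P' : MeasureTheory.AddContent ℝ≥0 (Sig : Set (Set Ω))} {u' : Z → ℝ}
    (h : IsSimpleBoundsRep R N P u) (h' : IsSimpleBoundsRep R N' P' u') :
    ∃ a b : ℝ, 0 < a ∧ ∀ z, u' z = a * u z + b := by
  have hle : ∀ c d : Lottery Z, util u d ≤ util u c ↔ util u' d ≤ util u' c := fun c d => by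
    rw [← h.const_const_iff, h'.const_const_iff]
  have heq : ∀ c d : Lottery Z, util u d = util u c → util u' d = util u' c := fun c d hcd =>
    le_antisymm ((hle c d).1 hcd.le) ((hle d c).1 hcd.ge)
  obtain ⟨c, d, hlt⟩ := h.exists_util_lt
  have hlt' : util u' d < util u' c := by
    rw [← not_le, ← hle, not_le]
    exact hlt
  set D := util u c - util u d with hD
  have hDpos : 0 < D := by linarith
  refine ⟨(util u' c - util u' d) / D, util u' d - (util u' c - util u' d) / D * util u d,
    div_pos (by linarith) hDpos, fun z => ?_⟩
  have key : ∀ (p q r : Lottery Z), util u p ≤ util u q → util u q ≤ util u r →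
      (util u r - util u p) * (util u' q - util u' p) =
        (util u' r - util u' p) * (util u q - util u p) := by
    intro p q r hpq hqr
    obtain ⟨t, ht⟩ := exists_lottery_between hpq hqr
    have ht' := heq _ _ ht
    rw [util_mix] at ht ht'
    rw [← ht, ← ht']
    ring
  rw [← util_single u' z, ← util_single u z]
  set p : Lottery Z := Convexity.StdSimplex.single z
  have hgoal : D * (util u' p - util u' d) = (util u' c - util u' d) * (util u p - util u d) := by
    rcases le_total (util u p) (util u d) with h1 | h1
    · have := key p d c h1 hlt.le
      rw [hD]
      linarith
    · rcases le_total (util u p) (util u c) with h2 | h2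
      · have := key d p c h1 h2
        rw [hD]
        linarith
      · have := key d c p hlt.le h2
        rw [hD]
        linarith
  field_simp
  linarith

/-- A bet on `E` is well-understood since `N` is at least 2, and the utility of its certain
equivalent reveals the weight of `E`. -/
theorem IsSimpleBoundsRep.prob_unique {N' : ℕ∞}
    {P' : MeasureTheory.AddContent ℝ≥0 (Sig : Set (Set Ω))} {u' : Z → ℝ}
    (h : IsSimpleBoundsRep R N P u) (h' : IsSimpleBoundsRep R N' P' u') {E : Set Ω}
    (hE : E ∈ Sig) : P' E = P E := by
  obtain ⟨c, d, hlt⟩ := h.exists_util_lt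
  have hbet := h.wellUnderstood_bet ⟨E, hE⟩ c d
  obtain ⟨a, b, ha, hu⟩ := h.utility_unique h'
  have hu' : ∀ p : Lottery Z, util u' p = a * util u p + b := fun p => by
    rw [← util_affine]
    congr 1
    exact funext hu
  have hval : ∀ {N : ℕ∞} {P : MeasureTheory.AddContent ℝ≥0 (Sig : Set (Set Ω))} {u : Z → ℝ},
      IsSimpleBoundsRep R N P u → ∀ e : Lottery Z,
      Indiff R (Act.splice ⟨E, hE⟩ (Act.const Sig c) (Act.const Sig d)) (Act.const Sig e) →
      P E * util u c + (1 - P E) * util u d = util u e := by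
    intro N P u h e he
    have hwe : WellUnderstood R (Act.const Sig e) :=
      ⟨e, h.basicConditions.preorder.1 _, h.basicConditions.preorder.1 _⟩
    have h1 := (h.rel_iff_of_wellUnderstood (h.wellUnderstood_bet ⟨E, hE⟩ c d) hwe).1 he.1
    have h2 := (h.rel_iff_of_wellUnderstood hwe (h.wellUnderstood_bet ⟨E, hE⟩ c d)).1 he.2
    rw [h.integral_bet, profile_const, integral_const h.prob] at h1 h2
    exact le_antisymm h2 h1
  obtain ⟨e, he⟩ := hbet
  have h1 := hval h e he
  have h2 := hval h' e he
  rw [hu', hu', hu', ← h1] at h2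
  have h3 : ((P' E : ℝ) - P E) * (a * (util u c - util u d)) = 0 := by linarith
  rcases mul_eq_zero.1 h3 with h4 | h4
  · exact NNReal.coe_injective (sub_eq_zero.1 h4)
  · exact absurd h4 (mul_pos ha (sub_pos.2 hlt)).ne'

end Common

/-! ### The expected utility theorem for lotteries. -/

section ExpectedUtility

variable {Z : Type*} {r : Lottery Z → Lottery Z → Prop}

/-- The cone of directions `l (p - q)` along which preference does not decrease. -/
def PrefCone (r : Lottery Z → Lottery Z → Prop) (v : Z →₀ ℝ) : Prop :=
  ∃ l : ℝ, 0 < l ∧ ∃ p q : Lottery Z, v = l • (p.weights - q.weights) ∧ r p q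

/-- Independence for a relation on lotteries. -/
def LotteryIndependence (r : Lottery Z → Lottery Z → Prop) : Prop :=
  ∀ (p q s : Lottery Z) (t : unitInterval), 0 < t → t < 1 →
    (r p q ↔ r (Lottery.mix t p s) (Lottery.mix t q s))

theorem exists_ratio {l l' : ℝ} (hl : 0 < l) (hl' : 0 < l') :
    ∃ t : unitInterval, 0 < t ∧ t < 1 ∧ (t : ℝ) = l / (l + l') := by
  have h : 0 < l + l' := by positivity
  refine ⟨⟨l / (l + l'), by positivity, (div_le_one h).2 (by linarith)⟩, ?_, ?_, rfl⟩
  · exact Subtype.mk_lt_mk.2 (by positivity)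
  · exact Subtype.mk_lt_mk.2 ((div_lt_one h).2 (by linarith))

/-- The equation says `l p + l' q' = l' p' + l q`. So mixing `p` and `q` with `q'` in the ratio `l :
l'` yields mixtures of `p'` and `q'` with `q`, and Independence is used forwards, then backwards. -/
theorem rel_of_smul_eq (hind : LotteryIndependence r) {l l' : ℝ} (hl : 0 < l) (hl' : 0 < l')
    {p q p' q' : Lottery Z}
    (h : l • (p.weights - q.weights) = l' • (p'.weights - q'.weights)) (hpq : r p q) :
    r p' q' := by
  obtain ⟨t, ht0, ht1, ht⟩ := exists_ratio hl hl'
  obtain ⟨t', ht0', ht1', ht'⟩ := exists_ratio hl' hl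
  have hz : ∀ z, l * (p.weights z - q.weights z) = l' * (p'.weights z - q'.weights z) := fun z => by
    simpa using DFunLike.congr_fun h z
  have hsum : l + l' ≠ 0 := by positivity
  have hsum' : l' + l ≠ 0 := by positivity
  have e1 : Lottery.mix t p q' = Lottery.mix t' p' q := by
    apply Convexity.StdSimplex.ext
    ext z
    simp only [Lottery.mix_weights, Finsupp.add_apply, Finsupp.smul_apply, smul_eq_mul, ht, ht']
    have := hz z
    field_simp
    linear_combination (l + l') * this
  have e2 : Lottery.mix t q q' = Lottery.mix t' q' q := by
    apply Convexity.StdSimplex.ext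
    ext z
    simp only [Lottery.mix_weights, Finsupp.add_apply, Finsupp.smul_apply, smul_eq_mul, ht, ht']
    field_simp
    ring
  have := (hind p q q' t ht0 ht1).1 hpq
  rw [e1, e2] at this
  exact (hind p' q' q t' ht0' ht1').2 this

/-- Preference depends only on the direction of the difference, so it can be studied as membership
in a convex cone. -/
theorem prefCone_sub_iff (hind : LotteryIndependence r) (p q : Lottery Z) :
    PrefCone r (p.weights - q.weights) ↔ r p q := by
  constructor
  · rintro ⟨l, hl, p', q', h, hr⟩
    exact rel_of_smul_eq hind hl one_pos (by rw [one_smul, h]) hr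
  · intro h
    exact ⟨1, one_pos, p, q, (one_smul _ _).symm, h⟩

theorem PrefCone.smul {v : Z →₀ ℝ} (h : PrefCone r v) {a : ℝ} (ha : 0 < a) :
    PrefCone r (a • v) := by
  obtain ⟨l, hl, p, q, rfl, hr⟩ := h
  exact ⟨a * l, by positivity, p, q, by rw [smul_smul], hr⟩

theorem Lottery.mix_swap (t t' : unitInterval) (h : (t' : ℝ) = 1 - t) (p q : Lottery Z) :
    Lottery.mix t p q = Lottery.mix t' q p := by
  apply Convexity.StdSimplex.ext
  rw [Lottery.mix_weights, Lottery.mix_weights, h, sub_sub_cancel, add_comm]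

theorem PrefCone.add (hind : LotteryIndependence r) (htr : ∀ p q s, r p q → r q s → r p s)
    {v w : Z →₀ ℝ} (hv : PrefCone r v) (hw : PrefCone r w) : PrefCone r (v + w) := by
  obtain ⟨l, hl, p, q, rfl, hr⟩ := hv
  obtain ⟨l', hl', p', q', rfl, hr'⟩ := hw
  obtain ⟨t, ht0, ht1, ht⟩ := exists_ratio hl hl'
  obtain ⟨t', ht0', ht1', ht'⟩ := exists_ratio hl' hl
  have htt : (t' : ℝ) = 1 - t := by
    rw [ht, ht']
    field_simp
    ring
  refine ⟨l + l', by positivity, Lottery.mix t p p', Lottery.mix t q q', ?_, ?_⟩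
  · ext z
    simp only [Lottery.mix_weights, Finsupp.add_apply, Finsupp.smul_apply, Finsupp.sub_apply,
      smul_eq_mul, ht]
    field_simp
    ring
  · refine htr _ _ _ ((hind p q p' t ht0 ht1).1 hr) ?_
    rw [Lottery.mix_swap t t' htt q p', Lottery.mix_swap t t' htt q q']
    exact (hind p' q' q t' ht0' ht1').1 hr'

/-- Two non-empty closed sets covering the connected unit interval must meet. -/
theorem exists_mix_indiff (htot : ∀ p q, r p q ∨ r q p)
    (hcl : ∀ p q s : Lottery Z, IsClosed {t : unitInterval | r (Lottery.mix t p q) s} ∧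
      IsClosed {t : unitInterval | r s (Lottery.mix t p q)})
    {a b e : Lottery Z} (hab : r a b) (hbe : r b e) :
    ∃ t : unitInterval, r b (Lottery.mix t a e) ∧ r (Lottery.mix t a e) b := by
  obtain ⟨t, -, ht⟩ := isPreconnected_closed_iff.1 (isPreconnected_univ (α := unitInterval))
    {t | r b (Lottery.mix t a e)} {t | r (Lottery.mix t a e) b} (hcl a e b).2 (hcl a e b).1
    (fun t _ => htot _ _) ⟨0, trivial, by simpa using hbe⟩ ⟨1, trivial, by simpa using hab⟩
  exact ⟨t, ht⟩

/-- The directions of indifference. -/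
def IndiffDir (r : Lottery Z → Lottery Z → Prop) (v : Z →₀ ℝ) : Prop :=
  PrefCone r v ∧ PrefCone r (-v)

theorem IndiffDir.neg {v : Z →₀ ℝ} (h : IndiffDir r v) : IndiffDir r (-v) :=
  ⟨h.2, by rw [neg_neg]; exact h.1⟩

theorem IndiffDir.add (hind : LotteryIndependence r) (htr : ∀ p q s, r p q → r q s → r p s)
    {v w : Z →₀ ℝ} (hv : IndiffDir r v) (hw : IndiffDir r w) : IndiffDir r (v + w) :=
  ⟨hv.1.add hind htr hw.1, by rw [neg_add]; exact hv.2.add hind htr hw.2⟩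

theorem IndiffDir.smul_pos {v : Z →₀ ℝ} (h : IndiffDir r v) {a : ℝ} (ha : 0 < a) :
    IndiffDir r (a • v) :=
  ⟨h.1.smul ha, by rw [← smul_neg]; exact h.2.smul ha⟩

theorem indiffDir_of_mix (hind : LotteryIndependence r) {a b e : Lottery Z} {t : unitInterval}
    (h : r b (Lottery.mix t a e) ∧ r (Lottery.mix t a e) b) :
    IndiffDir r (b.weights - (Lottery.mix t a e).weights) :=
  ⟨(prefCone_sub_iff hind _ _).2 h.1, by
    rw [neg_sub]; exact (prefCone_sub_iff hind _ _).2 h.2⟩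

/-- The number `s` is the utility of `p` on the scale with `d` at 0 and `c` at 1. It is read off an
indifference between the middle one of `p`, `c`, `d` and a mixture of the other two. -/
theorem exists_calibration (hind : LotteryIndependence r)
    (htot : ∀ p q, r p q ∨ r q p)
    (hcl : ∀ p q s : Lottery Z, IsClosed {t : unitInterval | r (Lottery.mix t p q) s} ∧
      IsClosed {t : unitInterval | r s (Lottery.mix t p q)})
    {c d : Lottery Z} (hcd : r c d) (hdc : ¬ r d c) (p : Lottery Z) :
    ∃ s : ℝ, IndiffDir r (p.weights - d.weights - s • (c.weights - d.weights)) := by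
  rcases htot p c with hpc | hcp
  · obtain ⟨t, ht⟩ := exists_mix_indiff htot hcl hpc hcd
    have ht0 : (t : ℝ) ≠ 0 := by
      intro h
      have h0 : t = 0 := Subtype.ext h
      rw [h0, Lottery.mix_zero] at ht
      exact hdc ht.2
    have htpos : 0 < (t : ℝ) := lt_of_le_of_ne t.2.1 ht0.symm
    refine ⟨(t : ℝ)⁻¹, ?_⟩
    have := (indiffDir_of_mix hind ht).neg.smul_pos (inv_pos.2 htpos)
    convert! this using 1
    ext z
    simp only [Lottery.mix_weights, Finsupp.add_apply, Finsupp.smul_apply, Finsupp.sub_apply,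
      Finsupp.neg_apply, smul_eq_mul]
    field_simp
    ring
  · rcases htot p d with hpd | hdp
    · obtain ⟨t, ht⟩ := exists_mix_indiff htot hcl hcp hpd
      refine ⟨t, ?_⟩
      convert! indiffDir_of_mix hind ht using 1
      ext z
      simp only [Lottery.mix_weights, Finsupp.add_apply, Finsupp.smul_apply, Finsupp.sub_apply,
        smul_eq_mul]
      ring
    · obtain ⟨t, ht⟩ := exists_mix_indiff htot hcl hcd hdp
      have ht1 : (t : ℝ) ≠ 1 := by
        intro h
        have h1 : t = 1 := Subtype.ext h
        rw [h1, Lottery.mix_one] at ht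
        exact hdc ht.1
      have htpos : 0 < 1 - (t : ℝ) := sub_pos.2 (lt_of_le_of_ne t.2.2 ht1)
      refine ⟨-(t * (1 - (t : ℝ))⁻¹), ?_⟩
      have := (indiffDir_of_mix hind ht).neg.smul_pos (inv_pos.2 htpos)
      convert! this using 1
      ext z
      simp only [Lottery.mix_weights, Finsupp.add_apply, Finsupp.smul_apply, Finsupp.sub_apply,
        Finsupp.neg_apply, smul_eq_mul]
      field_simp
      ring

/-- The expected utility theorem for finitely supported lotteries. -/
theorem exists_expected_utility (hind : LotteryIndependence r)
    (htr : ∀ p q s, r p q → r q s → r p s) (htot : ∀ p q, r p q ∨ r q p)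
    (hcl : ∀ p q s : Lottery Z, IsClosed {t : unitInterval | r (Lottery.mix t p q) s} ∧
      IsClosed {t : unitInterval | r s (Lottery.mix t p q)})
    {c d : Lottery Z} (hcd : r c d) (hdc : ¬ r d c) :
    ∃ u : Z → ℝ, ∀ p q, r p q ↔ util u q ≤ util u p := by
  have hdd : r d d := (htot d d).elim id id
  have hzero : IndiffDir r 0 := by
    constructor
    · rw [← sub_self d.weights]
      exact (prefCone_sub_iff hind _ _).2 hdd
    · rw [neg_zero, ← sub_self d.weights]
      exact (prefCone_sub_iff hind _ _).2 hdd
  have hsmul : ∀ {v : Z →₀ ℝ} {a : ℝ}, 0 ≤ a → IndiffDir r v → IndiffDir r (a • v) := by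
    intro v a ha hv
    rcases ha.eq_or_lt with rfl | h
    · rw [zero_smul]; exact hzero
    · exact hv.smul_pos h
  choose u hu using fun z : Z =>
    exists_calibration hind htot hcl hcd hdc (Convexity.StdSimplex.single z)
  -- Directions of indifference are closed under non-negative combinations, so the calibrations of
  -- the point masses, weighted by `p`, calibrate `p`.
  have hU : ∀ p : Lottery Z,
      IndiffDir r (p.weights - d.weights - util u p • (c.weights - d.weights)) := by
    intro p
    have hsum : ∀ s : Finset Z, IndiffDir r (∑ z ∈ s, p.weights z •
        ((Convexity.StdSimplex.single z : Lottery Z).weights - d.weights -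
          u z • (c.weights - d.weights))) := by
      classical
      intro s
      induction s using Finset.induction_on with
      | empty => simpa using hzero
      | insert z s hz ih =>
        rw [Finset.sum_insert hz]
        exact (hsmul (p.nonneg z) (hu z)).add hind htr ih
    convert! hsum p.weights.support using 1
    have h1 : p.weights = ∑ z ∈ p.weights.support,
        p.weights z • (Convexity.StdSimplex.single z : Lottery Z).weights := by
      conv_lhs => rw [← Finsupp.sum_single p.weights]
      refine Finset.sum_congr rfl fun z _ => ?_
      simp
    have h2 : d.weights = ∑ z ∈ p.weights.support, p.weights z • d.weights := by
      rw [← Finset.sum_smul]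
      have := p.total
      rw [Finsupp.sum] at this
      rw [this, one_smul]
    have h3 : util u p • (c.weights - d.weights) =
        ∑ z ∈ p.weights.support, p.weights z • u z • (c.weights - d.weights) := by
      rw [util, Finsupp.sum, Finset.sum_smul]
      exact Finset.sum_congr rfl fun z _ => mul_smul _ _ _
    simp only [smul_sub (p.weights _), Finset.sum_sub_distrib]
    rw [← h1, ← h2, h3]
  refine ⟨u, fun p q => ?_⟩
  have hcd' : PrefCone r (c.weights - d.weights) := (prefCone_sub_iff hind _ _).2 hcd
  have hI := (hU p).add hind htr (hU q).neg
  rw [← prefCone_sub_iff hind]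
  constructor
  · intro h
    by_contra hlt
    rw [not_le] at hlt
    -- Up to indifference `p - q` is `(util u p - util u q) (c - d)`. A negative coefficient would
    -- put `d - c` in the cone.
    have h1 := (h.add hind htr hI.2).smul (inv_pos.2 (sub_pos.2 hlt))
    refine hdc ((prefCone_sub_iff hind _ _).1 ?_)
    convert! h1 using 1
    have hne : util u q - util u p ≠ 0 := (sub_pos.2 hlt).ne'
    ext z
    simp only [Finsupp.add_apply, Finsupp.smul_apply, Finsupp.sub_apply, Finsupp.neg_apply,
      smul_eq_mul]
    field_simp
    ring
  · intro h
    rcases h.eq_or_lt with he | hlt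
    · convert! hI.1 using 1
      rw [he]
      abel
    · convert! (hcd'.smul (sub_pos.2 hlt)).add hind htr hI.1 using 1
      ext z
      simp only [Finsupp.add_apply, Finsupp.smul_apply, Finsupp.sub_apply, Finsupp.neg_apply,
        smul_eq_mul]
      ring

/-- Weak C-Independence for constant acts is Independence on lotteries. Some constants compare
strictly, since otherwise Monotonicity would make all acts indifferent. -/
theorem BasicConditions.exists_utility {Ω : Type*} {Sig : BooleanSubalgebra (Set Ω)}
    {R : Act Z Sig → Act Z Sig → Prop} (hB : BasicConditions R) :
    ∃ u : Z → ℝ, (∃ z z', u z ≠ u z') ∧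
      ∀ c d : Lottery Z, R (Act.const Sig c) (Act.const Sig d) ↔ util u d ≤ util u c := by
  have hnt : ∃ c d : Lottery Z, ¬ R (Act.const Sig d) (Act.const Sig c) := by
    by_contra! h
    obtain ⟨f, g, -, hgf⟩ := hB.nontriviality
    exact hgf (hB.monotonicity _ _ fun ω => h _ _)
  obtain ⟨c, d, hdc⟩ := hnt
  have hcd := (hB.cCompleteness c d).resolve_right hdc
  obtain ⟨u, hu⟩ := exists_expected_utility
    (r := fun p q => R (Act.const Sig p) (Act.const Sig q))
    (fun p q s t h0 h1 => (hB.weakCIndependence q s (Act.const Sig p) t h0 h1).1)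
    (fun p q s => hB.preorder.2 _ _ _) hB.cCompleteness
    (fun p q s => hB.archimedean (Act.const Sig p) (Act.const Sig q) (Act.const Sig s)) hcd hdc
  refine ⟨u, ?_, hu⟩
  by_contra! h
  refine hdc ((hu d c).2 (le_of_eq ?_))
  have hc : ∀ p : Lottery Z, ∀ z, util u p = u z := by
    intro p z
    rw [util, Finsupp.sum_congr (g2 := fun _ r => r * u z) fun z' _ => by rw [h z' z],
      ← Finsupp.sum_mul, p.total, one_mul]
  obtain ⟨z⟩ := c.nonempty
  rw [hc c z, hc d z]

end ExpectedUtility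

/-! ### Certain equivalents as values of utility profiles, and the probability revealed by bets. -/

section Value

variable {Ω Z β : Type*} {Sig : BooleanSubalgebra (Set Ω)} {R : Act Z Sig → Act Z Sig → Prop}
  {u : Z → ℝ}

/-- The axioms on the objective relation, together with a utility for its restriction to
constant acts. -/
structure UtilityModel (R : Act Z Sig → Act Z Sig → Prop) (u : Z → ℝ) : Prop where
  basic : BasicConditions R
  simplicity : SimplicityConditions R
  sIndependence : SIndependence R
  nonconst : ∃ z z', u z ≠ u z'
  const_iff : ∀ c d : Lottery Z,
    R (Act.const Sig c) (Act.const Sig d) ↔ util u d ≤ util u c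

/-- Acts with utility profile `x` have a certain equivalent of utility `v`. -/
def HasValue (R : Act Z Sig → Act Z Sig → Prop) (u : Z → ℝ) (x : Ω → ℝ) (v : ℝ) : Prop :=
  ∃ (f : Act Z Sig) (c : Lottery Z),
    profile u f = x ∧ util u c = v ∧ Indiff R f (Act.const Sig c)

namespace HasValue

variable {x y : Ω → ℝ} {v w : ℝ}

theorem isSimple (hx : HasValue R u x v) : IsSimple Sig x := by
  obtain ⟨f, c, rfl, -, -⟩ := hx
  exact isSimple_profile u f

theorem mem (hx : HasValue R u x v) (ω : Ω) : x ω ∈ Set.range (util u) := by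
  obtain ⟨f, c, rfl, -, -⟩ := hx
  exact profile_mem u f ω

theorem value_mem (hx : HasValue R u x v) : v ∈ Set.range (util u) := by
  obtain ⟨f, c, -, rfl, -⟩ := hx
  exact ⟨c, rfl⟩

end HasValue

namespace UtilityModel

variable {x y : Ω → ℝ} {v w : ℝ} (h : UtilityModel R u)
include h

theorem rel_refl (f : Act Z Sig) : R f f := h.basic.preorder.1 f

theorem rel_trans {f g k : Act Z Sig} (h₁ : R f g) (h₂ : R g k) : R f k :=
  h.basic.preorder.2 _ _ _ h₁ h₂

theorem rel_of_le {f g : Act Z Sig} (hle : ∀ ω, profile u g ω ≤ profile u f ω) : R f g :=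
  h.basic.monotonicity _ _ fun ω => (h.const_iff _ _).2 (hle ω)

theorem nonempty : Nonempty Ω := by
  by_contra hΩ
  rw [not_nonempty_iff] at hΩ
  obtain ⟨f, g, -, hgf⟩ := h.basic.nontriviality
  exact hgf (h.rel_of_le fun ω => hΩ.elim ω)

theorem exists_lt : ∃ p ∈ Set.range (util u), ∃ q ∈ Set.range (util u), p < q := by
  obtain ⟨z, z', hz⟩ := h.nonconst
  rcases lt_or_gt_of_ne hz with hlt | hlt
  · exact ⟨_, ⟨_, util_single u z⟩, _, ⟨_, util_single u z'⟩, hlt⟩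
  · exact ⟨_, ⟨_, util_single u z'⟩, _, ⟨_, util_single u z⟩, hlt⟩

/-- By Monotonicity the act and the lottery witnessing `HasValue` may be exchanged for any others
with the same utilities. -/
theorem indiff_const (hx : HasValue R u x v) {f : Act Z Sig} {c : Lottery Z}
    (hf : profile u f = x) (hc : util u c = v) : Indiff R f (Act.const Sig c) := by
  obtain ⟨f', c', hf', hc', h1, h2⟩ := hx
  have e1 : ∀ ω, profile u f ω = profile u f' ω := fun ω => by rw [hf, hf']
  have e2 : util u c = util u c' := by rw [hc, hc']
  exact ⟨h.rel_trans (h.rel_of_le fun ω => (e1 ω).ge)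
      (h.rel_trans h1 ((h.const_iff _ _).2 e2.le)),
    h.rel_trans ((h.const_iff _ _).2 e2.ge) (h.rel_trans h2 (h.rel_of_le fun ω => (e1 ω).le))⟩

theorem wellUnderstood (hx : HasValue R u x v) {f : Act Z Sig} (hf : profile u f = x) :
    WellUnderstood R f := by
  obtain ⟨c, hc⟩ := hx.value_mem
  exact ⟨c, h.indiff_const hx hf hc⟩

omit h in
theorem hasValue_of_wellUnderstood {f : Act Z Sig} (hf : WellUnderstood R f) :
    ∃ v, HasValue R u (profile u f) v := by
  obtain ⟨c, hc⟩ := hf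
  exact ⟨_, f, c, rfl, rfl, hc⟩

theorem rel_iff {f g : Act Z Sig} (hf : HasValue R u (profile u f) v)
    (hg : HasValue R u (profile u g) w) : R f g ↔ w ≤ v := by
  obtain ⟨c, hc⟩ := hf.value_mem
  obtain ⟨d, hd⟩ := hg.value_mem
  have h1 := h.indiff_const hf rfl hc
  have h2 := h.indiff_const hg rfl hd
  rw [← hc, ← hd, ← h.const_iff]
  exact ⟨fun hr => h.rel_trans h1.2 (h.rel_trans hr h2.1),
    fun hr => h.rel_trans h1.1 (h.rel_trans hr h2.2)⟩

theorem value_mono (hx : HasValue R u x v) (hy : HasValue R u y w) (hle : ∀ ω, x ω ≤ y ω) :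
    v ≤ w := by
  obtain ⟨f, _, rfl, -, -⟩ := id hx
  obtain ⟨g, _, rfl, -, -⟩ := id hy
  exact (h.rel_iff hy hx).1 (h.rel_of_le hle)

theorem value_unique (hx : HasValue R u x v) (hy : HasValue R u x w) : v = w :=
  le_antisymm (h.value_mono hx hy fun _ => le_rfl) (h.value_mono hy hx fun _ => le_rfl)

theorem hasValue_const {c : ℝ} (hc : c ∈ Set.range (util u)) : HasValue R u (fun _ => c) c := by
  obtain ⟨p, rfl⟩ := hc
  exact ⟨Act.const Sig p, p, rfl, rfl, h.rel_refl _, h.rel_refl _⟩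

theorem exists_le_value_le (hx : HasValue R u x v) : ∃ ω ω', x ω ≤ v ∧ v ≤ x ω' := by
  have := h.nonempty
  obtain ⟨_, ⟨ω, rfl⟩, hmin⟩ :=
    Set.exists_min_image (Set.range x) id hx.isSimple.finite_range (Set.range_nonempty x)
  obtain ⟨_, ⟨ω', rfl⟩, hmax⟩ :=
    Set.exists_max_image (Set.range x) id hx.isSimple.finite_range (Set.range_nonempty x)
  exact ⟨ω, ω', h.value_mono (h.hasValue_const (hx.mem ω)) hx fun ω'' => hmin _ ⟨ω'', rfl⟩,
    h.value_mono hx (h.hasValue_const (hx.mem ω')) fun ω'' => hmax _ ⟨ω'', rfl⟩⟩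

theorem hasValue_mix_const (hx : HasValue R u x v) {c : ℝ} (hc : c ∈ Set.range (util u))
    {t : ℝ} (ht0 : 0 < t) (ht1 : t < 1) :
    HasValue R u (fun ω => t * x ω + (1 - t) * c) (t * v + (1 - t) * c) := by
  obtain ⟨f, d, rfl, rfl, hi⟩ := hx
  obtain ⟨p, rfl⟩ := hc
  let s : unitInterval := ⟨t, ht0.le, ht1.le⟩
  have hw := h.basic.weakCIndependence d p f s (Subtype.mk_lt_mk.2 ht0) (Subtype.mk_lt_mk.2 ht1)
  exact ⟨Act.mix s f (Act.const Sig p), Lottery.mix s d p, profile_mix s f _, util_mix u s d p,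
    hw.1.1 hi.1, hw.2.1 hi.2⟩

theorem hasValue_of_mix_const (hx : IsSimple Sig x) (hxJ : ∀ ω, x ω ∈ Set.range (util u))
    (hv : v ∈ Set.range (util u)) {c : ℝ} (hc : c ∈ Set.range (util u))
    {t : ℝ} (ht0 : 0 < t) (ht1 : t < 1)
    (hm : HasValue R u (fun ω => t * x ω + (1 - t) * c) (t * v + (1 - t) * c)) :
    HasValue R u x v := by
  obtain ⟨f, rfl⟩ := exists_act_profile hx hxJ
  obtain ⟨p, rfl⟩ := hc
  obtain ⟨d, rfl⟩ := hv
  let s : unitInterval := ⟨t, ht0.le, ht1.le⟩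
  have hw := h.basic.weakCIndependence d p f s (Subtype.mk_lt_mk.2 ht0) (Subtype.mk_lt_mk.2 ht1)
  have hi := h.indiff_const hm (f := Act.mix s f (Act.const Sig p)) (c := Lottery.mix s d p)
    (profile_mix s f _) (util_mix u s d p)
  exact ⟨f, d, rfl, rfl, hw.1.2 hi.1, hw.2.2 hi.2⟩

/-- Mixing `a x + b` with a constant `c` is also mixing `x` with a constant `c'`: `t (a x + b) + (1
- t) c = t a x + (1 - t a) c'`. As `t` tends to 0, `c'` tends to `c`. With `c` interior to the
utility range, `c'` is a utility for small `t`, and Weak C-Independence applies in both directions.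
-/
theorem hasValue_affine (hx : HasValue R u x v) {a : ℝ} (ha : 0 < a) (b : ℝ)
    (hJ : ∀ ω, a * x ω + b ∈ Set.range (util u)) :
    HasValue R u (fun ω => a * x ω + b) (a * v + b) := by
  obtain ⟨p, hp, q, hq, hpq⟩ := h.exists_lt
  set c := (p + q) / 2 with hc
  have hlim : Filter.Tendsto (fun t : ℝ => (t * b + (1 - t) * c) / (1 - t * a))
      (nhdsWithin 0 (Set.Ioi 0)) (nhds c) := by
    have : ContinuousAt (fun t : ℝ => (t * b + (1 - t) * c) / (1 - t * a)) 0 :=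
      ContinuousAt.div (by fun_prop) (by fun_prop) (by norm_num)
    have h0 := this.tendsto
    simp only [zero_mul, sub_zero, one_mul, zero_add, div_one] at h0
    exact h0.mono_left nhdsWithin_le_nhds
  have h1 : ∀ᶠ t in nhdsWithin (0 : ℝ) (Set.Ioi 0),
      (t * b + (1 - t) * c) / (1 - t * a) ∈ Set.Ioo p q :=
    hlim (Ioo_mem_nhds (by linarith) (by linarith))
  have h2 : ∀ᶠ t in nhdsWithin (0 : ℝ) (Set.Ioi 0), t ∈ Set.Ioo 0 (min 1 a⁻¹) :=
    Ioo_mem_nhdsGT (lt_min one_pos (inv_pos.2 ha))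
  obtain ⟨t, ht, ht0, ht1⟩ := (h1.and h2).exists
  have hta : t * a < 1 := by
    have := mul_lt_mul_of_pos_right (ht1.trans_le (min_le_right _ _)) ha
    rwa [inv_mul_cancel₀ ha.ne'] at this
  have hne : 1 - t * a ≠ 0 := by linarith
  have hcJ : c ∈ Set.range (util u) :=
    (utilRange_ordConnected u).out hp hq ⟨by linarith, by linarith⟩
  have hc'J := (utilRange_ordConnected u).out hp hq ⟨ht.1.le, ht.2.le⟩
  obtain ⟨ω, ω', hω, hω'⟩ := h.exists_le_value_le hx
  have hvJ : a * v + b ∈ Set.range (util u) := by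
    refine (utilRange_ordConnected u).out (hJ ω) (hJ ω') ⟨?_, ?_⟩
    · have := mul_le_mul_of_nonneg_left hω ha.le
      linarith
    · have := mul_le_mul_of_nonneg_left hω' ha.le
      linarith
  refine h.hasValue_of_mix_const (hx.isSimple.comp fun r => a * r + b) hJ hvJ hcJ ht0
    (ht1.trans_le (min_le_left _ _)) ?_
  convert! h.hasValue_mix_const hx hc'J (mul_pos ht0 ha) hta using 1
  · funext ω
    field_simp
    ring
  · field_simp
    ring

/-- S-Independence allows `f` to be replaced in the mixture by its certain equivalent; a mixture
with a constant is then valued by Weak C-Independence. -/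
theorem value_mix (hx : HasValue R u x v) (hy : HasValue R u y w) {t z : ℝ} (ht0 : 0 < t)
    (ht1 : t < 1) (hm : HasValue R u (fun ω => t * x ω + (1 - t) * y ω) z) :
    z = t * v + (1 - t) * w := by
  obtain ⟨f, d, rfl, hd, hfd⟩ := id hx
  obtain ⟨k, -, rfl, -, -⟩ := id hy
  let s : unitInterval := ⟨t, ht0.le, ht1.le⟩
  have hc := h.hasValue_mix_const hy hx.value_mem (t := 1 - t) (by linarith) (by linarith)
  have hpf : profile u (Act.mix s f k) = fun ω => t * profile u f ω + (1 - t) * profile u k ω :=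
    profile_mix s f k
  have hpd : profile u (Act.mix s (Act.const Sig d) k) =
      fun ω => (1 - t) * profile u k ω + (1 - (1 - t)) * v := by
    rw [profile_mix, profile_const, hd]
    funext ω
    change t * v + (1 - t) * profile u k ω = _
    ring
  have hwd : WellUnderstood R (Act.const Sig d) := ⟨d, h.rel_refl _, h.rel_refl _⟩
  have hwf := h.wellUnderstood hx (f := f) rfl
  have hwk := h.wellUnderstood hy (f := k) rfl
  have hwfk := h.wellUnderstood hm hpf
  have hwdk := h.wellUnderstood hc hpd
  have hs0 : 0 < s := Subtype.mk_lt_mk.2 ht0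
  have hs1 : s < 1 := Subtype.mk_lt_mk.2 ht1
  have r1 := (h.sIndependence f _ k hwf hwd hwk s hs0 hs1 hwfk hwdk).1 hfd.1
  have r2 := (h.sIndependence _ f k hwd hwf hwk s hs0 hs1 hwdk hwfk).1 hfd.2
  rw [← hpf] at hm
  rw [← hpd] at hc
  have := le_antisymm ((h.rel_iff hc hm).1 r2) ((h.rel_iff hm hc).1 r1)
  linarith

theorem cells_eq_classes (f : Act Z Sig) : cells R f = (Setoid.ker (profile u f)).classes := by
  have key : ∀ ω ω', Indiff R (Act.const Sig (f ω)) (Act.const Sig (f ω')) ↔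
      profile u f ω = profile u f ω' := fun ω ω' => by
    rw [Indiff, h.const_iff, h.const_iff, le_antisymm_iff, and_comm]
    rfl
  ext T
  simp only [cells, key, Setoid.classes, Set.mem_range, Set.mem_ofPred_eq, Setoid.ker_def, eq_comm]

/-- (A1) supplies an act with the coarser partition, but gives no control over its utilities. -/
theorem exists_hasValue_coarsening (hx : HasValue R u x v) (φ : ℝ → β) :
    ∃ y w, HasValue R u y w ∧ ∀ ω ω', y ω = y ω' ↔ φ (x ω) = φ (x ω') := by
  obtain ⟨f, -, rfl, -, -⟩ := id hx
  obtain ⟨g, hg, hcells⟩ := h.simplicity.a1 f (h.wellUnderstood hx rfl)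
    (Setoid.ker fun ω => φ (profile u f ω)).classes (Setoid.isPartition_classes _) (by
      rw [h.cells_eq_classes]
      rintro _ ⟨ω, rfl⟩
      exact ⟨_, ⟨ω, rfl⟩, fun ω' hω' => congrArg φ hω'⟩)
  rw [h.cells_eq_classes, ← Setoid.classes_inj] at hcells
  obtain ⟨w, hw⟩ := hasValue_of_wellUnderstood (u := u) hg
  exact ⟨_, w, hw, fun ω ω' => Setoid.ext_iff.1 hcells ω ω'⟩

theorem hasValue_mix (hx : HasValue R u x v) (hy : HasValue R u y w)
    (hxy : ∀ ω ω', x ω = x ω' → y ω = y ω') (ω₀ : Ω) (hor : ∀ ω, y ω = x ω ∨ y ω = x ω₀)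
    {t : ℝ} (ht0 : 0 < t) (ht1 : t < 1) :
    HasValue R u (fun ω => t * x ω + (1 - t) * y ω) (t * v + (1 - t) * w) := by
  classical
  obtain ⟨f, -, rfl, -, -⟩ := id hx
  -- (A2) asks `g` to repeat lotteries of `f`, not merely utilities, so `g` is assembled from `f`.
  let g : Act Z Sig := Act.ofSimple
    ((isSimple_act f).comp₂ hy.isSimple fun p r => if r = util u p then p else f ω₀)
  have hgv : ∀ ω, g ω = if y ω = profile u f ω then f ω else f ω₀ := fun ω => rfl
  have hg : profile u g = y := by
    funext ω
    change util u (g ω) = y ω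
    rw [hgv]
    split_ifs with hω
    · exact hω.symm
    · exact ((hor ω).resolve_left hω).symm
  let s : unitInterval := ⟨t, ht0.le, ht1.le⟩
  have hwu := h.simplicity.a2 f g (h.wellUnderstood hx rfl) (by
    rw [h.cells_eq_classes]
    rintro _ ⟨ω, rfl⟩ ω₁ h₁ ω₂ h₂
    have : profile u g ω₁ = profile u g ω₂ := by
      rw [hg]
      exact hxy _ _ ((h₁ : profile u f ω₁ = profile u f ω).trans
        (h₂ : profile u f ω₂ = profile u f ω).symm)
    exact ⟨(h.const_iff _ _).2 this.ge, (h.const_iff _ _).2 this.le⟩)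
    ⟨f ω₀, ⟨ω₀, rfl⟩, fun ω => by
      rw [hgv]
      split_ifs
      · exact Or.inl rfl
      · exact Or.inr rfl⟩
    (h.wellUnderstood hy hg) s (Subtype.mk_lt_mk.2 ht0) (Subtype.mk_lt_mk.2 ht1)
  obtain ⟨z, hz⟩ := hasValue_of_wellUnderstood (u := u) hwu
  rw [profile_mix, hg] at hz
  have := h.value_mix hx hy ht0 ht1 hz
  rw [← this]
  exact hz

/-- Form of (A3) for labellings: `s` keeps the cells of `x`, except that the union of two non-null
ones is cut anew into the cells labelled `b₁` and `b₂`. -/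
theorem exists_hasValue_repartition (hx : HasValue R u x v) {ω₁ ω₂ : Ω} (hne : x ω₁ ≠ x ω₂)
    (h₁ : NonNull R ⟨x ⁻¹' {x ω₁}, hx.isSimple.preimage_mem _⟩)
    (h₂ : NonNull R ⟨x ⁻¹' {x ω₂}, hx.isSimple.preimage_mem _⟩)
    {s : Ω → β} (hs : IsSimple Sig s) {b₁ b₂ : β} (hb₁ : b₁ ∈ Set.range s)
    (hb₂ : b₂ ∈ Set.range s) (hb : b₁ ≠ b₂)
    (hreg : ∀ ω, (s ω = b₁ ∨ s ω = b₂) ↔ (x ω = x ω₁ ∨ x ω = x ω₂))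
    (hout : ∀ ω ω', ¬ (x ω = x ω₁ ∨ x ω = x ω₂) → ¬ (x ω' = x ω₁ ∨ x ω' = x ω₂) →
      (s ω = s ω' ↔ x ω = x ω')) :
    ∃ y w, HasValue R u y w ∧ ∀ ω ω', y ω = y ω' ↔ s ω = s ω' := by
  obtain ⟨f, -, rfl, -, -⟩ := id hx
  have hcl : ∀ ω, profile u f ⁻¹' {profile u f ω} ∈ cells R f := fun ω => by
    rw [h.cells_eq_classes]
    exact ⟨ω, rfl⟩
  obtain ⟨g, hg, hcells⟩ := h.simplicity.a3 f (h.wellUnderstood hx rfl) _ _ (hcl ω₁) (hcl ω₂)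
    (fun he => hne (by
      have : ω₁ ∈ profile u f ⁻¹' {profile u f ω₂} := by
        have he' : profile u f ⁻¹' {profile u f ω₁} = profile u f ⁻¹' {profile u f ω₂} :=
          congrArg Subtype.val he
        rw [← he']
        rfl
      exact this)) h₁ h₂
    ⟨s ⁻¹' {b₁}, hs.preimage_mem _⟩ ⟨s ⁻¹' {b₂}, hs.preimage_mem _⟩
    hb₁ hb₂ (Disjoint.preimage s (Set.disjoint_singleton.2 hb))
    (by ext ω; exact hreg ω)
  have hset : cells R g = (Setoid.ker s).classes := by
    rw [hcells, h.cells_eq_classes]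
    ext S
    constructor
    · rintro ((rfl | rfl) | ⟨⟨ω, rfl⟩, hω⟩)
      · obtain ⟨ω, rfl⟩ := hb₁
        exact ⟨ω, rfl⟩
      · obtain ⟨ω, rfl⟩ := hb₂
        exact ⟨ω, rfl⟩
      · have hn : ¬ (profile u f ω = profile u f ω₁ ∨ profile u f ω = profile u f ω₂) := by
          rintro (he | he)
          · refine hω (Or.inl ?_)
            simp only [Setoid.ker_def, he]
            rfl
          · refine hω (Or.inr ?_)
            simp only [Setoid.ker_def, he]
            rfl
        refine ⟨ω, ?_⟩
        ext ω'
        simp only [Setoid.ker_def, Set.mem_ofPred_eq]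
        by_cases hn' : profile u f ω' = profile u f ω₁ ∨ profile u f ω' = profile u f ω₂
        · constructor
          · intro he
            rw [he] at hn'
            exact absurd hn' hn
          · intro he
            have := (hreg ω').2 hn'
            rw [he, hreg] at this
            exact absurd this hn
        · exact (hout _ _ hn' hn).symm
    · rintro ⟨ω, rfl⟩
      simp only [Setoid.ker_def]
      by_cases hn : profile u f ω = profile u f ω₁ ∨ profile u f ω = profile u f ω₂
      · rcases (hreg ω).2 hn with he | he
        · exact Or.inl (Or.inl (by rw [he]; rfl))
        · exact Or.inl (Or.inr (by rw [he]; rfl))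
      · have hset : {ω' | s ω' = s ω} = {ω' | profile u f ω' = profile u f ω} := by
          ext ω'
          simp only [Set.mem_ofPred_eq]
          by_cases hn' : profile u f ω' = profile u f ω₁ ∨ profile u f ω' = profile u f ω₂
          · constructor
            · intro he
              have := (hreg ω').2 hn'
              rw [he, hreg] at this
              exact absurd this hn
            · intro he
              rw [he] at hn'
              exact absurd hn' hn
          · exact hout _ _ hn' hn
        rw [hset]
        refine Or.inr ⟨⟨ω, rfl⟩, ?_⟩
        rintro (he | he)
        · have : ω ∈ profile u f ⁻¹' {profile u f ω₁} := he ▸ (rfl : profile u f ω = _)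
          exact hn (Or.inl this)
        · have : ω ∈ profile u f ⁻¹' {profile u f ω₂} := he ▸ (rfl : profile u f ω = _)
          exact hn (Or.inr this)
  rw [h.cells_eq_classes, ← Setoid.classes_inj] at hset
  obtain ⟨w, hw⟩ := hasValue_of_wellUnderstood (u := u) hg
  exact ⟨_, w, hw, fun ω ω' => Setoid.ext_iff.1 hset ω ω'⟩

theorem hasValue_congr_null (hx : HasValue R u x v) {E : Sig} (hE : ¬ NonNull R E)
    (hy : IsSimple Sig y) (hyJ : ∀ ω, y ω ∈ Set.range (util u))
    (hxy : ∀ ω, ω ∉ (E : Set Ω) → y ω = x ω) : HasValue R u y v := by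
  obtain ⟨f, c, rfl, rfl, hfc⟩ := id hx
  obtain ⟨g, rfl⟩ := exists_act_profile hy hyJ
  have hi := h.simplicity.a4 f (h.wellUnderstood hx rfl) E hE g
  refine ⟨Act.splice E g f, c, ?_, rfl, h.rel_trans hi.1 hfc.1, h.rel_trans hfc.2 hi.2⟩
  rw [profile_splice]
  funext ω
  split_ifs with hω
  · rfl
  · exact (hxy ω hω).symm

-- (A0) gives one bet on `E`. Every other bet with the better prize on `E` is a positive affine
-- image of it and inherits its weight.
open Classical in
theorem exists_bet_weight {E : Set Ω} (hE : E ∈ Sig) :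
    ∃ p : ℝ, 0 ≤ p ∧ ∀ a ∈ Set.range (util u), ∀ b ∈ Set.range (util u), b < a →
      HasValue R u (fun ω => if ω ∈ E then a else b) (p * a + (1 - p) * b) := by
  obtain ⟨c, d, hcd, hwu⟩ := h.simplicity.a0 ⟨E, hE⟩
  obtain ⟨v, hv⟩ := hasValue_of_wellUnderstood (u := u) hwu
  have hlt : util u d < util u c := by
    rw [Strict, h.const_iff, h.const_iff] at hcd
    exact lt_of_not_ge hcd.2
  rw [profile_splice] at hv
  have hdv : util u d ≤ v := by
    refine h.value_mono (h.hasValue_const ⟨d, rfl⟩) hv fun ω => ?_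
    split_ifs
    · exact hlt.le
    · exact le_rfl
  have hpos : 0 < util u c - util u d := by linarith
  refine ⟨(v - util u d) / (util u c - util u d), div_nonneg (by linarith) hpos.le,
    fun a ha b hb hab => ?_⟩
  set k := (a - b) / (util u c - util u d) with hk
  have hkc : k * (util u c - util u d) = a - b := div_mul_cancel₀ _ hpos.ne'
  have hprof : (fun ω => k * (if ω ∈ E then util u c else util u d) + (b - k * util u d)) =
      fun ω => if ω ∈ E then a else b := by
    funext ω
    split_ifs <;> linarith
  have := h.hasValue_affine hv (div_pos (sub_pos.2 hab) hpos) (b - k * util u d) (by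
    intro ω
    have := congrFun hprof ω
    change k * (if ω ∈ E then util u c else util u d) + (b - k * util u d) ∈ _
    rw [this]
    split_ifs
    · exact ha
    · exact hb)
  change HasValue R u
    (fun ω => k * (if ω ∈ E then util u c else util u d) + (b - k * util u d)) _ at this
  rw [hprof] at this
  convert! this using 1
  rw [← hk, hk]
  field_simp
  ring

open Classical in
/-- The subjective probability revealed by bets. -/
theorem exists_probability :
    ∃ P : MeasureTheory.AddContent ℝ≥0 (Sig : Set (Set Ω)), P Set.univ = 1 ∧
      ∀ E ∈ Sig, ∀ a ∈ Set.range (util u), ∀ b ∈ Set.range (util u),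
        HasValue R u (fun ω => if ω ∈ E then a else b) (P E * a + (1 - P E) * b) := by
  choose! p hp0 hp using fun (E : Set Ω) (hE : E ∈ Sig) => h.exists_bet_weight hE
  obtain ⟨b, hb, a, ha, hab⟩ := h.exists_lt
  -- For disjoint `E` and `F`, the even mixture of the bets on `E` and on `F` with prizes `a`, `b`
  -- is the bet on `E ∪ F` with prizes `(a + b) / 2`, `b`. This yields additivity.
  have hmid : (a + b) / 2 ∈ Set.range (util u) :=
    (utilRange_ordConnected u).out hb ha ⟨by linarith, by linarith⟩
  have half : ∀ {x y : Ω → ℝ} {v w z : ℝ}, HasValue R u x v → HasValue R u y w →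
      HasValue R u (fun ω => (x ω + y ω) / 2) z → z = (v + w) / 2 := by
    intro x y v w z hx hy hm
    have := h.value_mix hx hy (t := 1 / 2) (by norm_num) (by norm_num) (z := z) (by
      convert! hm using 1
      funext ω
      ring)
    linarith
  have hadd : ∀ {E F : Set Ω}, E ∈ Sig → F ∈ Sig → Disjoint E F → p (E ∪ F) = p E + p F := by
    intro E F hE hF hd
    have h3 := hp _ ((isSetAlgebra Sig).union_mem hE hF) _ hmid b hb (by linarith)
    have := half (hp E hE a ha b hb hab) (hp F hF a ha b hb hab) (z := _) (by
      convert! h3 using 1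
      funext ω
      have hdω : ω ∈ E → ω ∉ F := fun h1 h2 => Set.disjoint_left.1 hd h1 h2
      by_cases hωE : ω ∈ E
      · simp [hωE, hdω hωE]
      · by_cases hωF : ω ∈ F <;> simp [hωE, hωF, add_comm])
    have h4 : (p (E ∪ F) - (p E + p F)) * (a - b) = 0 := by linarith
    rcases mul_eq_zero.1 h4 with h5 | h5 <;> linarith
  have hempty : p ∅ = 0 := by
    have := @hadd ∅ ∅ (isSetAlgebra Sig).empty_mem (isSetAlgebra Sig).empty_mem
      (Set.disjoint_empty _)
    rw [Set.union_empty] at this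
    linarith
  have huniv : p Set.univ = 1 := by
    have h1 := hp _ (isSetAlgebra Sig).univ_mem a ha b hb hab
    simp only [Set.mem_univ, if_true] at h1
    have := h.value_unique h1 (h.hasValue_const ha)
    have h4 : (p Set.univ - 1) * (a - b) = 0 := by linarith
    rcases mul_eq_zero.1 h4 with h5 | h5 <;> linarith
  have hcompl : ∀ {E : Set Ω}, E ∈ Sig → p Eᶜ = 1 - p E := by
    intro E hE
    have := hadd hE ((isSetAlgebra Sig).compl_mem hE) disjoint_compl_right
    rw [Set.union_compl_self, huniv] at this
    linarith
  let P : MeasureTheory.AddContent ℝ≥0 (Sig : Set (Set Ω)) :=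
    (isSetAlgebra Sig).isSetRing.addContent_of_union (fun E => (p E).toNNReal)
      (by rw [hempty, Real.toNNReal_zero])
      (fun {E F} hE hF hd => by
        rw [hadd hE hF hd, Real.toNNReal_add (hp0 E hE) (hp0 F hF)])
  have hPE : ∀ E ∈ Sig, (P E : ℝ) = p E := fun E hE => Real.coe_toNNReal _ (hp0 E hE)
  refine ⟨P, ?_, fun E hE a' ha' b' hb' => ?_⟩
  · rw [← NNReal.coe_inj, hPE _ (isSetAlgebra Sig).univ_mem, huniv, NNReal.coe_one]
  · rw [hPE E hE]
    rcases lt_trichotomy a' b' with hlt | rfl | hlt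
    -- With the worse prize on `E` this is a bet on the complement.
    · have := hp _ ((isSetAlgebra Sig).compl_mem hE) b' hb' a' ha' hlt
      rw [hcompl hE] at this
      convert! this using 1
      · funext ω
        by_cases hω : ω ∈ E <;> simp [hω]
      · ring
    · convert! h.hasValue_const ha' using 1
      · funext ω
        split_ifs <;> rfl
      · ring
    · exact hp E hE a' ha' b' hb' hlt

end UtilityModel

end Value

/-! ### Expected utility on the partitions of well-understood acts. -/

section GoodPartitions

variable {Ω Z : Type*} {Sig : BooleanSubalgebra (Set Ω)} {R : Act Z Sig → Act Z Sig → Prop}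
  {u : Z → ℝ} {P : MeasureTheory.AddContent ℝ≥0 (Sig : Set (Set Ω))}

open Classical in
/-- A utility model together with the probability that represents the values of bets. -/
structure ProbabilityModel (R : Act Z Sig → Act Z Sig → Prop) (u : Z → ℝ)
    (P : MeasureTheory.AddContent ℝ≥0 (Sig : Set (Set Ω))) : Prop extends UtilityModel R u where
  prob : P Set.univ = 1
  bet : ∀ E ∈ Sig, ∀ a ∈ Set.range (util u), ∀ b ∈ Set.range (util u),
    HasValue R u (fun ω => if ω ∈ E then a else b) (P E * a + (1 - P E) * b)

/-- Every act whose partition is strictly coarser than that of `x` has its expected utility as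
value. -/
def CoarseningsValued (R : Act Z Sig → Act Z Sig → Prop) (u : Z → ℝ)
    (P : MeasureTheory.AddContent ℝ≥0 (Sig : Set (Set Ω))) (x : Ω → ℝ) : Prop :=
  ∀ φ : ℝ → ℝ, (∀ ω, φ (x ω) ∈ Set.range (util u)) → ¬ Set.InjOn φ (Set.range x) →
    HasValue R u (fun ω => φ (x ω)) (integral P fun ω => φ (x ω))

namespace ProbabilityModel

variable {x y : Ω → ℝ} {v w : ℝ} (h : ProbabilityModel R u P)
include h

theorem hasValue_of_two_values (hx : IsSimple Sig x) {a b : ℝ} (ha : a ∈ Set.range (util u))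
    (hb : b ∈ Set.range (util u)) (hab : ∀ ω, x ω = a ∨ x ω = b) :
    HasValue R u x (integral P x) := by
  classical
  have hE := hx.preimage_mem {a}
  have hxe : x = fun ω => if ω ∈ x ⁻¹' {a} then a else b := by
    funext ω
    split_ifs with hω
    · exact hω
    · exact (hab ω).resolve_left hω
  have h1 := h.bet _ hE a ha b hb
  rw [← integral_bet h.prob hE, ← hxe] at h1
  exact h1

theorem nonNull_iff (E : Sig) : NonNull R E ↔ P E ≠ 0 := by
  classical
  have key : ∀ c₁ c₂ c₃ : Lottery Z,
      Strict R (Act.splice E (Act.const Sig c₂) (Act.const Sig c₁))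
        (Act.splice E (Act.const Sig c₃) (Act.const Sig c₁)) ↔
      (P E : ℝ) * util u c₃ < P E * util u c₂ := by
    intro c₁ c₂ c₃
    have hb : ∀ c d : Lottery Z, HasValue R u
        (profile u (Act.splice E (Act.const Sig c) (Act.const Sig d)))
        (P E * util u c + (1 - P E) * util u d) := fun c d => by
      rw [profile_splice]
      exact h.bet E E.2 _ ⟨c, rfl⟩ _ ⟨d, rfl⟩
    rw [Strict, h.rel_iff (hb _ _) (hb _ _), h.rel_iff (hb _ _) (hb _ _), ← lt_iff_le_not_ge,
      add_lt_add_iff_right]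
  simp only [NonNull, key]
  constructor
  · rintro ⟨_, c₂, c₃, h⟩ h0
    simp [h0] at h
  · intro h0
    obtain ⟨_, ⟨d, rfl⟩, _, ⟨c, rfl⟩, hlt⟩ := h.exists_lt
    exact ⟨c, c, d, mul_lt_mul_of_pos_left hlt (by positivity)⟩

/-- (A1) gives a well-understood act with the cells of `φ ∘ x`. It has fewer values than `x`, and `φ
∘ x` is a function of it. -/
theorem coarseningsValued_of_forall_lt
    (ih : ∀ y w, HasValue R u y w → (Set.range y).ncard < (Set.range x).ncard →
      ∀ φ : ℝ → ℝ, (∀ ω, φ (y ω) ∈ Set.range (util u)) →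
        HasValue R u (fun ω => φ (y ω)) (integral P fun ω => φ (y ω)))
    (hx : HasValue R u x v) : CoarseningsValued R u P x := by
  intro φ hφ hinj
  obtain ⟨y, w, hy, hker⟩ := h.exists_hasValue_coarsening hx φ
  obtain ⟨e, he⟩ := (Function.factorsThrough_iff y).1
    fun ω ω' (hω : φ (x ω) = φ (x ω')) => (hker ω ω').2 hω
  obtain ⟨e', he'⟩ := (Function.factorsThrough_iff fun ω => φ (x ω)).1
    fun ω ω' (hω : y ω = y ω') => (hker ω ω').1 hω
  have hfin := hx.isSimple.finite_range
  have hlt : (Set.range y).ncard < (Set.range x).ncard := by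
    have h1 : Set.range y ⊆ e '' (φ '' Set.range x) := by
      rintro _ ⟨ω, rfl⟩
      exact ⟨_, ⟨_, ⟨ω, rfl⟩, rfl⟩, (congrFun he ω).symm⟩
    calc (Set.range y).ncard ≤ (e '' (φ '' Set.range x)).ncard :=
          Set.ncard_le_ncard h1 ((hfin.image φ).image e)
      _ ≤ (φ '' Set.range x).ncard := Set.ncard_image_le (hfin.image φ)
      _ < (Set.range x).ncard := lt_of_le_of_ne (Set.ncard_image_le hfin) fun heq =>
          hinj (Set.injOn_of_ncard_image_eq heq hfin)
  have hpt : ∀ ω, φ (x ω) = e' (y ω) := fun ω => congrFun he' ω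
  simp only [hpt] at hφ ⊢
  exact ih y w hy hlt e' hφ

/-- A well-understood act with a lowest, a middle and a highest value has the expected value. -/
theorem value_eq_integral_of_three (hx : HasValue R u x v) (hstar : CoarseningsValued R u P x)
    {ω₁ ω₂ ω₃ : Ω} (h12 : x ω₁ < x ω₂) (h23 : x ω₂ < x ω₃) : v = integral P x := by
  classical
  set m := x ω₁ with hm
  set l := x ω₂ with hl
  set M := x ω₃ with hM
  have hs := hx.isSimple
  have hlow := hstar (Function.update id l m) (fun ω => by
      by_cases hω : x ω = l
      · rw [hω, Function.update_self]; exact hx.mem ω₁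
      · rw [Function.update_of_ne hω]; exact hx.mem ω)
    (fun hi => h12.ne (hi ⟨ω₁, rfl⟩ ⟨ω₂, rfl⟩ (by
      rw [Function.update_self, Function.update_of_ne h12.ne, id])))
  have hhigh := hstar (Function.update id l M) (fun ω => by
      by_cases hω : x ω = l
      · rw [hω, Function.update_self]; exact hx.mem ω₃
      · rw [Function.update_of_ne hω]; exact hx.mem ω)
    (fun hi => h23.ne (hi ⟨ω₂, rfl⟩ ⟨ω₃, rfl⟩ (by
      rw [Function.update_self, Function.update_of_ne h23.ne', id])))
  -- `hlow` and `hhigh` merge the cell `x = l` into those of `m` and of `M`. Mixing evenly with the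
  -- first lowers `l` to `k`. Mixing with the second restores it, with the weight `t` solving `t k +
  -- (1 - t) M = l`.
  set k := (l + m) / 2 with hk
  have hmid := h.hasValue_mix hx hlow (fun ω ω' he => by rw [he]) ω₁ (fun ω => by
    by_cases hω : x ω = l
    · rw [hω, Function.update_self]; exact Or.inr rfl
    · rw [Function.update_of_ne hω]; exact Or.inl rfl) (t := 1 / 2) (by norm_num) (by norm_num)
  have hmide : (fun ω => 1 / 2 * x ω + (1 - 1 / 2) * Function.update id l m (x ω)) =
      fun ω => Function.update id l k (x ω) := by
    funext ω
    by_cases hω : x ω = l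
    · rw [hω, Function.update_self, Function.update_self, hk]; ring
    · rw [Function.update_of_ne hω, Function.update_of_ne hω, id]; ring
  have hint := integral_mix (P := P) hs (hs.comp (Function.update id l m)) (1 / 2) (1 - 1 / 2)
  rw [hmide] at hmid hint
  by_cases hinj : Set.InjOn (Function.update id l k) (Set.range x)
  · set t := (M - l) / (M - k) with ht
    have hMk : 0 < M - k := by linarith
    have ht0 : 0 < t := div_pos (by linarith) hMk
    have ht1 : t < 1 := (div_lt_one hMk).2 (by linarith)
    have hback := h.hasValue_mix hmid hhigh
      (fun ω ω' he => by rw [hinj ⟨ω, rfl⟩ ⟨ω', rfl⟩ he]) ω₃ (fun ω => by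
        by_cases hω : x ω = l
        · rw [hω, Function.update_self, ← hM, Function.update_of_ne h23.ne']; exact Or.inr rfl
        · rw [Function.update_of_ne hω, Function.update_of_ne hω]; exact Or.inl rfl) ht0 ht1
    have hbacke : (fun ω => t * Function.update id l k (x ω) +
        (1 - t) * Function.update id l M (x ω)) = x := by
      funext ω
      by_cases hω : x ω = l
      · rw [hω, Function.update_self, Function.update_self, ht]
        field_simp
        ring
      · rw [Function.update_of_ne hω, Function.update_of_ne hω, id]; ring
    have hint2 := integral_mix (P := P) (hs.comp (Function.update id l k))
      (hs.comp (Function.update id l M)) t (1 - t)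
    rw [hbacke] at hback hint2
    have hv := h.value_unique hx hback
    rw [hint] at hint2
    -- Value and integral undergo the same two affine steps, so their difference reproduces itself
    -- with the factor `t / 2`, which is less than 1.
    have : (v - integral P x) * (1 - t * (1 / 2)) = 0 := by linarith
    rcases mul_eq_zero.1 this with h0 | h0
    · linarith
    · nlinarith
  -- Here `k` is already a value of `x`, and the intermediate act is a strict coarsening.
  · have h1 := hstar (Function.update id l k) (fun ω => hmid.mem ω) hinj
    have := h.value_unique hmid h1
    linarith

open Classical in
/-- If `x` is well-understood then so is every injective relabelling of its values whose maximum
is not attained where `x` is minimal: after shrinking the new values into a small interval above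
the minimum of `x`, the cells can be moved there one at a time. -/
theorem exists_hasValue_relabel (hx : HasValue R u x v) (hstar : CoarseningsValued R u P x)
    {ω₀ : Ω} (hmin : ∀ ω, x ω₀ ≤ x ω) {φ : ℝ → ℝ} (hφJ : ∀ ω, φ (x ω) ∈ Set.range (util u))
    (hφ : Set.InjOn φ (Set.range x)) {ω₁ : Ω} (hne : x ω₁ ≠ x ω₀)
    (hmax : ∀ ω, φ (x ω) ≤ φ (x ω₁)) : ∃ w, HasValue R u (fun ω => φ (x ω)) w := by
  set m := x ω₀ with hm
  have hfin := hx.isSimple.finite_range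
  -- `r₀` is the second lowest value of `x`, so no values lie strictly between `m` and `r₀`.
  obtain ⟨r₀, ⟨⟨ω₂, hω₂⟩, hr₀m⟩, hr₀⟩ := Set.exists_min_image {r ∈ Set.range x | r ≠ m} id
    (hfin.subset (Set.sep_subset _ _)) ⟨x ω₁, ⟨ω₁, rfl⟩, hne⟩
  have hr₀J : r₀ ∈ Set.range (util u) := hω₂ ▸ hx.mem ω₂
  have hgap : ∀ ω, x ω ≠ m → r₀ ≤ x ω := fun ω hω => hr₀ _ ⟨⟨ω, rfl⟩, hω⟩
  have hδ : 0 < r₀ - m := sub_pos.2 (lt_of_le_of_ne (hω₂ ▸ hmin ω₂) (Ne.symm hr₀m))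
  obtain ⟨lo, ⟨ω₃, -⟩, hlo⟩ := Set.exists_min_image (Set.range x) φ hfin ⟨x ω₁, ω₁, rfl⟩
  have hlo' : ∀ ω, φ lo ≤ φ (x ω) := fun ω => hlo _ ⟨ω, rfl⟩
  -- The summand 2 leaves room at both ends, so that the affine image `ψ` of `φ` falls strictly
  -- between `m` and `r₀`.
  set D := φ (x ω₁) - φ lo + 2 with hD
  have hDpos : 0 < D := by
    have := hlo' ω₁
    linarith
  set α := (r₀ - m) / D with hα
  have hαpos : 0 < α := div_pos hδ hDpos
  have hαD : α * D = r₀ - m := div_mul_cancel₀ _ hDpos.ne'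
  set ψ : ℝ → ℝ := fun r => α * φ r + (m + α * (1 - φ lo)) with hψ
  have hψm : ∀ ω, m < ψ (x ω) := fun ω => by
    have : 0 < α * (φ (x ω) - φ lo + 1) := mul_pos hαpos (by linarith [hlo' ω])
    simp only [hψ]
    linarith
  have hψr : ∀ ω, ψ (x ω) < r₀ := fun ω => by
    have : α * (φ (x ω) - φ lo + 1) < α * D :=
      mul_lt_mul_of_pos_left (by linarith [hmax ω]) hαpos
    simp only [hψ]
    linarith
  have hψJ : ∀ ω, ψ (x ω) ∈ Set.range (util u) := fun ω =>
    (utilRange_ordConnected u).out (hx.mem ω₀) hr₀J ⟨(hψm ω).le, (hψr ω).le⟩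
  have hψinj : ∀ ω ω', ψ (x ω) = ψ (x ω') → x ω = x ω' := fun ω ω' he => by
    simp only [hψ, add_left_inj] at he
    exact hφ ⟨ω, rfl⟩ ⟨ω', rfl⟩ (mul_left_cancel₀ hαpos.ne' he)
  have hstage : ∀ S : Finset ℝ, (∀ r ∈ S, r ∈ Set.range x ∧ r ≠ m) →
      ∃ w, HasValue R u (fun ω => if x ω ∈ S then ψ (x ω) else x ω) w := by
    intro S
    induction S using Finset.induction_on with
    | empty => exact fun _ => ⟨v, by simpa using hx⟩
    | insert r S hrS ih =>
      intro hS
      obtain ⟨w, hw⟩ := ih fun r' hr' => hS r' (Finset.mem_insert_of_mem hr')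
      obtain ⟨⟨ωr, rfl⟩, hrm⟩ := hS r (Finset.mem_insert_self _ _)
      have hmS : m ∉ S := fun hmem => (hS m (Finset.mem_insert_of_mem hmem)).2 rfl
      -- `g` merges the cell of `x ωr` into the lowest cell, which makes it a strict coarsening.
      -- Mixing with it with weight `t` lowers the value `x ωr` to `ψ (x ωr)`.
      set g : ℝ → ℝ := fun r' => if r' = x ωr then m else if r' ∈ S then ψ r' else r' with hg
      have hgv := hstar g (fun ω => by
          simp only [hg]
          split_ifs
          · exact hx.mem ω₀
          · exact hψJ ω
          · exact hx.mem ω)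
        (fun hi => hrm (hi ⟨ωr, rfl⟩ ⟨ω₀, rfl⟩ (by
          simp only [hg, if_true]
          rw [if_neg (Ne.symm hrm), if_neg hmS])))
      have hlt : m < x ωr := lt_of_le_of_ne (hmin ωr) (Ne.symm hrm)
      have hr0 : r₀ ≤ x ωr := hgap ωr hrm
      set t := (ψ (x ωr) - m) / (x ωr - m) with ht
      have hpos : 0 < x ωr - m := by linarith
      have ht0 : 0 < t := div_pos (by linarith [hψm ωr]) hpos
      have ht1 : t < 1 := (div_lt_one hpos).2 (by linarith [hψr ωr])
      have hker : ∀ ω ω', (if x ω ∈ S then ψ (x ω) else x ω) =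
          (if x ω' ∈ S then ψ (x ω') else x ω') → x ω = x ω' := by
        have hmixed : ∀ ω ω', x ω' ∉ S → ψ (x ω) ≠ x ω' := fun ω ω' _ he => by
          by_cases hωm : x ω' = m
          · exact (hψm ω).ne' (he.trans hωm)
          · exact ((hψr ω).trans_le (hgap ω' hωm)).ne he
        intro ω ω' he
        by_cases h1 : x ω ∈ S <;> by_cases h2 : x ω' ∈ S
        · rw [if_pos h1, if_pos h2] at he
          exact hψinj _ _ he
        · rw [if_pos h1, if_neg h2] at he
          exact absurd he (hmixed _ _ h2)
        · rw [if_neg h1, if_pos h2] at he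
          exact absurd he.symm (hmixed _ _ h1)
        · rwa [if_neg h1, if_neg h2] at he
      have hmix := h.hasValue_mix hw hgv (fun ω ω' he => by rw [hker ω ω' he]) ω₀ (fun ω => by
          simp only [hg]
          rw [← hm, if_neg hmS]
          by_cases hω : x ω = x ωr
          · exact Or.inr (if_pos hω)
          · exact Or.inl (if_neg hω)) ht0 ht1
      have hmixe : (fun ω => t * (if x ω ∈ S then ψ (x ω) else x ω) + (1 - t) * g (x ω)) =
          fun ω => if x ω ∈ insert (x ωr) S then ψ (x ω) else x ω := by
        funext ω
        simp only [hg, Finset.mem_insert]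
        by_cases hω : x ω = x ωr
        · rw [hω, if_pos (Or.inl rfl), if_neg hrS, if_pos rfl, ht]
          field_simp
          ring
        · rw [if_neg hω]
          simp only [hω, false_or]
          ring
      rw [hmixe] at hmix
      exact ⟨_, hmix⟩
  have hSmem : ∀ ω, x ω ∈ hfin.toFinset.erase m ↔ x ω ≠ m := fun ω => by simp
  obtain ⟨w, hw⟩ := hstage (hfin.toFinset.erase m) fun r hr => by
    rw [Finset.mem_erase, Set.Finite.mem_toFinset] at hr
    exact ⟨hr.2, hr.1⟩
  simp only [hSmem] at hw
  have hψlt : ψ m < ψ (x ω₁) := by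
    refine lt_of_le_of_ne ?_ fun he => hne (hψinj _ _ he).symm
    have := mul_le_mul_of_nonneg_left (hmax ω₀) hαpos.le
    simp only [hψ, hm]
    linarith
  -- Only the lowest cell remains, and it must move up. It is mixed with the cell where `ψ` is
  -- greatest, which therefore has to be a different one.
  set g : ℝ → ℝ := fun r => if r = m then ψ (x ω₁) else ψ r with hg
  have hgv := hstar g (fun ω => by
      simp only [hg]
      split_ifs
      · exact hψJ ω₁
      · exact hψJ ω)
    (fun hi => hne (hi ⟨ω₁, rfl⟩ ⟨ω₀, rfl⟩ (by
      simp only [hg, if_true]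
      rw [if_neg hne])))
  set t := (ψ (x ω₁) - ψ m) / (ψ (x ω₁) - m) with ht
  have hpos : 0 < ψ (x ω₁) - m := by linarith [hψm ω₁]
  have ht0 : 0 < t := div_pos (by linarith) hpos
  have hψm0 : m < ψ m := hψm ω₀
  have ht1 : t < 1 := (div_lt_one hpos).2 (by linarith)
  have hfinal := h.hasValue_mix hw hgv (fun ω ω' he => by
      have : x ω = x ω' := by
        by_cases h1 : x ω ≠ m <;> by_cases h2 : x ω' ≠ m
        · rw [if_pos h1, if_pos h2] at he
          exact hψinj _ _ he
        · rw [if_pos h1, if_neg h2, not_not.1 h2] at he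
          exact absurd he (hψm ω).ne'
        · rw [if_neg h1, if_pos h2, not_not.1 h1] at he
          exact absurd he (hψm ω').ne
        · rw [not_not.1 h1, not_not.1 h2]
      rw [this]) ω₁ (fun ω => by
      simp only [hg]
      rw [if_pos hne]
      by_cases hω : x ω = m
      · exact Or.inr (if_pos hω)
      · left
        rw [if_neg hω, if_pos hω]) ht0 ht1
  have hfe : (fun ω => t * (if x ω ≠ m then ψ (x ω) else x ω) + (1 - t) * g (x ω)) =
      fun ω => ψ (x ω) := by
    funext ω
    simp only [hg]
    by_cases hω : x ω = m
    · rw [hω, if_neg (not_not.2 rfl), if_pos rfl, ht]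
      field_simp
      ring
    · rw [if_pos hω, if_neg hω]
      ring
  rw [hfe] at hfinal
  have hφe : (fun ω => α⁻¹ * ψ (x ω) + -(α⁻¹ * (m + α * (1 - φ lo)))) = fun ω => φ (x ω) := by
    funext ω
    simp only [hψ]
    field_simp
    ring
  refine ⟨_, hφe ▸ h.hasValue_affine hfinal (inv_pos.2 hαpos) (-(α⁻¹ * (m + α * (1 - φ lo))))
    fun ω => ?_⟩
  have := congrFun hφe ω
  rw [this]
  exact hφJ ω

/-- Induction on the number of cells. With at most two cells the act is a bet, and a non-injective
`φ` gives a strict coarsening. For the other `φ`, relabelling shows that the act is well-understood,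
and three distinct values then identify its value with the integral. -/
theorem hasValue_comp_aux (n : ℕ) : ∀ (x : Ω → ℝ) (v : ℝ), HasValue R u x v →
    (Set.range x).ncard = n → ∀ φ : ℝ → ℝ, (∀ ω, φ (x ω) ∈ Set.range (util u)) →
      HasValue R u (fun ω => φ (x ω)) (integral P fun ω => φ (x ω)) := by
  classical
  induction n using Nat.strong_induction_on with
  | _ n ih =>
  intro x v hx hn φ hφJ
  have hcoarse : ∀ y w, HasValue R u y w → (Set.range y).ncard = n →
      CoarseningsValued R u P y := fun y w hy hyn =>
    h.coarseningsValued_of_forall_lt (fun y' w' hy' hlt => ih _ (hyn ▸ hlt) y' w' hy' rfl) hy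
  have hfin := hx.isSimple.finite_range
  have := h.nonempty
  obtain ⟨_, ⟨ω₀, rfl⟩, hmin⟩ :=
    Set.exists_min_image (Set.range x) id hfin (Set.range_nonempty x)
  obtain ⟨_, ⟨ω₁, rfl⟩, hmax⟩ :=
    Set.exists_max_image (Set.range x) id hfin (Set.range_nonempty x)
  replace hmin : ∀ ω, x ω₀ ≤ x ω := fun ω => hmin _ ⟨ω, rfl⟩
  replace hmax : ∀ ω, x ω ≤ x ω₁ := fun ω => hmax _ ⟨ω, rfl⟩
  by_cases hthree : ∃ ω₂, x ω₂ ≠ x ω₀ ∧ x ω₂ ≠ x ω₁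
  swap
  · push Not at hthree
    refine h.hasValue_of_two_values (hx.isSimple.comp φ) (hφJ ω₀) (hφJ ω₁) fun ω => ?_
    by_cases hω : x ω = x ω₀
    · exact Or.inl (by rw [hω])
    · exact Or.inr (by rw [hthree ω hω])
  obtain ⟨ω₂, h20, h21⟩ := hthree
  have hlt02 : x ω₀ < x ω₂ := lt_of_le_of_ne (hmin ω₂) (Ne.symm h20)
  have hlt21 : x ω₂ < x ω₁ := lt_of_le_of_ne (hmax ω₂) h21
  by_cases hinj : Set.InjOn φ (Set.range x)
  swap
  · exact hcoarse x v hx hn φ hφJ hinj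
  have hcard : ∀ σ : ℝ → ℝ, Set.InjOn σ (Set.range x) →
      (Set.range fun ω => σ (x ω)).ncard = n := fun σ hσ => by
    rw [← hn, ← hσ.ncard_image, ← Set.range_comp]
    rfl
  have hex : ∃ w, HasValue R u (fun ω => φ (x ω)) w := by
    obtain ⟨_, ⟨ω₃, rfl⟩, hφmax⟩ :=
      Set.exists_max_image (Set.range x) φ hfin (Set.range_nonempty x)
    replace hφmax : ∀ ω, φ (x ω) ≤ φ (x ω₃) := fun ω => hφmax _ ⟨ω, rfl⟩
    by_cases h30 : x ω₃ = x ω₀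
    swap
    · exact h.exists_hasValue_relabel hx (hcoarse x v hx hn) hmin hφJ hinj h30 hφmax
    -- Here `φ` is largest on the lowest cell, where relabelling does not apply. Exchanging the
    -- lowest value with a middle one first makes another cell the lowest.
    set σ := Equiv.swap (x ω₀) (x ω₂) with hσ
    have hσ1 : σ (x ω₁) = x ω₁ := Equiv.swap_apply_of_ne_of_ne (hlt02.trans hlt21).ne' h21.symm
    have hσmem : ∀ ω, ∃ ω', σ (x ω) = x ω' := fun ω => by
      rw [hσ, Equiv.swap_apply_def]
      split_ifs
      · exact ⟨ω₂, rfl⟩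
      · exact ⟨ω₀, rfl⟩
      · exact ⟨ω, rfl⟩
    obtain ⟨w', hw'⟩ := h.exists_hasValue_relabel hx (hcoarse x v hx hn) hmin (φ := σ)
      (fun ω => by obtain ⟨ω', he⟩ := hσmem ω; rw [he]; exact hx.mem ω')
      σ.injective.injOn (ω₁ := ω₁) (hlt02.trans hlt21).ne' (fun ω => by
        obtain ⟨ω', he⟩ := hσmem ω
        rw [he, hσ1]
        exact hmax ω')
    have hσσ : ∀ r, σ (σ r) = r := fun r => by rw [hσ, Equiv.swap_apply_self]
    have hσ0 : σ (x ω₀) = x ω₂ := Equiv.swap_apply_left _ _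
    have hσ2 : σ (x ω₂) = x ω₀ := Equiv.swap_apply_right _ _
    obtain ⟨w, hw⟩ := h.exists_hasValue_relabel hw'
      (hcoarse _ w' hw' (hcard σ σ.injective.injOn)) (ω₀ := ω₂) (fun ω => by
        obtain ⟨ω', he⟩ := hσmem ω
        rw [hσ2, he]
        exact hmin ω') (φ := fun r => φ (σ r)) (fun ω => by rw [hσσ]; exact hφJ ω)
      (by
        rintro _ ⟨ω, rfl⟩ _ ⟨ω', rfl⟩ he
        simp only [hσσ] at he
        simp only [hinj ⟨ω, rfl⟩ ⟨ω', rfl⟩ he])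
      (ω₁ := ω₀) (by rw [hσ0, hσ2]; exact h20) (fun ω => by
        simp only [hσσ]
        rw [← h30]
        exact hφmax ω)
    simp only [hσσ] at hw
    exact ⟨w, hw⟩
  obtain ⟨w, hw⟩ := hex
  have hstar := hcoarse _ w hw (hcard φ hinj)
  have hd : φ (x ω₀) ≠ φ (x ω₁) ∧ φ (x ω₀) ≠ φ (x ω₂) ∧ φ (x ω₁) ≠ φ (x ω₂) :=
    ⟨fun he => (hlt02.trans hlt21).ne (hinj ⟨ω₀, rfl⟩ ⟨ω₁, rfl⟩ he),
      fun he => hlt02.ne (hinj ⟨ω₀, rfl⟩ ⟨ω₂, rfl⟩ he),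
      fun he => hlt21.ne' (hinj ⟨ω₁, rfl⟩ ⟨ω₂, rfl⟩ he)⟩
  have hval : w = integral P fun ω => φ (x ω) := by
    have key : ∀ a b c : Ω, φ (x a) < φ (x b) → φ (x b) < φ (x c) →
        w = integral P fun ω => φ (x ω) := fun a b c hab hbc =>
      h.value_eq_integral_of_three hw hstar hab hbc
    obtain ⟨h01, h02, h12⟩ := hd
    rcases lt_or_gt_of_ne h01 with a1 | a1 <;> rcases lt_or_gt_of_ne h02 with a2 | a2 <;>
      rcases lt_or_gt_of_ne h12 with a3 | a3
    · exact key _ _ _ a1 a3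
    · exact key _ _ _ a2 a3
    · exact key _ _ _ a2 a1
    · exact key _ _ _ a2 a1
    · exact key _ _ _ a1 a2
    · exact key _ _ _ a1 a2
    · exact key _ _ _ a3 a2
    · exact key _ _ _ a3 a1
  rw [← hval]
  exact hw

theorem hasValue_comp (hx : HasValue R u x v) (φ : ℝ → ℝ)
    (hφ : ∀ ω, φ (x ω) ∈ Set.range (util u)) :
    HasValue R u (fun ω => φ (x ω)) (integral P fun ω => φ (x ω)) :=
  h.hasValue_comp_aux _ x v hx rfl φ hφ

theorem hasValue_of_fibers (hx : HasValue R u x v) (hxy : ∀ ω ω', x ω = x ω' → y ω = y ω')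
    (hyJ : ∀ ω, y ω ∈ Set.range (util u)) : HasValue R u y (integral P y) := by
  obtain ⟨φ, rfl⟩ := (Function.factorsThrough_iff y).1 fun ω ω' => hxy ω ω'
  exact h.hasValue_comp hx φ hyJ

theorem value_eq_integral (hx : HasValue R u x v) : v = integral P x :=
  h.value_unique hx (h.hasValue_comp hx id hx.mem)

end ProbabilityModel

end GoodPartitions

/-! ### Whether an act is well-understood depends on its number of non-null cells. -/

section Capacity

variable {Ω Z : Type*} {Sig : BooleanSubalgebra (Set Ω)} {R : Act Z Sig → Act Z Sig → Prop}
  {u : Z → ℝ} {P : MeasureTheory.AddContent ℝ≥0 (Sig : Set (Set Ω))}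

/-- All acts that are measurable with respect to the labelling `s` are well-understood. -/
def IsUnderstood {ι : Type*} (R : Act Z Sig → Act Z Sig → Prop) (u : Z → ℝ) (s : Ω → ι) : Prop :=
  ∀ x : Ω → ℝ, (∀ ω ω', s ω = s ω' → x ω = x ω') → (∀ ω, x ω ∈ Set.range (util u)) →
    ∃ v, HasValue R u x v

theorem content_ne_zero_of_mem_essRange {α ι : Type*} {atom : Ω → α} (hatom : IsSimple Sig atom)
    {s : α → ι} {i : ι} (h : ∃ a ∈ essRange P atom, s a = i) :
    P ((fun ω => s (atom ω)) ⁻¹' {i}) ≠ 0 := by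
  obtain ⟨a, ha, rfl⟩ := h
  refine fun h0 => ha (content_eq_zero_of_subset (hatom.preimage_mem _)
    ((hatom.comp s).preimage_mem _) ?_ h0)
  rintro ω rfl
  rfl

theorem exists_mem_essRange {α ι : Type*} {atom : Ω → α} (hatom : IsSimple Sig atom)
    {s : α → ι} {i : ι} (h : P ((fun ω => s (atom ω)) ⁻¹' {i}) ≠ 0) :
    ∃ a ∈ essRange P atom, s a = i := by
  by_contra! hne
  refine h (content_preimage_eq_zero hatom (S := s ⁻¹' {i}) fun a ha => ?_)
  by_contra h0
  exact hne a h0 ha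

theorem mem_range_of_mem_essRange {α ι : Type*} {atom : Ω → α}
    {s : α → ι} {i : ι} (h : ∃ a ∈ essRange P atom, s a = i) :
    i ∈ Set.range fun ω => s (atom ω) := by
  obtain ⟨a, ha, rfl⟩ := h
  obtain ⟨ω, rfl⟩ := essRange_subset_range _ ha
  exact ⟨ω, rfl⟩

namespace ProbabilityModel

variable {x y : Ω → ℝ} {v w : ℝ} (h : ProbabilityModel R u P)
include h

theorem isUnderstood_of_ker {ι : Type*} {s : Ω → ι} (hy : HasValue R u y w)
    (hker : ∀ ω ω', y ω = y ω' → s ω = s ω') : IsUnderstood R u s := fun _ hx hxJ =>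
  ⟨_, h.hasValue_of_fibers hy (fun ω ω' he => hx _ _ (hker ω ω' he)) hxJ⟩

/-- The utility range contains a non-degenerate interval. Distinct utilities turn a labelling into
the partition of an act. -/
theorem exists_injective_utils (n : ℕ) :
    ∃ e : Fin n → ℝ, Function.Injective e ∧ ∀ i, e i ∈ Set.range (util u) := by
  obtain ⟨p, hp, q, hq, hpq⟩ := h.exists_lt
  have hinf : (Set.range (util u)).Infinite :=
    (Set.Icc_infinite hpq).mono ((utilRange_ordConnected u).out hp hq)
  let e := hinf.natEmbedding
  exact ⟨fun i => e i, fun i j hij => Fin.ext (e.injective (Subtype.ext hij)), fun i => (e i).2⟩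

/-- (A3) applies to an act with distinct utilities on the labels of `s`. One well-understood act
with the new partition settles all acts measurable for it. -/
theorem isUnderstood_repartition {n : ℕ} {s s' : Ω → Fin n}
    (hs' : IsSimple Sig s') (hgood : IsUnderstood R u s) {i j : Fin n} (hij : i ≠ j)
    (hi : P (s ⁻¹' {i}) ≠ 0) (hj : P (s ⁻¹' {j}) ≠ 0) (hi' : i ∈ Set.range s')
    (hj' : j ∈ Set.range s') (hreg : ∀ ω, (s' ω = i ∨ s' ω = j) ↔ (s ω = i ∨ s ω = j))
    (hout : ∀ ω, ¬ (s ω = i ∨ s ω = j) → s' ω = s ω) : IsUnderstood R u s' := by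
  obtain ⟨e, he, heJ⟩ := h.exists_injective_utils n
  obtain ⟨v, hv⟩ := hgood (fun ω => e (s ω)) (fun ω ω' hω => by rw [hω]) fun ω => heJ _
  have hmem : ∀ k, P (s ⁻¹' {k}) ≠ 0 → ∃ ω, s ω = k := fun k hk =>
    essRange_subset_range (P := P) s hk
  have hpre : ∀ ω, (fun ω => e (s ω)) ⁻¹' {e (s ω)} = s ⁻¹' {s ω} := fun ω => by
    ext ω'
    exact he.eq_iff
  obtain ⟨ω₁, hω₁⟩ := hmem i hi
  obtain ⟨ω₂, hω₂⟩ := hmem j hj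
  obtain ⟨y, w, hy, hker⟩ := h.exists_hasValue_repartition hv (ω₁ := ω₁) (ω₂ := ω₂)
    (fun heq => hij (by rw [← hω₁, ← hω₂]; exact he heq))
    (by rw [h.nonNull_iff]; change P ((fun ω => e (s ω)) ⁻¹' {e (s ω₁)}) ≠ 0
        rwa [hpre, hω₁])
    (by rw [h.nonNull_iff]; change P ((fun ω => e (s ω)) ⁻¹' {e (s ω₂)}) ≠ 0
        rwa [hpre, hω₂])
    hs' hi' hj' hij (fun ω => by
      simp only [he.eq_iff, hω₁, hω₂]
      exact hreg ω) (fun ω ω' hω hω' => by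
      simp only [he.eq_iff, hω₁, hω₂] at hω hω' ⊢
      rw [hout ω hω, hout ω' hω'])
  exact h.isUnderstood_of_ker hy fun ω ω' heq => (hker ω ω').1 heq

/-- The labellings differ on null atoms only, so (A4) carries values across. -/
theorem isUnderstood_congr {α : Type*} {n : ℕ} {atom : Ω → α} (hatom : IsSimple Sig atom)
    {s t : α → Fin n} (ht : ∀ i, ∃ a ∈ essRange P atom, t a = i)
    (hst : ∀ a ∈ essRange P atom, s a = t a)
    (hgood : IsUnderstood R u fun ω => s (atom ω)) : IsUnderstood R u fun ω => t (atom ω) := by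
  intro x hx hxJ
  obtain ⟨φ, hφ⟩ := (Function.factorsThrough_iff x).1 fun ω ω' => hx ω ω'
  have hφ' : ∀ ω, x ω = φ (t (atom ω)) := fun ω => congrFun hφ ω
  obtain ⟨v, hv⟩ := hgood (fun ω => φ (s (atom ω))) (fun ω ω' he => by simp only at he; rw [he])
    fun ω => by
      -- As `t` uses every label, the number attached to the label `s (atom ω)` is a value of `x`,
      -- hence a utility.
      obtain ⟨ω', hω'⟩ := mem_range_of_mem_essRange (ht (s (atom ω)))
      simp only at hω'
      rw [← hω', ← hφ']
      exact hxJ ω'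
  have hE : P (atom ⁻¹' {a | s a ≠ t a}) = 0 := by
    refine content_preimage_eq_zero hatom fun a ha => ?_
    by_contra h0
    exact ha (hst a h0)
  refine ⟨v, h.hasValue_congr_null hv (E := ⟨_, hatom.preimage_mem {a | s a ≠ t a}⟩)
    ((h.nonNull_iff _).not.2 (not_not.2 hE))
    (((hatom.comp t).congr_fibers hx)) hxJ fun ω hω => ?_⟩
  have hω' : s (atom ω) = t (atom ω) := not_not.1 hω
  rw [hφ', hω']

open Classical in
/-- Any two labellings of finitely many atoms that use every label with positive probability are
connected by repartitions of pairs of cells. -/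
theorem isUnderstood_connected {α : Type*} [Fintype α] {n : ℕ} {atom : Ω → α}
    (hatom : IsSimple Sig atom) {t : α → Fin n} (ht : ∀ i, ∃ a ∈ essRange P atom, t a = i)
    (k : ℕ) : ∀ s : α → Fin n, (∀ i, ∃ a ∈ essRange P atom, s a = i) →
      {a | a ∈ essRange P atom ∧ s a ≠ t a}.ncard = k →
      IsUnderstood R u (fun ω => s (atom ω)) → IsUnderstood R u fun ω => t (atom ω) := by
  induction k using Nat.strong_induction_on with
  | _ k ih =>
  intro s hs hk hgood
  by_cases hbad : ∃ a ∈ essRange P atom, s a ≠ t a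
  swap
  · push Not at hbad
    exact h.isUnderstood_congr hatom ht hbad hgood
  have hstep : ∀ s' : α → Fin n, (∀ i, ∃ a ∈ essRange P atom, s' a = i) →
      ∀ i j : Fin n, i ≠ j → (∀ a, (s' a = i ∨ s' a = j) ↔ (s a = i ∨ s a = j)) →
      (∀ a, ¬ (s a = i ∨ s a = j) → s' a = s a) →
      {a | a ∈ essRange P atom ∧ s' a ≠ t a} ⊂ {a | a ∈ essRange P atom ∧ s a ≠ t a} →
      IsUnderstood R u fun ω => t (atom ω) := by
    intro s' hs' i j hij hreg hout hlt
    refine ih _ (hk ▸ Set.ncard_lt_ncard hlt (Set.toFinite _)) s' hs' rfl ?_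
    exact h.isUnderstood_repartition (hatom.comp s') hgood hij
      (content_ne_zero_of_mem_essRange hatom (hs i)) (content_ne_zero_of_mem_essRange hatom (hs j))
      (mem_range_of_mem_essRange (hs' i)) (mem_range_of_mem_essRange (hs' j))
      (fun ω => hreg _) fun ω => hout _
  -- A misplaced atom that shares its cell with another non-null atom can move to its target cell,
  -- leaving its old cell non-null.
  by_cases hbig : ∃ a ∈ essRange P atom, s a ≠ t a ∧ ∃ b ∈ essRange P atom, b ≠ a ∧ s b = s a
  · obtain ⟨a, ha, hat, b, hb, hba, hsb⟩ := hbig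
    have hupd : ∀ c, c ≠ a → Function.update s a (t a) c = s c := fun c hc =>
      Function.update_of_ne hc _ _
    refine hstep (Function.update s a (t a)) (fun i => ?_) (s a) (t a) hat (fun c => ?_)
      (fun c hc => ?_) ?_
    · by_cases hi : i = s a
      · exact ⟨b, hb, by rw [hupd b hba, hsb, hi]⟩
      · obtain ⟨c, hc, rfl⟩ := hs i
        exact ⟨c, hc, hupd c fun hca => hi (by rw [hca])⟩
    · by_cases hc : c = a
      · rw [hc, Function.update_self]
        exact ⟨fun _ => Or.inl rfl, fun _ => Or.inr rfl⟩
      · rw [hupd c hc]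
    · exact hupd c fun hca => hc (Or.inl (by rw [hca]))
    · refine Set.ssubset_iff_of_subset ?_ |>.2 ⟨a, ⟨ha, hat⟩, fun h' => h'.2 ?_⟩
      · rintro c ⟨hc, hct⟩
        by_cases hca : c = a
        · rw [hca, Function.update_self] at hct
          exact absurd rfl hct
        · exact ⟨hc, by rwa [hupd c hca] at hct⟩
      · rw [Function.update_self]
  -- Each misplaced atom is now the only non-null one in its cell. Some non-null `b` has the label
  -- of `a` as its target and is itself misplaced. Exchanging the labels of `a` and `b` puts `b` in
  -- place and keeps both cells non-null.
  · push Not at hbig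
    obtain ⟨a, ha, hat⟩ := hbad
    obtain ⟨b, hb, htb⟩ := ht (s a)
    have hba : b ≠ a := fun he => hat (by rw [← htb, he])
    have hsb : s b ≠ s a := hbig a ha hat b hb hba
    have hbt : s b ≠ t b := by rw [htb]; exact hsb
    set s' := Function.update (Function.update s a (s b)) b (s a) with hs'
    have hs'b : s' b = s a := by rw [hs', Function.update_self]
    have hs'a : s' a = s b := by rw [hs', Function.update_of_ne hba.symm, Function.update_self]
    have hupd : ∀ c, c ≠ a → c ≠ b → s' c = s c := fun c hca hcb => by
      rw [hs', Function.update_of_ne hcb, Function.update_of_ne hca]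
    refine hstep s' (fun i => ?_) (s a) (s b) hsb.symm (fun c => ?_) (fun c hc => ?_) ?_
    · by_cases hia : i = s a
      · exact ⟨b, hb, hia ▸ hs'b⟩
      by_cases hib : i = s b
      · exact ⟨a, ha, hib ▸ hs'a⟩
      obtain ⟨c, hc, rfl⟩ := hs i
      exact ⟨c, hc, hupd c (fun he => hia (by rw [he])) fun he => hib (by rw [he])⟩
    · by_cases hca : c = a
      · rw [hca, hs'a]
        exact ⟨fun _ => Or.inl rfl, fun _ => Or.inr rfl⟩
      by_cases hcb : c = b
      · rw [hcb, hs'b]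
        exact ⟨fun _ => Or.inr rfl, fun _ => Or.inl rfl⟩
      rw [hupd c hca hcb]
    · exact hupd c (fun he => hc (Or.inl (by rw [he]))) fun he => hc (Or.inr (by rw [he]))
    · refine Set.ssubset_iff_of_subset ?_ |>.2 ⟨b, ⟨hb, hbt⟩, fun h' => h'.2 ?_⟩
      · rintro c ⟨hc, hct⟩
        by_cases hca : c = a
        · exact hca ▸ ⟨ha, hat⟩
        by_cases hcb : c = b
        · exact hcb ▸ ⟨hb, hbt⟩
        exact ⟨hc, by rwa [hupd c hca hcb] at hct⟩
      · rw [hs'b, htb]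

/-- An act with at most as many non-null cells as a well-understood act is well-understood. -/
theorem exists_hasValue_of_essRange_le (hy : HasValue R u y w) (hx : IsSimple Sig x)
    (hxJ : ∀ ω, x ω ∈ Set.range (util u))
    (hle : (essRange P x).ncard ≤ (essRange P y).ncard) : ∃ v, HasValue R u x v := by
  set n := (essRange P x).ncard with hn
  obtain ⟨E, hE, hE0, hess⟩ := ae_mem_essRange (P := P) hx
  obtain ⟨ω₀, hω₀⟩ := exists_notMem_of_null h.prob hE0
  have hfinx : Finite (essRange P x) := hx.finite_range.subset (essRange_subset_range x)
  have hfiny : Finite (essRange P y) :=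
    hy.isSimple.finite_range.subset (essRange_subset_range y)
  have := Fintype.ofFinite (essRange P y)
  have hnpos : 0 < n := by
    rw [hn, Set.ncard_pos hfinx]
    exact ⟨_, hess ω₀ hω₀⟩
  have : Nonempty (Fin n) := ⟨⟨0, hnpos⟩⟩
  obtain ⟨f⟩ : Nonempty (Fin n ↪ essRange P y) := by
    refine Function.Embedding.nonempty_of_card_le ?_
    rwa [Fintype.card_fin, ← Nat.card_eq_fintype_card, Nat.card_coe_set_eq]
  let g : essRange P x ≃ Fin n := Finite.equivFinOfCardEq (Nat.card_coe_set_eq _)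
  -- `ρ` and `τ` number `n` of the essential values of `y` and all those of `x`, with arbitrary
  -- labels elsewhere. The atoms are the pairs of labels.
  let ρ : ℝ → Fin n := Function.invFun fun i => (f i : ℝ)
  let τ : ℝ → Fin n := Function.invFun fun i => (g.symm i : ℝ)
  have hρ : ∀ i, ρ (f i) = i :=
    Function.leftInverse_invFun (f := fun i => (f i : ℝ))
      (Subtype.val_injective.comp f.injective)
  have hτ : ∀ i, τ (g.symm i) = i :=
    Function.leftInverse_invFun (f := fun i => (g.symm i : ℝ))
      (Subtype.val_injective.comp g.symm.injective)
  have hatom : IsSimple Sig fun ω => (ρ (y ω), τ (x ω)) :=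
    (hy.isSimple.comp ρ).prodMk (hx.comp τ)
  have hgood : IsUnderstood R u fun ω => τ (x ω) := by
    refine h.isUnderstood_connected (t := Prod.snd) hatom
      (fun i => exists_mem_essRange hatom ?_) _ Prod.fst
      (fun i => exists_mem_essRange hatom ?_) rfl
      (h.isUnderstood_of_ker hy fun ω ω' he => congrArg ρ he)
    · exact content_ne_zero_of_mem_essRange hx ⟨_, (g.symm i).2, hτ i⟩
    · exact content_ne_zero_of_mem_essRange hy.isSimple ⟨_, (f i).2, hρ i⟩
  obtain ⟨v, hv⟩ := hgood (fun ω => g.symm (τ (x ω))) (fun ω ω' he => by simp only at he; rw [he])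
    fun ω => by
      obtain ⟨ω', hω'⟩ := essRange_subset_range x (g.symm (τ (x ω))).2
      rw [← hω']
      exact hxJ ω'
  refine ⟨v, h.hasValue_congr_null hv (E := ⟨E, hE⟩)
    ((h.nonNull_iff _).not.2 (not_not.2 hE0)) hx hxJ fun ω hω => ?_⟩
  have := hτ (g ⟨x ω, hess ω hω⟩)
  rw [Equiv.symm_apply_apply] at this
  change τ (x ω) = _ at this
  simp only [this, Equiv.symm_apply_apply]

/-- After a change on a null event the act is a bet. -/
theorem exists_hasValue_of_essRange_le_two (hx : IsSimple Sig x)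
    (hxJ : ∀ ω, x ω ∈ Set.range (util u)) (hle : (essRange P x).encard ≤ 2) :
    ∃ v, HasValue R u x v := by
  classical
  obtain ⟨E, hE, hE0, hess⟩ := ae_mem_essRange (P := P) hx
  obtain ⟨ω₀, hω₀⟩ := exists_notMem_of_null h.prob hE0
  have hpair : ∃ b ∈ essRange P x, essRange P x ⊆ {x ω₀, b} := by
    by_cases hsub : essRange P x ⊆ {x ω₀}
    · exact ⟨x ω₀, hess ω₀ hω₀, hsub.trans (by simp)⟩
    · obtain ⟨b, hb, hbne⟩ := Set.not_subset.1 hsub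
      refine ⟨b, hb, fun c hc => ?_⟩
      by_contra hne
      simp only [Set.mem_insert_iff, Set.mem_singleton_iff, not_or] at hne hbne
      have h3 : ({c, x ω₀, b} : Set ℝ).encard ≤ 2 := (Set.encard_le_encard (by
        rintro _ (rfl | rfl | rfl)
        · exact hc
        · exact hess ω₀ hω₀
        · exact hb)).trans hle
      rw [Set.encard_insert_of_notMem (by simpa using hne),
        Set.encard_pair (Ne.symm hbne)] at h3
      exact absurd h3 (by decide)
  obtain ⟨b, hb, hsub⟩ := hpair
  have hbJ : b ∈ Set.range (util u) := by
    obtain ⟨ω', rfl⟩ := essRange_subset_range x hb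
    exact hxJ ω'
  have hs := IsSimple.ite hE (IsSimple.const Sig (x ω₀)) hx
  have hv := h.hasValue_of_two_values hs (hxJ ω₀) hbJ fun ω => by
    split_ifs with hω
    · exact Or.inl rfl
    · exact hsub (hess ω hω)
  exact ⟨_, h.hasValue_congr_null hv (E := ⟨E, hE⟩)
    ((h.nonNull_iff _).not.2 (not_not.2 hE0)) hx hxJ fun ω hω => (if_neg hω).symm⟩

/-- The capacity: acts are well-understood iff their number of non-null cells does not
exceed it. -/
theorem exists_capacity : ∃ N : ℕ∞, 2 ≤ N ∧ ∀ x : Ω → ℝ, IsSimple Sig x →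
    (∀ ω, x ω ∈ Set.range (util u)) →
      ((∃ v, HasValue R u x v) ↔ (essRange P x).encard ≤ N) := by
  -- The supremum is only 1 when `P` takes no values besides 0 and 1, whence the maximum with 2.
  refine ⟨max 2 (⨆ y : {y : Ω → ℝ // ∃ v, HasValue R u y v}, (essRange P y.1).encard),
    le_max_left _ _, fun x hx hxJ => ⟨fun hv => ?_, fun hle => ?_⟩⟩
  · exact (le_iSup (fun y : {y : Ω → ℝ // ∃ v, HasValue R u y v} => (essRange P y.1).encard)
      ⟨x, hv⟩).trans (le_max_right _ _)
  · rcases le_max_iff.1 hle with hle | hle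
    · exact h.exists_hasValue_of_essRange_le_two hx hxJ hle
    · have hfin : (essRange P x).Finite := hx.finite_range.subset (essRange_subset_range x)
      obtain ⟨E, hE, hE0, hess⟩ := ae_mem_essRange (P := P) hx
      obtain ⟨ω₀, hω₀⟩ := exists_notMem_of_null h.prob hE0
      have hpos : 0 < (essRange P x).ncard := (Set.ncard_pos hfin).2 ⟨_, hess ω₀ hω₀⟩
      -- Subtracting 1 makes the inequality strict. So some well-understood `y` has at least as many
      -- essential values as `x`, although the supremum need not be attained.
      have hlt : (((essRange P x).ncard - 1 : ℕ) : ℕ∞) <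
          ⨆ y : {y : Ω → ℝ // ∃ v, HasValue R u y v}, (essRange P y.1).encard := by
        refine lt_of_lt_of_le ?_ hle
        rw [← hfin.cast_ncard_eq, Nat.cast_lt]
        omega
      obtain ⟨⟨y, w, hy⟩, hlt⟩ := lt_iSup_iff.1 hlt
      have hfiny : (essRange P y).Finite :=
        hy.isSimple.finite_range.subset (essRange_subset_range y)
      rw [← hfiny.cast_ncard_eq, Nat.cast_lt] at hlt
      exact h.exists_hasValue_of_essRange_le hy hx hxJ (by omega)

end ProbabilityModel

end Capacity

/-! ### From the axioms to the common representation. -/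

section Sufficiency

variable {Ω Z : Type*} {Sig : BooleanSubalgebra (Set Ω)} {R R' : Act Z Sig → Act Z Sig → Prop}
  {u : Z → ℝ} {P : MeasureTheory.AddContent ℝ≥0 (Sig : Set (Set Ω))} {N : ℕ∞}

/-- Uniform Comparability puts well-understood acts between `f` and `g`, and the bounds of these are
their integrals. In the other direction the extremal acts below `f` and above `g` form such a pair.
-/
theorem ProbabilityModel.isSimpleBoundsRep (h : ProbabilityModel R u P)
    (hUC : UniformComparability R) (hN : 2 ≤ N)
    (hcap : ∀ x : Ω → ℝ, IsSimple Sig x → (∀ ω, x ω ∈ Set.range (util u)) →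
      ((∃ v, HasValue R u x v) ↔ (essRange P x).encard ≤ N)) :
    IsSimpleBoundsRep R N P u := by
  have hparam : IsParam N P u := ⟨hN, h.prob, h.nonconst⟩
  have hN1 := hparam.one_le
  have hval : ∀ f : Act Z Sig, (essRange P (profile u f)).encard ≤ N →
      HasValue R u (profile u f) (integral P (profile u f)) := fun f hf => by
    obtain ⟨v, hv⟩ := (hcap _ (isSimple_profile u f) (profile_mem u f)).2 hf
    rwa [h.value_eq_integral hv] at hv
  have hwu : ∀ f : Act Z Sig, WellUnderstood R f → (essRange P (profile u f)).encard ≤ N :=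
    fun f hf => (hcap _ (isSimple_profile u f) (profile_mem u f)).1
      (UtilityModel.hasValue_of_wellUnderstood hf)
  refine isSimpleBoundsRep_iff.2 ⟨hparam, fun f g => ⟨fun hfg => ?_, fun hfg => ?_⟩⟩
  · by_cases hdom : Dominates R f g
    · exact Or.inl fun ω => (h.const_iff _ _).1 (hdom ω)
    · right
      obtain ⟨k, l, hk, hl, hfk, hkl, hlg⟩ := (hUC f g hdom).1 hfg
      have hk' := hwu k hk
      have hl' := hwu l hl
      calc upperInt N P (profile u g) ≤ upperInt N P (profile u l) :=
            upperInt_mono h.prob hN1 (isSimple_profile u g) (isSimple_profile u l)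
              (AELE.of_le fun ω => (h.const_iff _ _).1 (hlg ω))
        _ = integral P (profile u l) :=
            upperInt_eq_integral h.prob hN1 (isSimple_profile u l) hl'
        _ ≤ integral P (profile u k) := (h.rel_iff (hval k hk') (hval l hl')).1 hkl
        _ = lowerInt N P (profile u k) :=
            (lowerInt_eq_integral h.prob hN1 (isSimple_profile u k) hk').symm
        _ ≤ lowerInt N P (profile u f) :=
            lowerInt_mono h.prob hN1 (isSimple_profile u k) (isSimple_profile u f)
              (AELE.of_le fun ω => (h.const_iff _ _).1 (hfk ω))
  · rcases hfg with hle | hle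
    · exact h.rel_of_le hle
    · obtain ⟨k, hk1, hk2, hk3⟩ := exists_act_below (u := u) h.prob hN1 f
      obtain ⟨l, hl1, hl2, hl3⟩ := exists_act_above (u := u) h.prob hN1 g
      refine h.rel_trans (h.rel_of_le hk2) (h.rel_trans ?_ (h.rel_of_le hl2))
      rw [h.rel_iff (hval k hk1) (hval l hl1), hk3, hl3]
      exact hle

/-- Each `f` is indifferent under `R'` to a constant `c` of utility `lowerInt`. One half is
Consistency. For the other, Caution ranks above `f` all constants strictly better than `c`, and
continuity passes to the limit. -/
theorem IsSimpleBoundsRep.isCautiousRep (h : IsSimpleBoundsRep R N P u)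
    (hpre : IsPreorderRel R') (harch : ArchimedeanContinuity R') (hcons : Consistency R R')
    (hstrong : StrongConsistencyForSimpleActs R R') (hcaut : Caution R R') :
    IsCautiousRep R' N P u := by
  have hP := h.prob
  have hN := h.one_le
  have hequiv : ∀ f : Act Z Sig, ∃ c : Lottery Z, util u c = lowerInt N P (profile u f) ∧
      Indiff R' f (Act.const Sig c) := by
    intro f
    obtain ⟨k, -, hk2, hk3⟩ := exists_act_below (u := u) hP hN f
    obtain ⟨c, hc⟩ := exists_lottery_integral (u := u) hP k
    rw [hk3] at hc
    refine ⟨c, hc, hcons _ _ ((h.rel_const_iff f c).2 hc.le), ?_⟩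
    by_cases hbetter : ∃ d : Lottery Z, util u c < util u d
    · obtain ⟨d, hd⟩ := hbetter
      have hcl := (harch (Act.const Sig d) (Act.const Sig c) f).1
      have hpos : ∀ t : unitInterval, 0 < t →
          R' (Act.mix t (Act.const Sig d) (Act.const Sig c)) f := by
        intro t ht
        have ht' : (0 : ℝ) < t := ht
        refine hcaut f (Lottery.mix t d c) fun hR => ?_
        rw [h.rel_const_iff, util_mix, ← hc] at hR
        have := mul_pos ht' (sub_pos.2 hd)
        linarith
      have hmem : (0 : unitInterval) ∈
          {t : unitInterval | R' (Act.mix t (Act.const Sig d) (Act.const Sig c)) f} := by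
        refine closure_minimal (s := Set.Ioi 0) (fun t ht => hpos t ht) hcl ?_
        rw [closure_Ioi' ⟨1, zero_lt_one⟩]
        exact Set.self_mem_Ici
      have he : Act.mix 0 (Act.const Sig d) (Act.const Sig c) = Act.const Sig c := by
        change Act.const Sig (Lottery.mix 0 d c) = _
        rw [Lottery.mix_zero]
      rwa [Set.mem_ofPred_eq, he] at hmem
    -- If no lottery is better than `c`, there is nothing to approach it from, but `c` dominates
    -- every act and Consistency suffices.
    · push Not at hbetter
      refine hcons _ _ ((h.const_rel_iff f c).2 ?_)
      rw [← upperInt_const (P := P) (N := N) hP hN (util u c)]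
      exact upperInt_mono hP hN (isSimple_profile u f) (IsSimple.const Sig _)
        (AELE.of_le fun ω => hbetter (f ω))
  refine isCautiousRep_iff.2 ⟨h.1, fun f g => ?_⟩
  obtain ⟨c, hc, hfc⟩ := hequiv f
  obtain ⟨d, hd, hgd⟩ := hequiv g
  have hwu : ∀ e : Lottery Z, WellUnderstood R (Act.const Sig e) := fun e =>
    ⟨e, h.basicConditions.preorder.1 _, h.basicConditions.preorder.1 _⟩
  rw [← hc, ← hd, ← h.const_const_iff, hstrong _ _ (hwu c) (hwu d)]
  exact ⟨fun hfg => hpre.2 _ _ _ hfc.2 (hpre.2 _ _ _ hfg hgd.1),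
    fun hcd => hpre.2 _ _ _ hfc.1 (hpre.2 _ _ _ hcd hgd.2)⟩

theorem exists_isCommonRep (hB : BasicConditions R) (hS : SimplicityConditions R)
    (hSI : SIndependence R) (hUC : UniformComparability R) (hpre : IsPreorderRel R')
    (harch : ArchimedeanContinuity R') (hcons : Consistency R R')
    (hstrong : StrongConsistencyForSimpleActs R R') (hcaut : Caution R R') :
    ∃ (N : ℕ∞) (P : MeasureTheory.AddContent ℝ≥0 (Sig : Set (Set Ω))) (u : Z → ℝ),
      IsCommonRep R R' N P u := by
  obtain ⟨u, hne, hu⟩ := hB.exists_utility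
  have hU : UtilityModel R u := ⟨hB, hS, hSI, hne, hu⟩
  obtain ⟨P, hP, hbet⟩ := hU.exists_probability
  have hM : ProbabilityModel R u P := ⟨hU, hP, hbet⟩
  obtain ⟨N, hN, hcap⟩ := hM.exists_capacity
  have hrep := hM.isSimpleBoundsRep hUC hN hcap
  exact ⟨N, P, u, hrep, hrep.isCautiousRep hpre harch hcons hstrong hcaut⟩

end Sufficiency

end SimpleBounds

theorem theorem4 {Ω Z : Type*} (Sig : BooleanSubalgebra (Set Ω))
    (R R' : SimpleBounds.Act Z Sig → SimpleBounds.Act Z Sig → Prop) :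
    ((SimpleBounds.BasicConditions R ∧ SimpleBounds.SimplicityConditions R ∧
        SimpleBounds.SIndependence R ∧ SimpleBounds.UniformComparability R ∧
        SimpleBounds.IsPreorderRel R' ∧ SimpleBounds.ArchimedeanContinuity R' ∧
        SimpleBounds.Consistency R R' ∧ SimpleBounds.StrongConsistencyForSimpleActs R R' ∧
        SimpleBounds.Caution R R') ↔
      ∃ (N : ℕ∞) (P : MeasureTheory.AddContent NNReal (Sig : Set (Set Ω))) (u : Z → ℝ),
        SimpleBounds.IsCommonRep R R' N P u) ∧
    ∀ (N : ℕ∞) (P : MeasureTheory.AddContent NNReal (Sig : Set (Set Ω))) (u : Z → ℝ),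
      SimpleBounds.IsCommonRep R R' N P u →
        (∀ f, (SimpleBounds.simInf N P u f).Nonempty ∧ (SimpleBounds.simSup N P u f).Nonempty) ∧
        (∀ (N' : ℕ∞) (P' : MeasureTheory.AddContent NNReal (Sig : Set (Set Ω))) (u' : Z → ℝ),
          SimpleBounds.IsCommonRep R R' N' P' u' →
            (∀ E ∈ Sig, P' E = P E) ∧ ∃ a b : ℝ, 0 < a ∧ ∀ z, u' z = a * u z + b) ∧
        (∀ a b : ℝ, 0 < a → SimpleBounds.IsCommonRep R R' N P fun z => a * u z + b) := by
  refine ⟨⟨?_, ?_⟩, fun N P u h => ⟨fun f => ?_, fun N' P' u' h' => ?_, fun a b ha => ?_⟩⟩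
  · rintro ⟨hB, hS, hSI, hUC, hpre, harch, hcons, hstrong, hcaut⟩
    exact SimpleBounds.exists_isCommonRep hB hS hSI hUC hpre harch hcons hstrong hcaut
  · rintro ⟨N, P, u, h⟩
    exact ⟨h.1.basicConditions, h.1.simplicityConditions, h.1.sIndependence,
      h.1.uniformComparability, h.2.isPreorderRel, h.2.archimedeanContinuity, h.consistency,
      h.strongConsistency, h.caution⟩
  · exact ⟨SimpleBounds.simInf_nonempty h.1.prob h.1.one_le f,
      SimpleBounds.simSup_nonempty h.1.prob h.1.one_le f⟩
  · exact ⟨fun E hE => h.1.prob_unique h'.1 hE, h.1.utility_unique h'.1⟩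
  · exact h.affine ha b
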